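/- Let $v:(0,\infty)\times\mathbb R^3\to\mathbb R^3$ be a vector field in $L^2(\mathbb R_+,\dot H^1(\mathbb R^3))$ with $\nabla\cdot v(t)=0$ in the sense of distributions for almost every $t>0$, where $\dot H^1(\mathbb R^3)$ is the completion of the space of test functions for the norm $\|\nabla\cdot\|_{L^2}$, realized as a space of locally integrable functions. Let $\varphi_0\in\mathcal D(\mathbb R^3)$ be a real-valued smooth compactly supported function. Then there exists a distributional solution $\varphi$ of the Cauchy problem $$\partial_t\varphi-v\cdot\nabla\varphi-\Delta\varphi=0\ \text{ on }(0,\infty)\times\mathbb R^3,\qquad \varphi(0)=\varphi_0,$$ that is: $\varphi$, its spatial gradient $\nabla\varphi$ in the sense of distributions and the product $v\cdot\nabla\varphi$ are locally integrable functions on $(0,\infty)\times\mathbb R^3$ ($\varphi$ and $v\cdot\nabla\varphi$ also up to $t=0$), the equation holds in $\mathcal D'((0,\infty)\times\mathbb R^3)$, and $\varphi$ is continuous in time with values in distributions, $t\mapsto\int_{\mathbb R^3}\varphi(t)\psi\,dx$ being continuous on $[0,\infty)$ for every $\psi\in\mathcal D(\mathbb R^3)$, with value $\varphi_0$ at $t=0$.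 Moreover, for every $t>0$ and every $j\in\{1,2,3\}$, $$\|\varphi(t)\|_{L^\infty(\mathbb R^3)}\le\|\varphi_0\|_{L^\infty(\mathbb R^3)}$$ and $$\|\partial_j\varphi(t)\|_{L^2(\mathbb R^3)}^2+\int_0^t\|\nabla\partial_j\varphi(s)\|_{L^2(\mathbb R^3)}^2\,ds\le\|\partial_j\varphi_0\|_{L^2(\mathbb R^3)}^2+\|\varphi_0\|_{L^\infty(\mathbb R^3)}^2\,\|\partial_jv\|_{L^2(\mathbb R_+\times\mathbb R^3)}^2,$$ all derivatives of $\varphi$ and $v$ being taken in the sense of distributions. -/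

import Mathlib

open MeasureTheory Set Filter Topology TopologicalSpace
open scoped ENNReal Distributions

/-- Euclidean three-dimensional space. -/
abbrev E3 : Type := EuclideanSpace ℝ (Fin 3)

/-- The `j`-th vector of the standard basis of `ℝ³`. -/
noncomputable def stdVec (j : Fin 3) : E3 := EuclideanSpace.single j 1

/-- The open half space-time `(0, ∞) × ℝ³`. -/
def spaceTime : Opens (ℝ × E3) := ⟨Ioi 0 ×ˢ univ, isOpen_Ioi.prod isOpen_univ⟩

/-- The space direction `e_j` seen in `ℝ × ℝ³`. -/
noncomputable def spaceDir (j : Fin 3) : ℝ × E3 := (0, stdVec j)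

/-- The time direction in `ℝ × ℝ³`. -/
def timeDir : ℝ × E3 := (1, 0)

/-- `g` is the derivative of `u` in the direction `d`, in the sense of distributions on the open
set `Ω`; both are locally integrable functions on `Ω`. -/
def HasWeakDerivOn {V F : Type*} [NormedAddCommGroup V] [NormedSpace ℝ V] [MeasureSpace V]
    [NormedAddCommGroup F] [NormedSpace ℝ F]
    (Ω : Opens V) (d : V) (u g : V → F) : Prop :=
  LocallyIntegrableOn u (Ω : Set V) volume ∧ LocallyIntegrableOn g (Ω : Set V) volume ∧
    ∀ ψ : 𝓓(Ω, ℝ), ∫ x, (fderiv ℝ ψ x d) • u x = - ∫ x, ψ x • g x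

/-- `u` belongs to the homogeneous Sobolev space `Ḣ¹(ℝ³)`, with partial derivatives `Du j = ∂_j u`.
Here `Ḣ¹(ℝ³)` is the completion of the space of test functions for the norm `‖∇ · ‖_{L²}`, realized
as a space of locally integrable functions: the partial derivatives of `u` are in `L²`, and `u` is
the `L¹_loc` limit of test functions whose partial derivatives converge to those of `u` in `L²`. -/
structure MemHomSobolev {F : Type*} [NormedAddCommGroup F] [NormedSpace ℝ F]
    (u : E3 → F) (Du : Fin 3 → E3 → F) : Prop where
  weakDeriv : ∀ j, HasWeakDerivOn (⊤ : Opens E3) (stdVec j) u (Du j)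
  memLp : ∀ j, MemLp (Du j) 2 volume
  approx : ∃ w : ℕ → 𝓓((⊤ : Opens E3), F),
    (∀ K : Set E3, IsCompact K →
      Tendsto (fun n => ∫⁻ x in K, ‖w n x - u x‖ₑ) atTop (𝓝 0)) ∧
    ∀ j, Tendsto (fun n => eLpNorm (fun x => fderiv ℝ (w n) x (stdVec j) - Du j x) 2 volume)
      atTop (𝓝 0)

/-- `v` belongs to `L²(ℝ₊, Ḣ¹(ℝ³))`, with partial derivatives `Dv j = ∂_j v` in space. -/
structure MemL2HomSobolev {F : Type*} [NormedAddCommGroup F] [NormedSpace ℝ F]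
    (v : ℝ → E3 → F) (Dv : Fin 3 → ℝ → E3 → F) : Prop where
  aestronglyMeasurable :
    AEStronglyMeasurable (Function.uncurry v) (volume.restrict (spaceTime : Set (ℝ × E3)))
  slice : ∀ᵐ t ∂(volume.restrict (Ioi (0 : ℝ))), MemHomSobolev (v t) (fun j => Dv j t)
  memLp : ∀ j,
    MemLp (Function.uncurry (Dv j)) 2 (volume.restrict (spaceTime : Set (ℝ × E3)))

/-- The vector field `v(t)` is divergence free, in the sense of distributions, for almost every
positive time `t`. -/
def IsDivergenceFree (v : ℝ → E3 → E3) : Prop :=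
  ∀ᵐ t ∂(volume.restrict (Ioi (0 : ℝ))), ∀ ψ : 𝓓((⊤ : Opens E3), ℝ),
    ∫ x, ∑ i, v t x i * fderiv ℝ ψ x (stdVec i) = 0

/-- The product `v · ∇φ`, with `Dφ i = ∂_i φ`, as a function on space-time. -/
def transportTerm (v : ℝ → E3 → E3) (Dφ : Fin 3 → ℝ → E3 → ℝ) (p : ℝ × E3) : ℝ :=
  ∑ i, v p.1 p.2 i * Dφ i p.1 p.2

/-- The Laplacian in the space variable of a function on space-time. -/
noncomputable def spaceLaplacian (Ψ : ℝ × E3 → ℝ) (p : ℝ × E3) : ℝ :=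
  ∑ i, fderiv ℝ (fun q => fderiv ℝ Ψ q (spaceDir i)) p (spaceDir i)

/-- `φ`, whose partial derivatives in space are `Dφ j = ∂_j φ`, is a distributional solution of
`∂_t φ - v · ∇φ - Δφ = 0` on `(0, ∞) × ℝ³` with initial value `φ(0) = φ₀`.
The initial value is taken in `C([0, ∞), 𝓓'(ℝ³))`, so that `φ(t)` makes sense at every time. -/
structure IsDistributionalSolution (v : ℝ → E3 → E3) (φ₀ : E3 → ℝ)
    (φ : ℝ → E3 → ℝ) (Dφ : Fin 3 → ℝ → E3 → ℝ) : Prop where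
  locallyIntegrable : LocallyIntegrableOn (Function.uncurry φ) (Ici (0 : ℝ) ×ˢ (univ : Set E3))
  weakDeriv : ∀ j, HasWeakDerivOn spaceTime (spaceDir j)
    (Function.uncurry φ) (Function.uncurry (Dφ j))
  locallyIntegrable_transport :
    LocallyIntegrableOn (transportTerm v Dφ) (Ici (0 : ℝ) ×ˢ (univ : Set E3))
  equation : ∀ Ψ : 𝓓(spaceTime, ℝ),
    ∫ p : ℝ × E3, (-(φ p.1 p.2 * fderiv ℝ Ψ p timeDir) - transportTerm v Dφ p * Ψ p
      - φ p.1 p.2 * spaceLaplacian Ψ p) = 0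
  locallyIntegrable_slice : ∀ t, 0 ≤ t → LocallyIntegrable (φ t)
  continuousOn : ∀ ψ : 𝓓((⊤ : Opens E3), ℝ),
    ContinuousOn (fun t => ∫ x, φ t x * ψ x) (Ici (0 : ℝ))
  initial : φ 0 =ᵐ[volume] φ₀

/-! The solution is obtained as a limit of an explicit finite-difference scheme whose space variable
runs over all of `ℝ³` (translations by `h`, no lattice). The scheme is built so that each a priori
bound of the theorem has a discrete counterpart, exact or up to a factor tending to one.

Maximum principle and energy. Transport is discretized in skew-symmetric flux form, with edge
velocities whose discrete divergence vanishes. Under a CFL condition one step is then a convex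
combination of seven values (`abs_eulerStep_le`), which gives the sup bound. A difference quotient
of the solution obeys the same scheme with one extra source, the transport of the shifted solution
by the difference quotient `b` of the velocity (`diffQuot_eulerStep`). When this source is tested
against the difference quotient `f` and summed by parts, the solution appears undifferentiated,
hence bounded by `M`, and `2 M |b| |∇f| ≤ M² |b|² + |∇f|²` consumes exactly one of the two copies of
the dissipation. This explains the constants of the theorem. The explicit time step costs only
relative errors of order `τ / h²` (`integral_sq_step_le`).

Velocities. The edge velocities are averages over time steps of the fluxes of a mollified and
truncated `v` through the faces of cubes of side `h`. The divergence theorem makes them discretely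
divergence free (`BoundedField.sum_face_flux`). Averaging commutes with translations and contracts
`L²`, so their difference quotients are bounded by `∂_j v` with constant one; they converge to `v`
in `L²` on bounded sets (`tendsto_gridAverage`, `exists_approximatingVelocity`).

Limit. The discrete solutions and their difference quotients are bounded in `L²` of every time slab,
hence converge weakly along a subsequence. The velocities converge strongly, so the product passes
to the limit. To have a value at every time, the scheme is tested against functions of space: the
pairings converge at each time to a continuous function of time (`SchemeLimit.tendsto_pairing`), and
an ultrafilter finer than `atTop` selects weak limits at all times simultaneously
(`SchemeLimit.exists_slices`). The energy inequality follows from weak lower semicontinuity together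
with `τ / h² → 0` (`SchemeLimit.energy_limit`). -/

/-- The difference quotient of `f` in the direction `d` with step `r`. -/
noncomputable def diffQuot {V F : Type*} [AddCommGroup V] [Module ℝ V] [AddCommGroup F]
    [Module ℝ F] (d : V) (r : ℝ) (f : V → F) (x : V) : F :=
  r⁻¹ • (f (x + r • d) - f x)

/-! ### The explicit scheme: maximum principle, Leibniz rule, summation by parts -/

/-- The seven point discretization of the Laplacian. -/
noncomputable def discreteLaplacian (h : ℝ) (f : E3 → ℝ) (x : E3) : ℝ :=
  ∑ i, (f (x + h • stdVec i) - 2 * f x + f (x - h • stdVec i)) / h ^ 2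

/-- The skew-symmetric discretization of the transport operator, where `a i x` is the velocity on
the edge from `x` to `x + h • stdVec i`. -/
noncomputable def discreteTransport (h : ℝ) (a : Fin 3 → E3 → ℝ) (f : E3 → ℝ) (x : E3) : ℝ :=
  ∑ i, (a i x * f (x + h • stdVec i) - a i (x - h • stdVec i) * f (x - h • stdVec i)) / (2 * h)

/-- One step of the explicit Euler scheme. -/
noncomputable def eulerStep (h τ : ℝ) (a : Fin 3 → E3 → ℝ) (f : E3 → ℝ) (x : E3) : ℝ :=
  f x + τ * (discreteLaplacian h f x + discreteTransport h a f x)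

/-- The discrete divergence of the edge velocities vanishes. -/
def DiscreteDivFree (h : ℝ) (a : Fin 3 → E3 → ℝ) : Prop :=
  ∀ x, ∑ i, (a i x - a i (x - h • stdVec i)) = 0

lemma hasCompactSupport_comp_add {F : Type*} [Zero F] {f : E3 → F} (hf : HasCompactSupport f)
    (y : E3) : HasCompactSupport fun x => f (x + y) :=
  hf.comp_homeomorph (Homeomorph.addRight y)

lemma hasCompactSupport_comp_sub {F : Type*} [Zero F] {f : E3 → F} (hf : HasCompactSupport f)
    (y : E3) : HasCompactSupport fun x => f (x - y) := by
  simpa [sub_eq_add_neg] using hasCompactSupport_comp_add hf (-y)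

lemma hasCompactSupport_finset_sum {X ι F : Type*} [TopologicalSpace X] [AddCommMonoid F]
    (s : Finset ι) {f : ι → X → F} (hf : ∀ i ∈ s, HasCompactSupport (f i)) :
    HasCompactSupport fun x => ∑ i ∈ s, f i x := by
  classical
  induction s using Finset.induction_on with
  | empty => simp only [Finset.sum_empty]; exact HasCompactSupport.zero
  | insert i s hi ih =>
    simp only [Finset.sum_insert hi]
    exact (hf i (by simp)).add (ih fun j hj => hf j (by simp [hj]))

lemma HasCompactSupport.div_const {X : Type*} [TopologicalSpace X] {f : X → ℝ}
    (hf : HasCompactSupport f) (c : ℝ) : HasCompactSupport fun x => f x / c := by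
  simp only [div_eq_mul_inv]
  exact hf.mul_right (f' := fun _ => c⁻¹)

lemma continuous_diffQuot (d : E3) (r : ℝ) {f : E3 → ℝ} (hf : Continuous f) :
    Continuous (diffQuot d r f) := by
  unfold diffQuot; fun_prop

lemma hasCompactSupport_diffQuot (d : E3) (r : ℝ) {f : E3 → ℝ} (hf : HasCompactSupport f) :
    HasCompactSupport (diffQuot d r f) := by
  unfold diffQuot
  exact ((hasCompactSupport_comp_add hf _).sub hf).mul_left (f := fun _ => r⁻¹)

lemma continuous_discreteLaplacian (h : ℝ) {f : E3 → ℝ} (hf : Continuous f) :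
    Continuous (discreteLaplacian h f) := by
  unfold discreteLaplacian; fun_prop

lemma hasCompactSupport_discreteLaplacian (h : ℝ) {f : E3 → ℝ} (hf : HasCompactSupport f) :
    HasCompactSupport (discreteLaplacian h f) := by
  unfold discreteLaplacian
  refine hasCompactSupport_finset_sum _ fun i _ => HasCompactSupport.div_const ?_ _
  exact ((hasCompactSupport_comp_add hf _).sub (hf.mul_left (f := fun _ => (2 : ℝ)))).add
    (hasCompactSupport_comp_sub hf _)

lemma continuous_discreteTransport (h : ℝ) {a : Fin 3 → E3 → ℝ} (ha : ∀ i, Continuous (a i))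
    {f : E3 → ℝ} (hf : Continuous f) : Continuous (discreteTransport h a f) := by
  unfold discreteTransport; fun_prop

lemma hasCompactSupport_discreteTransport (h : ℝ) (a : Fin 3 → E3 → ℝ) {f : E3 → ℝ}
    (hf : HasCompactSupport f) : HasCompactSupport (discreteTransport h a f) := by
  unfold discreteTransport
  refine hasCompactSupport_finset_sum _ fun i _ => HasCompactSupport.div_const ?_ _
  exact ((hasCompactSupport_comp_add hf _).mul_left).sub ((hasCompactSupport_comp_sub hf _).mul_left)

lemma continuous_eulerStep (h τ : ℝ) {a : Fin 3 → E3 → ℝ} (ha : ∀ i, Continuous (a i))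
    {f : E3 → ℝ} (hf : Continuous f) : Continuous (eulerStep h τ a f) :=
  hf.add (((continuous_discreteLaplacian h hf).add (continuous_discreteTransport h ha hf)).const_mul τ)

lemma hasCompactSupport_eulerStep (h τ : ℝ) (a : Fin 3 → E3 → ℝ) {f : E3 → ℝ}
    (hf : HasCompactSupport f) : HasCompactSupport (eulerStep h τ a f) :=
  hf.add (((hasCompactSupport_discreteLaplacian h hf).add
    (hasCompactSupport_discreteTransport h a hf)).mul_left (f := fun _ => τ))

/-- The new value is an average of the seven old ones with weights `1 - 6 τ / h²` and `τ / h² * (1 ±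
h a / 2)`. The CFL condition and the velocity bound make the weights nonnegative; the discrete
divergence condition makes them sum to one. -/
lemma abs_eulerStep_le {h τ M : ℝ} (hh : 0 < h) (hτ : 0 < τ) (hτh : 6 * τ ≤ h ^ 2)
    {a : Fin 3 → E3 → ℝ} (ha : ∀ i x, |a i x| ≤ 1 / h) (hdiv : DiscreteDivFree h a)
    {f : E3 → ℝ} (hf : ∀ x, |f x| ≤ M) (x : E3) : |eulerStep h τ a f x| ≤ M := by
  have key : eulerStep h τ a f x = (1 - 6 * τ / h ^ 2) * f x
      + ∑ i, ((τ / h ^ 2 * (1 + h * a i x / 2)) * f (x + h • stdVec i)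
        + (τ / h ^ 2 * (1 - h * a i (x - h • stdVec i) / 2)) * f (x - h • stdVec i)) := by
    unfold eulerStep discreteLaplacian discreteTransport
    simp only [Fin.sum_univ_three]
    field_simp
    ring
  have hc : 0 ≤ τ / h ^ 2 := by positivity
  have h1 : ∀ i y, 0 ≤ 1 + h * a i y / 2 ∧ 0 ≤ 1 - h * a i y / 2 := by
    intro i y
    have := abs_le.1 (ha i y)
    have e1 : h * (1 / h) = 1 := by field_simp
    constructor <;> nlinarith [mul_le_mul_of_nonneg_left this.1 hh.le,
      mul_le_mul_of_nonneg_left this.2 hh.le]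
  have h0 : 0 ≤ 1 - 6 * τ / h ^ 2 := by
    rw [sub_nonneg, div_le_one (by positivity)]; exact hτh
  -- The velocity contributions to the total weight add up to a multiple of the discrete divergence
  -- at `x`.
  have hsum : (1 - 6 * τ / h ^ 2) + ∑ i, ((τ / h ^ 2 * (1 + h * a i x / 2))
        + (τ / h ^ 2 * (1 - h * a i (x - h • stdVec i) / 2))) = 1 := by
    have := hdiv x
    simp only [Fin.sum_univ_three] at this ⊢
    linear_combination (τ / h ^ 2 * h / 2) * this
  rw [key]
  calc _ ≤ |(1 - 6 * τ / h ^ 2) * f x| + ∑ i, (|(τ / h ^ 2 * (1 + h * a i x / 2)) * f (x + h • stdVec i)|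
        + |(τ / h ^ 2 * (1 - h * a i (x - h • stdVec i) / 2)) * f (x - h • stdVec i)|) := by
        refine (abs_add_le _ _).trans (add_le_add le_rfl ?_)
        exact (Finset.abs_sum_le_sum_abs _ _).trans (Finset.sum_le_sum fun i _ => abs_add_le _ _)
    _ ≤ (1 - 6 * τ / h ^ 2) * M + ∑ i, ((τ / h ^ 2 * (1 + h * a i x / 2)) * M
        + (τ / h ^ 2 * (1 - h * a i (x - h • stdVec i) / 2)) * M) := by
        refine add_le_add ?_ (Finset.sum_le_sum fun i _ => add_le_add ?_ ?_)
        · rw [abs_mul, abs_of_nonneg h0]; exact mul_le_mul_of_nonneg_left (hf _) h0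
        · rw [abs_mul, abs_of_nonneg (mul_nonneg hc (h1 i x).1)]
          exact mul_le_mul_of_nonneg_left (hf _) (mul_nonneg hc (h1 i x).1)
        · rw [abs_mul, abs_of_nonneg (mul_nonneg hc (h1 i _).2)]
          exact mul_le_mul_of_nonneg_left (hf _) (mul_nonneg hc (h1 i _).2)
    _ = M := by
        simp only [← add_mul, ← Finset.sum_mul]; rw [hsum, one_mul]

/-- The discrete Leibniz rule for the scheme. -/
lemma diffQuot_eulerStep (h τ : ℝ) (a : Fin 3 → E3 → ℝ) (f : E3 → ℝ) (d : E3) (r : ℝ) (x : E3) :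
    diffQuot d r (eulerStep h τ a f) x = diffQuot d r f x
      + τ * (discreteLaplacian h (diffQuot d r f) x + discreteTransport h a (diffQuot d r f) x
        + discreteTransport h (fun i => diffQuot d r (a i)) (fun y => f (y + r • d)) x) := by
  -- Translations commute, and the product rule is used in the form `δ(a f) = a δf + (δa) f(· + r
  -- d)`: the velocity stays unshifted in the main term and the shift falls on `f` in the source.
  unfold eulerStep discreteLaplacian discreteTransport diffQuot
  have e1 : ∀ i, x + r • d + h • stdVec i = x + h • stdVec i + r • d := fun i => by abel
  have e2 : ∀ i, x + r • d - h • stdVec i = x - h • stdVec i + r • d := fun i => by abel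
  simp only [Fin.sum_univ_three, smul_eq_mul, e1, e2]
  ring

lemma integrable_sq_of_hasCompactSupport {u : E3 → ℝ} (hu : Continuous u)
    (huc : HasCompactSupport u) : Integrable fun x => u x ^ 2 := by
  have hc : HasCompactSupport fun x => u x * u x := huc.mul_right
  simpa only [sq] using (hu.fun_mul hu).integrable_of_hasCompactSupport (μ := volume) hc

lemma integral_sub_comp_sub_eq_zero {J : E3 → ℝ} (hJ : Continuous J) (hJc : HasCompactSupport J)
    (y : E3) : ∫ x, (J x - J (x - y)) = 0 := by
  have h1 := hJ.integrable_of_hasCompactSupport (μ := volume) hJc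
  rw [integral_sub h1 (h1.comp_sub_right y), integral_sub_right_eq_self (fun x => J x) y, sub_self]

/-- Every summation by parts below goes through this lemma: a discrete divergence of compactly
supported fluxes `J i` integrates to zero by translation invariance, so it suffices to exhibit the
fluxes and check a pointwise algebraic identity. -/
lemma integral_eq_of_sub_eq_sum {f g : E3 → ℝ} (hf : Integrable f) (hg : Integrable g)
    {J : Fin 3 → E3 → ℝ} (hJ : ∀ i, Continuous (J i)) (hJc : ∀ i, HasCompactSupport (J i))
    (h : ℝ) (hfg : ∀ x, f x - g x = ∑ i, (J i x - J i (x - h • stdVec i))) :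
    ∫ x, f x = ∫ x, g x := by
  rw [← sub_eq_zero, ← integral_sub hf hg]
  simp only [hfg]
  rw [integral_finsetSum]
  · exact Finset.sum_eq_zero fun i _ => integral_sub_comp_sub_eq_zero (hJ i) (hJc i) _
  · intro i _
    have h1 := (hJ i).integrable_of_hasCompactSupport (μ := volume) (hJc i)
    exact h1.sub (h1.comp_sub_right _)

/-! ### Energy identities and the energy inequality for one step -/

section Energy

variable {h : ℝ} {a b : Fin 3 → E3 → ℝ} {f g : E3 → ℝ}

lemma integral_mul_discreteLaplacian_self (hh : 0 < h) (hf : Continuous f)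
    (hfc : HasCompactSupport f) :
    ∫ x, f x * discreteLaplacian h f x = ∫ x, -∑ i, diffQuot (stdVec i) h f x ^ 2 := by
  have hd := fun i => continuous_diffQuot (stdVec i) h hf
  have hdc := fun i => hasCompactSupport_diffQuot (stdVec i) h hfc
  refine integral_eq_of_sub_eq_sum (h := h)
    (J := fun i x => f (x + h • stdVec i) * diffQuot (stdVec i) h f x / h) ?_ ?_ ?_ ?_ ?_
  · exact (hf.mul (continuous_discreteLaplacian h hf)).integrable_of_hasCompactSupport hfc.mul_right
  · refine Continuous.integrable_of_hasCompactSupport ?_ ?_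
    · fun_prop
    · refine HasCompactSupport.neg (hasCompactSupport_finset_sum _ fun i _ => ?_)
      exact (hdc i).comp_left (g := fun t : ℝ => t ^ 2) (by norm_num)
  · intro i; have := hd i; fun_prop
  · intro i; exact (hdc i).mul_left.div_const _
  · intro x
    simp only [discreteLaplacian, diffQuot, smul_eq_mul, sub_add_cancel, Fin.sum_univ_three]
    field_simp
    ring

/-- This is the point of the skew-symmetric form: `f` times its transport is itself a discrete
divergence, with flux `a f(x) f(x + h e_i) / (2 h)`, whatever the divergence of `a`. -/
lemma integral_mul_discreteTransport_self (ha : ∀ i, Continuous (a i)) (hf : Continuous f)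
    (hfc : HasCompactSupport f) : ∫ x, f x * discreteTransport h a f x = 0 := by
  rw [← integral_zero E3 ℝ (μ := volume)]
  refine integral_eq_of_sub_eq_sum (h := h)
    (J := fun i x => a i x * f (x + h • stdVec i) * f x / (2 * h)) ?_ ?_ ?_ ?_ ?_
  · exact (hf.mul (continuous_discreteTransport h ha hf)).integrable_of_hasCompactSupport
      hfc.mul_right
  · exact integrable_zero _ _ _
  · intro i; have := ha i; fun_prop
  · intro i; exact hfc.mul_left.div_const _
  · intro x
    simp only [discreteTransport, sub_add_cancel, Fin.sum_univ_three]
    ring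

/-- Moves the difference from `g` onto `f`, so that only a sup bound on `g` is needed afterwards.
The leftover term is `f g` times the discrete divergence of `b`. -/
lemma integral_mul_discreteTransport (hh : 0 < h) (hb : ∀ i, Continuous (b i))
    (hdiv : DiscreteDivFree h b) (hf : Continuous f) (hfc : HasCompactSupport f)
    (hg : Continuous g) :
    ∫ x, f x * discreteTransport h b g x
      = ∫ x, -∑ i, b i x * ((g x + g (x + h • stdVec i)) / 2) * diffQuot (stdVec i) h f x := by
  have hd := fun i => continuous_diffQuot (stdVec i) h hf
  have hdc := fun i => hasCompactSupport_diffQuot (stdVec i) h hfc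
  refine integral_eq_of_sub_eq_sum (h := h)
    (J := fun i x => (b i x * (g x * f (x + h • stdVec i) + f (x + h • stdVec i)
      * g (x + h • stdVec i))) / (2 * h)) ?_ ?_ ?_ ?_ ?_
  · exact (hf.mul (continuous_discreteTransport h hb hg)).integrable_of_hasCompactSupport
      hfc.mul_right
  · refine Continuous.integrable_of_hasCompactSupport ?_ ?_
    · fun_prop
    · exact (hasCompactSupport_finset_sum _ fun i _ => (hdc i).mul_left).neg
  · intro i; have := hb i; fun_prop
  · intro i
    refine HasCompactSupport.div_const ?_ _
    exact (((hasCompactSupport_comp_add hfc _).mul_left).add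
      ((hasCompactSupport_comp_add hfc _).mul_right)).mul_left
  · intro x
    have := hdiv x
    simp only [discreteTransport, diffQuot, smul_eq_mul, sub_add_cancel, Fin.sum_univ_three] at this ⊢
    field_simp
    linear_combination (-f x * g x) * this

/-- The weak form of one step of the scheme. -/
lemma integral_eulerStep_sub_mul {τ : ℝ} (hh : 0 < h) (ha : ∀ i, Continuous (a i))
    (hdiv : DiscreteDivFree h a) (hf : Continuous f) (hfc : HasCompactSupport f)
    (hg : Continuous g) :
    ∫ x, (eulerStep h τ a f x - f x) * g x
      = τ * ∫ x, (f x * discreteLaplacian h g x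
          + ∑ i, diffQuot (stdVec i) h f x * (a i x * ((g x + g (x + h • stdVec i)) / 2))) := by
  have hd := fun i => continuous_diffQuot (stdVec i) h hf
  have hdc := fun i => hasCompactSupport_diffQuot (stdVec i) h hfc
  rw [← integral_const_mul]
  -- The first flux rewrites transport as velocity times difference quotient of `f`; the second is
  -- the discrete Green formula. What remains is `f g` times the discrete divergence of `a`.
  refine integral_eq_of_sub_eq_sum (h := h)
    (J := fun i x => -τ * (a i x * (diffQuot (stdVec i) h f x * g (x + h • stdVec i)) / 2)
      + τ / h ^ 2 * (f (x + h • stdVec i) * g x - f x * g (x + h • stdVec i))) ?_ ?_ ?_ ?_ ?_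
  · exact (((continuous_eulerStep h τ ha hf).sub hf).mul hg).integrable_of_hasCompactSupport
      ((hasCompactSupport_eulerStep h τ a hfc).sub hfc).mul_right
  · refine Continuous.integrable_of_hasCompactSupport ?_ ?_
    · have := continuous_discreteLaplacian h hg
      fun_prop
    · refine HasCompactSupport.mul_left (f := fun _ => τ) ?_
      exact hfc.mul_right.add (hasCompactSupport_finset_sum _ fun i _ => (hdc i).mul_right)
  · intro i; have := ha i; have := hd i; fun_prop
  · intro i
    refine HasCompactSupport.add ?_ ?_
    · exact ((hdc i).mul_right.mul_left.div_const _).mul_left (f := fun _ => -τ)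
    · exact HasCompactSupport.mul_left (f := fun _ => τ / h ^ 2)
        ((hasCompactSupport_comp_add hfc _).mul_right.sub hfc.mul_right)
  · intro x
    have := hdiv x
    simp only [eulerStep, discreteLaplacian, discreteTransport, diffQuot, smul_eq_mul,
      sub_add_cancel, Fin.sum_univ_three] at this ⊢
    field_simp
    linear_combination (τ * h * f x * g x) * this

lemma sq_sum_le_twelve (u : Fin 3 → Fin 4 → ℝ) :
    (∑ i, ∑ l, u i l) ^ 2 ≤ 12 * ∑ i, ∑ l, u i l ^ 2 := by
  have := sq_sum_le_card_mul_sum_sq (s := (Finset.univ : Finset (Fin 3 × Fin 4)))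
    (f := fun p => u p.1 p.2)
  simpa [Fintype.sum_prod_type, Finset.card_univ] using this

/-- A crude bound on the increment of one step. It is multiplied by `τ²` in the energy inequality,
so losing a factor `1 / h²` is affordable as soon as `τ / h²` is small. -/
lemma sq_discrete_le {M : ℝ} (hh : 0 < h) (ha : ∀ i x, |a i x| ≤ 1 / h) (hdiv : DiscreteDivFree h a)
    (hg : ∀ x, |g x| ≤ M) (x : E3) :
    (discreteLaplacian h f x + discreteTransport h a f x + discreteTransport h b g x) ^ 2
      ≤ ∑ i, (27 / h ^ 2 * (diffQuot (stdVec i) h f x ^ 2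
          + diffQuot (stdVec i) h f (x - h • stdVec i) ^ 2)
        + 3 * M ^ 2 / h ^ 2 * (b i x ^ 2 + b i (x - h • stdVec i) ^ 2)) := by
  set D := fun i y => diffQuot (stdVec i) h f y
  -- Subtracting `f x` times the discrete divergence of `a` leaves only first differences of `f`,
  -- with coefficients of order `1 / h`. There are four such terms per direction, twelve in all.
  have e : discreteLaplacian h f x + discreteTransport h a f x + discreteTransport h b g x
      = ∑ i, ∑ l, (![(1 / h + a i x / 2) * D i x,
          (-1 / h + a i (x - h • stdVec i) / 2) * D i (x - h • stdVec i),
          b i x * g (x + h • stdVec i) / (2 * h),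
          -(b i (x - h • stdVec i) * g (x - h • stdVec i)) / (2 * h)] : Fin 4 → ℝ) l := by
    have := hdiv x
    simp only [D, discreteLaplacian, discreteTransport, diffQuot, smul_eq_mul, sub_add_cancel,
      Fin.sum_univ_three, Fin.sum_univ_four, Matrix.cons_val] at this ⊢
    field_simp
    linear_combination (h * f x) * this
  rw [e]
  refine (sq_sum_le_twelve _).trans ?_
  rw [Finset.mul_sum]
  refine Finset.sum_le_sum fun i _ => ?_
  simp only [Fin.sum_univ_four, Matrix.cons_val]
  -- Since `|a| ≤ 1 / h`, the coefficients are at most `3 / (2 h)`. With the factor 12 of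
  -- Cauchy–Schwarz this gives `12 * 9 / 4 = 27`; the terms with `b` give `12 / 4 = 3`.
  have hA : ∀ y, (1 / h + a i y / 2) ^ 2 ≤ 9 / 4 / h ^ 2 ∧ (-1 / h + a i y / 2) ^ 2 ≤ 9 / 4 / h ^ 2 := by
    intro y
    have h1 := abs_le.1 (ha i y)
    have h2 : 9 / 4 / h ^ 2 = (3 / 2 * (1 / h)) ^ 2 := by field_simp; norm_num
    have h3 : 0 < 1 / h := by positivity
    have h4 : -1 / h = -(1 / h) := by ring
    rw [h2, h4]
    constructor <;> apply sq_le_sq' <;> linarith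
  have hG : ∀ y, g y ^ 2 ≤ M ^ 2 := fun y => sq_le_sq' (abs_le.1 (hg y)).1 (abs_le.1 (hg y)).2
  have t1 := mul_le_mul_of_nonneg_right (hA x).1 (sq_nonneg (D i x))
  have t2 := mul_le_mul_of_nonneg_right (hA (x - h • stdVec i)).2 (sq_nonneg (D i (x - h • stdVec i)))
  have hh2 : 0 ≤ 3 / h ^ 2 := by positivity
  have t3 := mul_le_mul_of_nonneg_left
    (mul_le_mul_of_nonneg_left (hG (x + h • stdVec i)) (sq_nonneg (b i x))) hh2
  have t4 := mul_le_mul_of_nonneg_left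
    (mul_le_mul_of_nonneg_left (hG (x - h • stdVec i)) (sq_nonneg (b i (x - h • stdVec i)))) hh2
  have r3 : (b i x * g (x + h • stdVec i) / (2 * h)) ^ 2
      = (3 / h ^ 2 * (b i x ^ 2 * g (x + h • stdVec i) ^ 2)) / 12 := by field_simp; ring
  have r4 : (-(b i (x - h • stdVec i) * g (x - h • stdVec i)) / (2 * h)) ^ 2
      = (3 / h ^ 2 * (b i (x - h • stdVec i) ^ 2 * g (x - h • stdVec i) ^ 2)) / 12 := by
    field_simp; ring
  rw [mul_pow, mul_pow, r3, r4]
  have s1 : 27 / h ^ 2 * (D i x ^ 2 + D i (x - h • stdVec i) ^ 2)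
      + 3 * M ^ 2 / h ^ 2 * (b i x ^ 2 + b i (x - h • stdVec i) ^ 2)
      = 12 * (9 / 4 / h ^ 2 * D i x ^ 2) + 12 * (9 / 4 / h ^ 2 * D i (x - h • stdVec i) ^ 2)
        + 3 / h ^ 2 * (b i x ^ 2 * M ^ 2) + 3 / h ^ 2 * (b i (x - h • stdVec i) ^ 2 * M ^ 2) := by
    ring
  change _ ≤ 27 / h ^ 2 * (D i x ^ 2 + D i (x - h • stdVec i) ^ 2)
      + 3 * M ^ 2 / h ^ 2 * (b i x ^ 2 + b i (x - h • stdVec i) ^ 2)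
  rw [s1]
  linarith

set_option maxHeartbeats 400000 in
/-- The energy inequality for one step of the scheme. -/
lemma integral_sq_step_le {τ M : ℝ} (hh : 0 < h) (hτ : 0 < τ)
    (ha : ∀ i, Continuous (a i)) (ha' : ∀ i x, |a i x| ≤ 1 / h) (hdiv : DiscreteDivFree h a)
    (hb : ∀ i, Continuous (b i)) (hbdiv : DiscreteDivFree h b)
    (hb2 : ∀ i, Integrable fun x => b i x ^ 2)
    (hf : Continuous f) (hfc : HasCompactSupport f) (hg : Continuous g) (hgc : HasCompactSupport g)
    (hgM : ∀ x, |g x| ≤ M) :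
    (∫ x, (f x + τ * (discreteLaplacian h f x + discreteTransport h a f x
        + discreteTransport h b g x)) ^ 2)
      + τ * (1 - 54 * τ / h ^ 2) * ∑ i, ∫ x, diffQuot (stdVec i) h f x ^ 2
      ≤ (∫ x, f x ^ 2) + τ * (1 + 54 * τ / h ^ 2) * M ^ 2 * ∑ i, ∫ x, b i x ^ 2 := by
  set D := fun i x => diffQuot (stdVec i) h f x with hD
  set G := fun x => discreteLaplacian h f x + discreteTransport h a f x
    + discreteTransport h b g x with hG
  have hDc : ∀ i, Continuous (D i) := fun i => continuous_diffQuot _ h hf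
  have hDs : ∀ i, HasCompactSupport (D i) := fun i => hasCompactSupport_diffQuot _ h hfc
  have hGc : Continuous G := ((continuous_discreteLaplacian h hf).add
    (continuous_discreteTransport h ha hf)).add (continuous_discreteTransport h hb hg)
  have hGs : HasCompactSupport G := ((hasCompactSupport_discreteLaplacian h hfc).add
    (hasCompactSupport_discreteTransport h a hfc)).add (hasCompactSupport_discreteTransport h b hgc)
  have iD := fun i => integrable_sq_of_hasCompactSupport (hDc i) (hDs i)
  have ifG : Integrable fun x => f x * G x :=
    (hf.mul hGc).integrable_of_hasCompactSupport hfc.mul_right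
  have iprod : ∀ {u : E3 → ℝ}, Continuous u → Integrable fun x => f x * u x :=
    fun hu => (hf.mul hu).integrable_of_hasCompactSupport hfc.mul_right
  have e1 : ∫ x, (f x + τ * G x) ^ 2 = (∫ x, f x ^ 2) + 2 * τ * (∫ x, f x * G x)
      + τ ^ 2 * ∫ x, G x ^ 2 := by
    have : ∀ x, (f x + τ * G x) ^ 2 = (f x ^ 2 + 2 * τ * (f x * G x)) + τ ^ 2 * G x ^ 2 :=
      fun x => by ring
    simp only [this]
    rw [integral_add ((integrable_sq_of_hasCompactSupport hf hfc).fun_add (ifG.const_mul _)) ((integrable_sq_of_hasCompactSupport hGc hGs).const_mul _),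
      integral_add (integrable_sq_of_hasCompactSupport hf hfc) (ifG.const_mul _), integral_const_mul, integral_const_mul]
  -- The diffusion dissipates, the transport of `f` drops out by skew symmetry, and the source is
  -- left with the difference on `f`.
  have e2 : ∫ x, f x * G x = -(∑ i, ∫ x, D i x ^ 2)
      + ∫ x, -∑ i, b i x * ((g x + g (x + h • stdVec i)) / 2) * D i x := by
    have : ∀ x, f x * G x = (f x * discreteLaplacian h f x + f x * discreteTransport h a f x)
      + f x * discreteTransport h b g x := fun x => by simp only [hG]; ring
    simp only [this]
    rw [integral_add ((iprod (continuous_discreteLaplacian h hf)).fun_add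
      (iprod (continuous_discreteTransport h ha hf))) (iprod (continuous_discreteTransport h hb hg)),
      integral_add (iprod (continuous_discreteLaplacian h hf))
        (iprod (continuous_discreteTransport h ha hf)),
      integral_mul_discreteLaplacian_self hh hf hfc, integral_mul_discreteTransport_self ha hf hfc,
      integral_mul_discreteTransport hh hb hbdiv hf hfc hg, integral_neg,
      integral_finsetSum _ fun i _ => iD i, add_zero]
  -- Young's inequality with weight exactly one: the expansion of the square contributes `-2 τ ∑ ∫
  -- D²`, and one of these two copies is spent here.
  have e3 : 2 * ∫ x, -∑ i, b i x * ((g x + g (x + h • stdVec i)) / 2) * D i x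
      ≤ ∑ i, (M ^ 2 * (∫ x, b i x ^ 2) + ∫ x, D i x ^ 2) := by
    have : ∀ i, M ^ 2 * (∫ x, b i x ^ 2) + (∫ x, D i x ^ 2) = ∫ x, (M ^ 2 * b i x ^ 2 + D i x ^ 2) :=
      fun i => by rw [integral_add ((hb2 i).const_mul _) (iD i), integral_const_mul]
    simp only [this]
    rw [← integral_finsetSum _ fun i _ => ((hb2 i).const_mul _).fun_add (iD i), ← integral_const_mul]
    refine integral_mono ?_ ?_ ?_
    · refine (Continuous.integrable_of_hasCompactSupport ?_ ?_).const_mul _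
      · fun_prop
      · exact HasCompactSupport.neg
          (hasCompactSupport_finset_sum _ fun i _ => (hDs i).mul_left)
    · exact integrable_finsetSum _ fun i _ => ((hb2 i).const_mul _).fun_add (iD i)
    · intro x
      simp only [← Finset.sum_neg_distrib, Finset.mul_sum]
      refine Finset.sum_le_sum fun i _ => ?_
      have hm : ((g x + g (x + h • stdVec i)) / 2) ^ 2 ≤ M ^ 2 := by
        have h1 := abs_le.1 (hgM x)
        have h2 := abs_le.1 (hgM (x + h • stdVec i))
        apply sq_le_sq' <;> linarith
      nlinarith [sq_nonneg (b i x * ((g x + g (x + h • stdVec i)) / 2) + D i x),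
        mul_le_mul_of_nonneg_left hm (sq_nonneg (b i x))]
  -- Both translates in the pointwise bound have the same integral, which doubles 27 and 3.
  have e4 : ∫ x, G x ^ 2 ≤ ∑ i, (54 / h ^ 2 * (∫ x, D i x ^ 2) + 6 * M ^ 2 / h ^ 2 * ∫ x, b i x ^ 2) := by
    have iT : ∀ i, Integrable fun x => 27 / h ^ 2 * (D i x ^ 2 + D i (x - h • stdVec i) ^ 2)
        + 3 * M ^ 2 / h ^ 2 * (b i x ^ 2 + b i (x - h • stdVec i) ^ 2) := fun i =>
      (((iD i).fun_add ((iD i).comp_sub_right (h • stdVec i))).const_mul _).fun_add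
        (((hb2 i).fun_add ((hb2 i).comp_sub_right (h • stdVec i))).const_mul _)
    have : ∀ i, 54 / h ^ 2 * (∫ x, D i x ^ 2) + 6 * M ^ 2 / h ^ 2 * ∫ x, b i x ^ 2
        = ∫ x, (27 / h ^ 2 * (D i x ^ 2 + D i (x - h • stdVec i) ^ 2)
        + 3 * M ^ 2 / h ^ 2 * (b i x ^ 2 + b i (x - h • stdVec i) ^ 2)) := by
      intro i
      rw [integral_add (((iD i).fun_add ((iD i).comp_sub_right (h • stdVec i))).const_mul _)
        (((hb2 i).fun_add ((hb2 i).comp_sub_right (h • stdVec i))).const_mul _), integral_const_mul,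
        integral_const_mul, integral_add (iD i) ((iD i).comp_sub_right (h • stdVec i)),
        integral_add (hb2 i) ((hb2 i).comp_sub_right (h • stdVec i)),
        integral_sub_right_eq_self (fun x => D i x ^ 2),
        integral_sub_right_eq_self (fun x => b i x ^ 2)]
      ring
    simp only [this]
    rw [← integral_finsetSum _ fun i _ => iT i]
    exact integral_mono (integrable_sq_of_hasCompactSupport hGc hGs) (integrable_finsetSum _ fun i _ => iT i)
      fun x => sq_discrete_le hh ha' hdiv hgM x
  rw [Finset.sum_add_distrib, ← Finset.mul_sum] at e3
  rw [Finset.sum_add_distrib, ← Finset.mul_sum, ← Finset.mul_sum] at e4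
  change (∫ x, (f x + τ * G x) ^ 2) + τ * (1 - 54 * τ / h ^ 2) * ∑ i, ∫ x, D i x ^ 2 ≤ _
  rw [e1, e2]
  have hB : 0 ≤ ∑ i, ∫ x, b i x ^ 2 :=
    Finset.sum_nonneg fun i _ => integral_nonneg fun x => sq_nonneg _
  set SB := ∑ i, ∫ x, b i x ^ 2
  set SD := ∑ i, ∫ x, D i x ^ 2
  have p1 := mul_le_mul_of_nonneg_left e3 hτ.le
  have p2 := mul_le_mul_of_nonneg_left e4 (sq_nonneg τ)
  -- The coefficient of the `b` term is 6 but is stated as 54, to have one small parameter `54 τ /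
  -- h²` on both sides; 48 is the slack.
  have p3 : 0 ≤ 48 * τ ^ 2 / h ^ 2 * M ^ 2 * SB := by positivity
  have q1 : τ ^ 2 * (54 / h ^ 2 * SD + 6 * M ^ 2 / h ^ 2 * SB)
    = τ * (54 * τ / h ^ 2) * SD + τ * (54 * τ / h ^ 2) * M ^ 2 * SB - 48 * τ ^ 2 / h ^ 2 * M ^ 2 * SB := by
    ring
  linarith [p1, p2, p3, q1]

end Energy

/-! ### Iterating the scheme: bounds over many time steps -/

/-- The solution of the explicit Euler scheme with edge velocities `a n` at the `n`-th step. -/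
noncomputable def eulerScheme (h τ : ℝ) (a : ℕ → Fin 3 → E3 → ℝ) (f : E3 → ℝ) : ℕ → E3 → ℝ
  | 0 => f
  | n + 1 => eulerStep h τ (a n) (eulerScheme h τ a f n)

/-- Edge velocities for which the explicit Euler scheme is stable. -/
structure StableVelocity (h τ : ℝ) (a : ℕ → Fin 3 → E3 → ℝ) : Prop where
  h_pos : 0 < h
  τ_pos : 0 < τ
  cfl : 108 * τ ≤ h ^ 2
  continuous : ∀ n i, Continuous (a n i)
  abs_le : ∀ n i x, |a n i x| ≤ 1 / h
  divFree : ∀ n, DiscreteDivFree h (a n)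

namespace StableVelocity

variable {h τ : ℝ} {a : ℕ → Fin 3 → E3 → ℝ} {f : E3 → ℝ}

lemma continuous_eulerScheme (H : StableVelocity h τ a) (hf : Continuous f) (n : ℕ) :
    Continuous (eulerScheme h τ a f n) := by
  induction n with
  | zero => exact hf
  | succ n ih => exact continuous_eulerStep h τ (H.continuous n) ih

lemma hasCompactSupport_eulerScheme (hf : HasCompactSupport f) (n : ℕ) :
    HasCompactSupport (eulerScheme h τ a f n) := by
  induction n with
  | zero => exact hf
  | succ n ih => exact hasCompactSupport_eulerStep h τ (a n) ih

lemma abs_eulerScheme_le (H : StableVelocity h τ a) {M : ℝ} (hf : ∀ x, |f x| ≤ M) (n : ℕ) (x : E3) :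
    |eulerScheme h τ a f n x| ≤ M := by
  induction n generalizing x with
  | zero => exact hf x
  | succ n ih =>
    exact abs_eulerStep_le H.h_pos H.τ_pos (by linarith [H.cfl, H.τ_pos]) (H.abs_le n)
      (H.divFree n) ih x

lemma integral_sq_eulerScheme_add_le (H : StableVelocity h τ a) (hf : Continuous f)
    (hfc : HasCompactSupport f) (N : ℕ) :
    (∫ x, eulerScheme h τ a f N x ^ 2) + (1 - 54 * τ / h ^ 2) * ∑ n ∈ Finset.range N,
      τ * ∑ i, ∫ x, diffQuot (stdVec i) h (eulerScheme h τ a f n) x ^ 2 ≤ ∫ x, f x ^ 2 := by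
  induction N with
  | zero => simp [eulerScheme]
  | succ N ih =>
    -- For the solution itself there is no source, so `b`, `g` and `M` are zero.
    have := integral_sq_step_le (b := fun _ _ => 0) (g := fun _ => 0) (M := 0) H.h_pos H.τ_pos
      (H.continuous N) (H.abs_le N) (H.divFree N) (fun i => continuous_const)
      (fun x => by simp) (by simp) (H.continuous_eulerScheme hf N)
      (hasCompactSupport_eulerScheme (h := h) (τ := τ) (a := a) hfc N) continuous_const
      HasCompactSupport.zero (by simp)
    have e : ∀ x, discreteTransport h (fun _ _ => 0) (fun _ => 0) x = 0 := by
      intro x; simp [discreteTransport]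
    simp only [e, add_zero] at this
    rw [Finset.sum_range_succ, mul_add]
    simp only [eulerScheme, eulerStep]
    simp at this
    linarith

/-- The number 108 in the CFL condition is twice 54, so at least half of the dissipation survives
the explicit time step. -/
lemma one_sub_pos (H : StableVelocity h τ a) : 1 / 2 ≤ 1 - 54 * τ / h ^ 2 := by
  have : 54 * τ / h ^ 2 ≤ 1 / 2 := by
    rw [div_le_iff₀ (pow_pos H.h_pos 2)]; linarith [H.cfl]
  linarith

lemma integral_sq_eulerScheme_le (H : StableVelocity h τ a) (hf : Continuous f)
    (hfc : HasCompactSupport f) (N : ℕ) :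
    ∫ x, eulerScheme h τ a f N x ^ 2 ≤ ∫ x, f x ^ 2 := by
  have h1 := H.integral_sq_eulerScheme_add_le hf hfc N
  have h2 : 0 ≤ (1 - 54 * τ / h ^ 2) * ∑ n ∈ Finset.range N,
      τ * ∑ i, ∫ x, diffQuot (stdVec i) h (eulerScheme h τ a f n) x ^ 2 := by
    refine mul_nonneg (by linarith [H.one_sub_pos]) (Finset.sum_nonneg fun n _ => ?_)
    exact mul_nonneg H.τ_pos.le (Finset.sum_nonneg fun i _ => integral_nonneg fun x => sq_nonneg _)
  linarith

lemma discreteDivFree_diffQuot {b : Fin 3 → E3 → ℝ} (hb : DiscreteDivFree h b) (d : E3) (r : ℝ) :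
    DiscreteDivFree h fun i => diffQuot d r (b i) := by
  intro x
  have h1 := hb x
  have h2 := hb (x + r • d)
  have e2 : ∀ i, x + r • d - h • stdVec i = x - h • stdVec i + r • d := fun i => by abel
  simp only [diffQuot, Fin.sum_univ_three, e2, smul_eq_mul] at h1 h2 ⊢
  linear_combination r⁻¹ * h2 - r⁻¹ * h1

/-- The energy inequality for a difference quotient of the solution of the scheme. -/
lemma integral_sq_diffQuot_eulerScheme_add_le (H : StableVelocity h τ a) (hf : Continuous f)
    (hfc : HasCompactSupport f) {M : ℝ} (hM : ∀ x, |f x| ≤ M) (d : E3) (r : ℝ)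
    (hb : ∀ n i, Integrable fun x => diffQuot d r (a n i) x ^ 2) (N : ℕ) :
    (∫ x, diffQuot d r (eulerScheme h τ a f N) x ^ 2)
      + (1 - 54 * τ / h ^ 2) * ∑ n ∈ Finset.range N,
      τ * ∑ i, ∫ x, diffQuot (stdVec i) h (diffQuot d r (eulerScheme h τ a f n)) x ^ 2
      ≤ (∫ x, diffQuot d r f x ^ 2) + (1 + 54 * τ / h ^ 2) * M ^ 2 * ∑ n ∈ Finset.range N,
        τ * ∑ i, ∫ x, diffQuot d r (a n i) x ^ 2 := by
  induction N with
  | zero => simp [eulerScheme]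
  | succ N ih =>
    have hc := H.continuous_eulerScheme hf N
    have hs := hasCompactSupport_eulerScheme (h := h) (τ := τ) (a := a) hfc N
    -- By the Leibniz rule the source is the transport of the translated solution by the difference
    -- quotient of the velocity. Translating and taking difference quotients preserve, respectively,
    -- the sup bound and the vanishing discrete divergence.
    have := integral_sq_step_le (b := fun i => diffQuot d r (a N i))
      (g := fun y => eulerScheme h τ a f N (y + r • d)) (M := M)
      (f := diffQuot d r (eulerScheme h τ a f N)) H.h_pos H.τ_pos
      (H.continuous N) (H.abs_le N) (H.divFree N) (fun i => continuous_diffQuot _ _ (H.continuous N i))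
      (discreteDivFree_diffQuot (H.divFree N) d r) (hb N) (continuous_diffQuot _ _ hc)
      (hasCompactSupport_diffQuot _ _ hs) (by fun_prop)
      (hasCompactSupport_comp_add hs _) fun x => H.abs_eulerScheme_le hM N _
    rw [Finset.sum_range_succ, mul_add, Finset.sum_range_succ, mul_add]
    simp only [eulerScheme, diffQuot_eulerStep]
    linarith

end StableVelocity

/-! ### Weak compactness in Hilbert spaces -/

section Hilbert

variable {H : Type*} [NormedAddCommGroup H] [InnerProductSpace ℝ H] [CompleteSpace H]

/-- Bounded sequences in a Hilbert space converge weakly along any ultrafilter. -/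
lemma exists_weak_limit_ultrafilter (U : Ultrafilter ℕ) {x : ℕ → H} {R : ℝ} (hx : ∀ k, ‖x k‖ ≤ R) :
    ∃ y : H, ∀ z, Tendsto (fun k => inner ℝ (x k) z) U (𝓝 (inner ℝ y z)) := by
  let X : ℕ → WeakDual ℝ H := fun k => StrongDual.toWeakDual (InnerProductSpace.toDual ℝ H (x k))
  have hK := WeakDual.isCompact_closedBall (0 : StrongDual ℝ H) R
  have hmem : ∀ k, X k ∈ WeakDual.toStrongDual ⁻¹' Metric.closedBall (0 : StrongDual ℝ H) R := by
    intro k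
    simpa [X] using hx k
  obtain ⟨Y, -, hY⟩ := hK.ultrafilter_le_nhds (U.map X)
    (by rw [le_principal_iff]; exact Filter.mem_map.2 (Filter.univ_mem' hmem))
  refine ⟨(InnerProductSpace.toDual ℝ H).symm (WeakDual.toStrongDual Y), fun z => ?_⟩
  rw [InnerProductSpace.toDual_symm_apply]
  have : Tendsto (fun k => X k z) U (𝓝 (Y z)) := ((WeakDual.eval_continuous z).tendsto Y).comp hY
  simpa [X] using this

/-- Bounded sequences in a separable Hilbert space have weakly convergent subsequences. -/
lemma exists_weak_limit_subseq [SeparableSpace H] {x : ℕ → H} {R : ℝ} (hx : ∀ k, ‖x k‖ ≤ R) :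
    ∃ (θ : ℕ → ℕ) (y : H), StrictMono θ ∧
      ∀ z, Tendsto (fun k => inner ℝ (x (θ k)) z) atTop (𝓝 (inner ℝ y z)) := by
  let X : ℕ → WeakDual ℝ H := fun k => StrongDual.toWeakDual (InnerProductSpace.toDual ℝ H (x k))
  have hK := WeakDual.isSeqCompact_closedBall ℝ H (0 : StrongDual ℝ H) R
  have hmem : ∀ k, X k ∈ WeakDual.toStrongDual ⁻¹' Metric.closedBall (0 : StrongDual ℝ H) R := by
    intro k
    simpa [X] using hx k
  obtain ⟨Y, -, θ, hθ, hY⟩ := hK hmem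
  refine ⟨θ, (InnerProductSpace.toDual ℝ H).symm (WeakDual.toStrongDual Y), hθ, fun z => ?_⟩
  rw [InnerProductSpace.toDual_symm_apply]
  have : Tendsto (fun k => X (θ k) z) atTop (𝓝 (Y z)) :=
    ((WeakDual.eval_continuous z).tendsto Y).comp hY
  simpa [X] using this

lemma exists_weak_limit_subseq_family [SeparableSpace H] {ι : Type*} (s : Finset ι)
    {x : ι → ℕ → H} {R : ℝ} (hx : ∀ i k, ‖x i k‖ ≤ R) :
    ∃ (θ : ℕ → ℕ) (y : ι → H), StrictMono θ ∧
      ∀ i ∈ s, ∀ z, Tendsto (fun k => inner ℝ (x i (θ k)) z) atTop (𝓝 (inner ℝ (y i) z)) := by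
  classical
  induction s using Finset.induction_on with
  | empty => exact ⟨id, fun _ => 0, strictMono_id, by simp⟩
  | insert j s hj ih =>
    obtain ⟨θ, y, hθ, hy⟩ := ih
    obtain ⟨η, w, hη, hw⟩ := exists_weak_limit_subseq (x := fun k => x j (θ k)) (fun k => hx j (θ k))
    refine ⟨θ ∘ η, Function.update y j w, hθ.comp hη, fun i hi z => ?_⟩
    rcases Finset.mem_insert.1 hi with rfl | hi
    · simpa using hw z
    · have hij : i ≠ j := fun h => hj (h ▸ hi)
      simpa [hij, Function.comp_def] using (hy i hi z).comp hη.tendsto_atTop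

end Hilbert

/-! ### Weak convergence in `L²` and on time slabs -/

section WeakL2

variable {α : Type*} [MeasurableSpace α] {μ : Measure α}

/-- Weak convergence in `L²`. -/
def TendstoWeakL2 (μ : Measure α) (f : ℕ → α → ℝ) (l : Filter ℕ) (f' : α → ℝ) : Prop :=
  ∀ g : α → ℝ, MemLp g 2 μ → Tendsto (fun k => ∫ x, f k x * g x ∂μ) l (𝓝 (∫ x, f' x * g x ∂μ))

lemma inner_toLp_eq_integral {f g : α → ℝ} (hf : MemLp f 2 μ) (hg : MemLp g 2 μ) :
    inner ℝ (hf.toLp f) (hg.toLp g) = ∫ x, f x * g x ∂μ := by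
  rw [L2.inner_def]
  refine integral_congr_ae ?_
  filter_upwards [hf.coeFn_toLp, hg.coeFn_toLp] with x h1 h2
  rw [h1, h2]
  simp [mul_comm]

lemma norm_toLp_sq {f : α → ℝ} (hf : MemLp f 2 μ) : ‖hf.toLp f‖ ^ 2 = ∫ x, f x ^ 2 ∂μ := by
  rw [← real_inner_self_eq_norm_sq, inner_toLp_eq_integral hf hf]
  simp only [sq]

lemma norm_toLp_eq_sqrt {f : α → ℝ} (hf : MemLp f 2 μ) :
    ‖hf.toLp f‖ = √(∫ x, f x ^ 2 ∂μ) := by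
  rw [← norm_toLp_sq hf, Real.sqrt_sq (norm_nonneg _)]

lemma abs_integral_mul_le_sqrt {f g : α → ℝ} (hf : MemLp f 2 μ) (hg : MemLp g 2 μ) :
    |∫ x, f x * g x ∂μ| ≤ √(∫ x, f x ^ 2 ∂μ) * √(∫ x, g x ^ 2 ∂μ) := by
  rw [← inner_toLp_eq_integral hf hg, ← norm_toLp_eq_sqrt hf, ← norm_toLp_eq_sqrt hg]
  exact abs_real_inner_le_norm _ _

lemma enorm_sq_eq_ofReal (a : ℝ) : ‖a‖ₑ ^ 2 = ENNReal.ofReal (a ^ 2) := by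
  rw [← ofReal_norm, ← ENNReal.ofReal_pow (norm_nonneg _), Real.norm_eq_abs, sq_abs]

lemma memLp_two_of_lintegral_le {f : α → ℝ} (hf : AEStronglyMeasurable f μ) {C : ℝ}
    (h : ∫⁻ x, ‖f x‖ₑ ^ 2 ∂μ ≤ ENNReal.ofReal C) : MemLp f 2 μ := by
  refine ⟨hf, ?_⟩
  rw [eLpNorm_lt_top_iff_lintegral_rpow_enorm_lt_top (by norm_num) (by norm_num)]
  simpa using h.trans_lt ENNReal.ofReal_lt_top

lemma integral_sq_le_of_lintegral_le {f : α → ℝ} (hf : AEStronglyMeasurable f μ) {C : ℝ}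
    (hC : 0 ≤ C) (h : ∫⁻ x, ‖f x‖ₑ ^ 2 ∂μ ≤ ENNReal.ofReal C) : ∫ x, f x ^ 2 ∂μ ≤ C := by
  rw [integral_eq_lintegral_of_nonneg_ae (Eventually.of_forall fun x => sq_nonneg _)
    (hf.pow 2)]
  simp only [enorm_sq_eq_ofReal] at h
  exact ENNReal.toReal_le_of_le_ofReal hC h

lemma lintegral_enorm_sq_eq_ofReal_integral {f : α → ℝ} (hf : MemLp f 2 μ) :
    ∫⁻ x, ‖f x‖ₑ ^ 2 ∂μ = ENNReal.ofReal (∫ x, f x ^ 2 ∂μ) := by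
  rw [ofReal_integral_eq_lintegral_ofReal hf.integrable_sq
    (Eventually.of_forall fun x => sq_nonneg _)]
  simp only [enorm_sq_eq_ofReal]

lemma eLpNorm_two_sq {F : Type*} [NormedAddCommGroup F] (f : α → F) :
    eLpNorm f 2 μ ^ 2 = ∫⁻ x, ‖f x‖ₑ ^ 2 ∂μ := by
  rw [eLpNorm_eq_lintegral_rpow_enorm_toReal (by norm_num) (by norm_num)]
  rw [← ENNReal.rpow_natCast, ← ENNReal.rpow_mul]
  simp

lemma exists_tendstoWeakL2_ultrafilter (U : Ultrafilter ℕ) {f : ℕ → α → ℝ} {C : ℝ}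
    (hf : ∀ k, MemLp (f k) 2 μ) (hC : ∀ k, ∫ x, f k x ^ 2 ∂μ ≤ C) :
    ∃ f' : α → ℝ, StronglyMeasurable f' ∧ MemLp f' 2 μ ∧ TendstoWeakL2 μ f U f' := by
  obtain ⟨y, hy⟩ := exists_weak_limit_ultrafilter U (x := fun k => (hf k).toLp (f k)) (R := √C)
    (fun k => by rw [norm_toLp_eq_sqrt]; exact Real.sqrt_le_sqrt (hC k))
  refine ⟨y, Lp.stronglyMeasurable y, Lp.memLp y, fun g hg => ?_⟩
  have := hy (hg.toLp g)
  simp only [inner_toLp_eq_integral] at this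
  rwa [← Lp.toLp_coeFn y (Lp.memLp y), inner_toLp_eq_integral] at this

/-- The product of a weakly and a strongly convergent sequence. -/
lemma TendstoWeakL2.tendsto_integral_mul {f : ℕ → α → ℝ} {l : Filter ℕ} {f' : α → ℝ}
    (h : TendstoWeakL2 μ f l f') {C : ℝ} (hf : ∀ k, MemLp (f k) 2 μ)
    (hC : ∀ k, ∫ x, f k x ^ 2 ∂μ ≤ C) {g : ℕ → α → ℝ} {g' : α → ℝ} (hg : ∀ k, MemLp (g k) 2 μ)
    (hg' : MemLp g' 2 μ) (hgg : Tendsto (fun k => ∫ x, (g k x - g' x) ^ 2 ∂μ) l (𝓝 0)) :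
    Tendsto (fun k => ∫ x, f k x * g k x ∂μ) l (𝓝 (∫ x, f' x * g' x ∂μ)) := by
  have e : ∀ k, ∫ x, f k x * g k x ∂μ
      = (∫ x, f k x * g' x ∂μ) + ∫ x, f k x * (g k x - g' x) ∂μ := by
    intro k
    have h1 : Integrable (fun x => f k x * g' x) μ := (hf k).integrable_mul hg'
    have h2 : Integrable (fun x => f k x * (g k x - g' x)) μ :=
      (hf k).integrable_mul ((hg k).sub hg')
    rw [← integral_add h1 h2]
    congr 1; ext x; ring
  simp only [e]
  rw [← add_zero (∫ x, f' x * g' x ∂μ)]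
  refine (h g' hg').add ?_
  refine squeeze_zero_norm (a := fun k => √C * √(∫ x, (g k x - g' x) ^ 2 ∂μ)) (fun k => ?_) ?_
  · refine (abs_integral_mul_le_sqrt (hf k) ((hg k).sub hg')).trans ?_
    exact mul_le_mul_of_nonneg_right (Real.sqrt_le_sqrt (hC k)) (Real.sqrt_nonneg _)
  · have := (hgg.sqrt).const_mul (√C)
    simpa using this

/-- The finite time slab `(0, T] × ℝ³`, as a measure on space-time. -/
noncomputable def slab (T : ℝ) : Measure (ℝ × E3) :=
  (volume.restrict (Ioc 0 T)).prod (volume : Measure E3)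

/-- The half space-time, as a measure. -/
noncomputable def halfSpaceTime : Measure (ℝ × E3) :=
  (volume.restrict (Ioi (0 : ℝ))).prod (volume : Measure E3)

instance : SigmaFinite halfSpaceTime := by unfold halfSpaceTime; infer_instance

lemma slab_eq_restrict (T : ℝ) :
    slab T = (volume : Measure (ℝ × E3)).restrict (Ioc 0 T ×ˢ univ) := by
  rw [slab, Measure.volume_eq_prod, ← Measure.prod_restrict, Measure.restrict_univ]

lemma halfSpaceTime_eq_restrict :
    halfSpaceTime = (volume : Measure (ℝ × E3)).restrict (spaceTime : Set (ℝ × E3)) := by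
  rw [halfSpaceTime, Measure.volume_eq_prod]
  change _ = Measure.restrict _ (Ioi (0 : ℝ) ×ˢ univ)
  rw [← Measure.prod_restrict, Measure.restrict_univ]

lemma slab_eq_restrict_halfSpaceTime (T : ℝ) :
    slab T = halfSpaceTime.restrict (Iic T ×ˢ univ) := by
  rw [slab_eq_restrict, halfSpaceTime_eq_restrict,
    Measure.restrict_restrict (measurableSet_Iic.prod MeasurableSet.univ)]
  change _ = volume.restrict ((Iic T ×ˢ univ) ∩ (Ioi (0 : ℝ) ×ˢ univ))
  rw [prod_inter_prod, Iic_inter_Ioi, univ_inter]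

lemma slab_mono {S T : ℝ} (h : S ≤ T) : slab S ≤ slab T := by
  rw [slab_eq_restrict, slab_eq_restrict]
  exact Measure.restrict_mono (prod_mono (Ioc_subset_Ioc le_rfl h) le_rfl) le_rfl

lemma slab_le_halfSpaceTime (T : ℝ) : slab T ≤ halfSpaceTime := by
  rw [slab_eq_restrict_halfSpaceTime]; exact Measure.restrict_le_self

/-- Sequences of functions on space-time which are bounded in `L²(ℝ³)` uniformly in time have
subsequences that converge weakly in `L²` of any finite time slab. -/
lemma exists_tendstoWeakL2_slab {ι : Type*} [Fintype ι] {f : ι → ℕ → ℝ × E3 → ℝ} {C : ℝ}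
    (hf : ∀ i k, Measurable (f i k))
    (hC : ∀ i k s, ∫⁻ x, ‖f i k (s, x)‖ₑ ^ 2 ≤ ENNReal.ofReal C) :
    ∃ (θ : ℕ → ℕ) (f' : ι → ℝ × E3 → ℝ), StrictMono θ ∧ (∀ i, StronglyMeasurable (f' i)) ∧
      (∀ i T, MemLp (f' i) 2 (slab T)) ∧
      ∀ i T, TendstoWeakL2 (slab T) (fun k => f i (θ k)) atTop (f' i) := by
  have hI : IntegrableOn (fun s : ℝ => Real.exp (-s)) (Ioi 0) := integrableOn_exp_neg_Ioi 0
  set A : ℝ := ∫ s in Ioi (0 : ℝ), Real.exp (-s)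
  have hA : ∫⁻ s in Ioi (0 : ℝ), ENNReal.ofReal (Real.exp (-s)) = ENNReal.ofReal A :=
    (ofReal_integral_eq_lintegral_ofReal hI
      (Eventually.of_forall fun s => (Real.exp_pos _).le)).symm
  have hA0 : 0 ≤ A := integral_nonneg fun s => (Real.exp_pos _).le
  -- The weight `exp (-s)` turns a bound uniform in time into one in `L²` of the whole half
  -- space-time, so a single extraction serves all `T`. The weight is undone on each slab, where
  -- `exp s` is bounded.
  set F : ι → ℕ → ℝ × E3 → ℝ := fun i k p => Real.exp (-p.1) * f i k p with hF
  have hFm : ∀ i k, Measurable (F i k) := fun i k => by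
    have := hf i k
    fun_prop
  have hFC : ∀ i k, ∫⁻ p, ‖F i k p‖ₑ ^ 2 ∂halfSpaceTime ≤ ENNReal.ofReal (A * |C|) := by
    intro i k
    rw [halfSpaceTime, lintegral_prod _ (by have := hFm i k; fun_prop)]
    calc _ ≤ ∫⁻ s in Ioi (0 : ℝ), ENNReal.ofReal (Real.exp (-s)) * ENNReal.ofReal |C| := by
          refine setLIntegral_mono' measurableSet_Ioi fun s hs => ?_
          calc _ = ∫⁻ x, ENNReal.ofReal (Real.exp (-s)) ^ 2 * ‖f i k (s, x)‖ₑ ^ 2 := by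
                simp only [hF, enorm_mul, mul_pow, Real.enorm_of_nonneg (Real.exp_pos _).le]
            _ = ENNReal.ofReal (Real.exp (-s)) ^ 2 * ∫⁻ x, ‖f i k (s, x)‖ₑ ^ 2 := by
                rw [lintegral_const_mul]; have := hf i k; fun_prop
            _ ≤ _ := by
                gcongr
                · rw [sq]
                  refine mul_le_of_le_one_right' ?_
                  rw [ENNReal.ofReal_le_one, Real.exp_le_one_iff]
                  exact neg_nonpos.2 (le_of_lt hs)
                · exact (hC i k s).trans (ENNReal.ofReal_le_ofReal (le_abs_self C))
      _ = _ := by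
          rw [lintegral_mul_const _ (by fun_prop), hA, ENNReal.ofReal_mul hA0]
  have hFL : ∀ i k, MemLp (F i k) 2 halfSpaceTime := fun i k =>
    memLp_two_of_lintegral_le (hFm i k).aestronglyMeasurable (hFC i k)
  -- These two facts provide the separability of `L²` that extracting a subsequence requires.
  have : Fact ((2 : ℝ≥0∞) ≠ ∞) := ⟨by norm_num⟩
  have : IsSeparable halfSpaceTime := inferInstance
  obtain ⟨θ, y, hθ, hy⟩ := exists_weak_limit_subseq_family Finset.univ
    (x := fun i k => (hFL i k).toLp (F i k)) (R := √(A * |C|)) (fun i k => by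
      rw [norm_toLp_eq_sqrt]
      exact Real.sqrt_le_sqrt (integral_sq_le_of_lintegral_le (hFm i k).aestronglyMeasurable
        (by positivity) (hFC i k)))
  have hexp : Continuous fun p : ℝ × E3 => Real.exp p.1 := by fun_prop
  have hbd : ∀ T, ∀ᵐ p ∂slab T, ‖Real.exp p.1‖ ≤ Real.exp T := by
    intro T
    rw [slab_eq_restrict]
    filter_upwards [ae_restrict_mem (measurableSet_Ioc.prod MeasurableSet.univ)] with p hp
    rw [Real.norm_eq_abs, abs_of_pos (Real.exp_pos _)]
    exact Real.exp_le_exp.2 hp.1.2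
  have hmul : ∀ T {u : ℝ × E3 → ℝ}, MemLp u 2 (slab T) →
      MemLp (fun p => Real.exp p.1 * u p) 2 (slab T) := by
    intro T u hu
    refine hu.of_le_mul (c := Real.exp T) (hexp.aestronglyMeasurable.mul hu.1) ?_
    filter_upwards [hbd T] with p hp
    rw [norm_mul]
    gcongr
  refine ⟨θ, fun i p => Real.exp p.1 * y i p, hθ, fun i => ?_, fun i T => ?_, fun i T g hg => ?_⟩
  · exact hexp.stronglyMeasurable.mul (Lp.stronglyMeasurable (y i))
  · exact hmul T ((Lp.memLp (y i)).mono_measure (slab_le_halfSpaceTime T))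
  · have hS : MeasurableSet (Iic T ×ˢ (univ : Set E3)) := measurableSet_Iic.prod MeasurableSet.univ
    have hg2 : MemLp ((Iic T ×ˢ (univ : Set E3)).indicator fun p => Real.exp p.1 * g p) 2
        halfSpaceTime := by
      rw [memLp_indicator_iff_restrict hS, ← slab_eq_restrict_halfSpaceTime]
      exact hmul T hg
    have := hy i (Finset.mem_univ i) (hg2.toLp _)
    rw [← Lp.toLp_coeFn (y i) (Lp.memLp (y i))] at this
    simp only [inner_toLp_eq_integral] at this
    have e : ∀ u : ℝ × E3 → ℝ, ∫ p, u p * (Iic T ×ˢ (univ : Set E3)).indicator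
        (fun p => Real.exp p.1 * g p) p ∂halfSpaceTime = ∫ p, u p * (Real.exp p.1 * g p) ∂slab T := by
      intro u
      rw [slab_eq_restrict_halfSpaceTime, ← integral_indicator hS]
      congr with p
      by_cases hp : p ∈ Iic T ×ˢ (univ : Set E3) <;> simp [hp]
    simp only [e] at this
    convert this using 3 with k
    · ext p
      simp only [hF]
      rw [Real.exp_neg]
      field_simp
    · ext p; ring

end WeakL2

/-! ### Mollifiers and measurable representatives -/

/-- A smooth bump function around the origin with radius comparable to `1 / (n + 1)`. -/
noncomputable def shrinkingBump (n : ℕ) : ContDiffBump (0 : E3) where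
  rIn := 1 / (n + 1)
  rOut := 2 / (n + 1)
  rIn_pos := by positivity
  rIn_lt_rOut := by gcongr; norm_num

/-- The smooth probability density associated with `shrinkingBump`. -/
noncomputable def mollifier (n : ℕ) : E3 → ℝ := (shrinkingBump n).normed volume

lemma contDiff_mollifier (n : ℕ) {m : ℕ∞} : ContDiff ℝ m (mollifier n) :=
  (shrinkingBump n).contDiff_normed

lemma continuous_mollifier (n : ℕ) : Continuous (mollifier n) :=
  (shrinkingBump n).continuous_normed

lemma hasCompactSupport_mollifier (n : ℕ) : HasCompactSupport (mollifier n) :=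
  (shrinkingBump n).hasCompactSupport_normed

lemma mollifier_nonneg (n : ℕ) (x : E3) : 0 ≤ mollifier n x := (shrinkingBump n).nonneg_normed x

lemma integral_mollifier (n : ℕ) : ∫ x, mollifier n x = 1 := (shrinkingBump n).integral_normed

lemma mollifier_eq_zero {n : ℕ} {x : E3} (hx : 2 / (n + 1 : ℝ) ≤ ‖x‖) : mollifier n x = 0 := by
  have : x ∉ Function.support (mollifier n) := by
    rw [mollifier, ContDiffBump.support_normed_eq]
    simpa [shrinkingBump] using hx
  simpa using this

lemma ae_tendsto_integral_mollifier {f : E3 → ℝ} (hf : LocallyIntegrable f) :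
    ∀ᵐ x, Tendsto (fun n => ∫ y, f y * mollifier n (x - y)) atTop (𝓝 (f x)) := by
  have h1 : Tendsto (fun n : ℕ => (shrinkingBump n).rOut) atTop (𝓝 0) := by
    have := (tendsto_one_div_add_atTop_nhds_zero_nat (𝕜 := ℝ)).const_mul 2
    simpa [shrinkingBump, div_eq_mul_inv] using this
  have h2 : ∀ᶠ n : ℕ in atTop, (shrinkingBump n).rOut ≤ 2 * (shrinkingBump n).rIn := by
    refine Eventually.of_forall fun n => le_of_eq ?_
    simp [shrinkingBump]; ring
  filter_upwards [ContDiffBump.ae_convolution_tendsto_right_of_locallyIntegrable h1 h2 hf]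
    with x hx
  refine hx.congr fun n => ?_
  rw [convolution_eq_swap]
  simp [mollifier, mul_comm]

lemma hasCompactSupport_comp_const_sub {F : Type*} [Zero F] {f : E3 → F} (hf : HasCompactSupport f)
    (x : E3) : HasCompactSupport fun y => f (x - y) :=
  hf.comp_homeomorph (Homeomorph.subLeft x)

/-- A family of locally integrable functions which depends measurably on a parameter, in the sense
of distributions, has a jointly measurable version. -/
lemma exists_measurable_version {f : ℝ → E3 → ℝ} (hf : ∀ t, LocallyIntegrable (f t))
    (hm : ∀ ψ : E3 → ℝ, ContDiff ℝ ((⊤ : ℕ∞) : WithTop ℕ∞) ψ → HasCompactSupport ψ →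
      Measurable fun t => ∫ x, f t x * ψ x) :
    ∃ g : ℝ → E3 → ℝ, Measurable (Function.uncurry g) ∧ ∀ t, g t =ᵐ[volume] f t := by
  -- The mollified functions are continuous in `x` and measurable in `t`, hence jointly measurable.
  set G : ℕ → ℝ × E3 → ℝ := fun n p => ∫ y, f p.1 y * mollifier n (p.2 - y) with hG
  have hGm : ∀ n, Measurable (G n) := by
    intro n
    have := measurable_uncurry_of_continuous_of_measurable (m := inferInstance)
      (u := fun (x : E3) (t : ℝ) => ∫ y, f t y * mollifier n (x - y)) (fun t => ?_) (fun x => ?_)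
    · exact this.comp measurable_swap
    · have := (hasCompactSupport_mollifier n).continuous_convolution_left
        (ContinuousLinearMap.lsmul ℝ ℝ) (continuous_mollifier n) (hf t) (μ := volume)
      convert this using 2 with x
      rw [convolution_eq_swap]
      simp [mul_comm]
    · refine hm _ ((contDiff_mollifier n).comp (contDiff_const.sub contDiff_id)) ?_
      exact hasCompactSupport_comp_const_sub (hasCompactSupport_mollifier n) x
  -- The limit superior is defined and measurable everywhere, and at almost every `x` it is the
  -- limit given by Lebesgue differentiation.
  refine ⟨fun t x => limsup (fun n => G n (t, x)) atTop, Measurable.limsup hGm, fun t => ?_⟩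
  filter_upwards [ae_tendsto_integral_mollifier (hf t)] with x hx
  exact hx.limsup_eq

/-- Mollifiers centred at `x` are nonnegative of mass one, so testing against them and letting them
shrink bounds `|f x|` at almost every point. This transfers the maximum principle to weak limits. -/
lemma ae_abs_le_of_integral_le {f : E3 → ℝ} (hf : LocallyIntegrable f) {M : ℝ}
    (h : ∀ ψ : E3 → ℝ, ContDiff ℝ ((⊤ : ℕ∞) : WithTop ℕ∞) ψ → HasCompactSupport ψ →
      |∫ x, f x * ψ x| ≤ M * ∫ x, |ψ x|) : ∀ᵐ x, |f x| ≤ M := by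
  filter_upwards [ae_tendsto_integral_mollifier hf] with x hx
  refine le_of_tendsto hx.abs (Eventually.of_forall fun n => ?_)
  refine (h _ ((contDiff_mollifier n).comp (contDiff_const.sub contDiff_id))
    (hasCompactSupport_comp_const_sub (hasCompactSupport_mollifier n) x)).trans ?_
  simp only [Function.comp_def, id, abs_of_nonneg (mollifier_nonneg n _)]
  rw [integral_sub_left_eq_self (mollifier n) volume x, integral_mollifier, mul_one]

/-! ### Difference quotients of smooth functions -/

section MeanValue

variable {V : Type*} [NormedAddCommGroup V] [NormedSpace ℝ V]

/-- The mean value form expresses a difference quotient of a test function as an exact value of its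
derivative at a nearby point, which controls size, support and limit at once. -/
lemma exists_diffQuot_eq_fderiv {f : V → ℝ} (hf : ContDiff ℝ 1 f) (d : V) {r : ℝ} (hr : r ≠ 0)
    (x : V) : ∃ ξ, dist ξ x ≤ |r| * ‖d‖ ∧ diffQuot d r f x = fderiv ℝ f ξ d := by
  have hd : ∀ t : ℝ, HasDerivAt (fun t => f (x + t • (r • d))) (fderiv ℝ f (x + t • (r • d)) (r • d)) t := by
    intro t
    have h1 : HasDerivAt (fun t : ℝ => x + t • (r • d)) (r • d) t := by
      simpa using ((hasDerivAt_id t).smul_const (r • d)).const_add x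
    exact ((hf.differentiable (by norm_num)) _).hasFDerivAt.comp_hasDerivAt t h1
  obtain ⟨c, hc, hc'⟩ := exists_hasDerivAt_eq_slope (fun t => f (x + t • (r • d))) _ zero_lt_one
    (fun t _ => (hd t).continuousAt.continuousWithinAt) (fun t _ => hd t)
  refine ⟨x + c • (r • d), ?_, ?_⟩
  · rw [dist_eq_norm, add_sub_cancel_left, norm_smul, norm_smul, Real.norm_eq_abs,
      Real.norm_eq_abs, abs_of_pos hc.1]
    exact mul_le_of_le_one_left (by positivity) hc.2.le
  · simp only [one_smul, zero_smul, add_zero, sub_zero, div_one] at hc'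
    rw [diffQuot, ← hc', map_smul, smul_eq_mul, smul_eq_mul, inv_mul_cancel_left₀ hr]

lemma fderiv_diffQuot {f : V → ℝ} (hf : ContDiff ℝ 1 f) (d d' : V) (r : ℝ) (x : V) :
    fderiv ℝ (diffQuot d r f) x d' = diffQuot d r (fun y => fderiv ℝ f y d') x := by
  have hD := hf.differentiable (by norm_num)
  have h1 : DifferentiableAt ℝ (fun y => f (y + r • d)) x := by
    exact (hD _).comp x (by fun_prop)
  have h2 : fderiv ℝ (fun y => f (y + r • d)) x = fderiv ℝ f (x + r • d) :=
    fderiv_comp_add_right (f := f) (r • d)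
  unfold diffQuot
  rw [fderiv_fun_const_smul (h1.fun_sub (hD x)), fderiv_fun_sub h1 (hD x), h2]
  simp

lemma contDiff_diffQuot {f : V → ℝ} {n : WithTop ℕ∞} (hf : ContDiff ℝ n f) (d : V) (r : ℝ) :
    ContDiff ℝ n (diffQuot d r f) := by
  unfold diffQuot
  exact ((hf.comp (contDiff_id.add contDiff_const)).sub hf).const_smul r⁻¹

lemma exists_diffQuot_diffQuot_eq_fderiv {f : V → ℝ} (hf : ContDiff ℝ 2 f) (d d' : V) {r r' : ℝ}
    (hr : r ≠ 0) (hr' : r' ≠ 0) (x : V) :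
    ∃ ξ, dist ξ x ≤ |r| * ‖d‖ + |r'| * ‖d'‖ ∧
      diffQuot d' r' (diffQuot d r f) x = fderiv ℝ (fun y => fderiv ℝ f y d') ξ d := by
  obtain ⟨ξ, h1, h2⟩ := exists_diffQuot_eq_fderiv
    (contDiff_diffQuot (hf.of_le (by norm_num)) d r) d' hr' x
  have hf' : ContDiff ℝ 1 fun y => fderiv ℝ f y d' := by
    exact (hf.fderiv_right (m := 1) (by norm_num)).clm_apply contDiff_const
  obtain ⟨ζ, h3, h4⟩ := exists_diffQuot_eq_fderiv hf' d hr ξ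
  refine ⟨ζ, (dist_triangle _ _ _).trans (add_le_add h3 h1), ?_⟩
  rw [h2, fderiv_diffQuot (hf.of_le (by norm_num)), h4]

lemma continuous_fderiv_apply {f : V → ℝ} (hf : ContDiff ℝ 1 f) (d : V) :
    Continuous fun y => fderiv ℝ f y d :=
  (hf.continuous_fderiv (by norm_num)).clm_apply continuous_const

lemma continuous_fderiv_fderiv_apply {f : V → ℝ} (hf : ContDiff ℝ 2 f) (d d' : V) :
    Continuous fun y => fderiv ℝ (fun z => fderiv ℝ f z d) y d' :=
  continuous_fderiv_apply ((hf.fderiv_right (m := 1) (by norm_num)).clm_apply contDiff_const) d'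

end MeanValue

/-! ### Bounded convergence of discretized test functions -/

section BoundedConvergence

variable {α : Type*} [MeasurableSpace α] {μ : Measure α} {K : Set α}

/-- Bounded almost everywhere convergence of functions which vanish outside of `K`. -/
structure BoundedTendsto (μ : Measure α) (K : Set α) (c : ℕ → α → ℝ) (c' : α → ℝ) : Prop where
  aestronglyMeasurable : ∀ k, AEStronglyMeasurable (c k) μ
  bound : ∃ C, ∀ k x, |c k x| ≤ C
  eq_zero : ∀ k, ∀ x ∉ K, c k x = 0
  ae_tendsto : ∀ᵐ x ∂μ, Tendsto (fun k => c k x) atTop (𝓝 (c' x))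

namespace BoundedTendsto

variable {c : ℕ → α → ℝ} {c' : α → ℝ} {e : ℕ → α → ℝ} {e' : α → ℝ}

lemma add (hc : BoundedTendsto μ K c c') (he : BoundedTendsto μ K e e') :
    BoundedTendsto μ K (fun k x => c k x + e k x) fun x => c' x + e' x where
  aestronglyMeasurable k := (hc.aestronglyMeasurable k).add (he.aestronglyMeasurable k)
  bound := by
    obtain ⟨C, hC⟩ := hc.bound
    obtain ⟨D, hD⟩ := he.bound
    exact ⟨C + D, fun k x => (abs_add_le _ _).trans (add_le_add (hC k x) (hD k x))⟩
  eq_zero k x hx := by rw [hc.eq_zero k x hx, he.eq_zero k x hx, add_zero]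
  ae_tendsto := by
    filter_upwards [hc.ae_tendsto, he.ae_tendsto] with x h1 h2 using h1.add h2

lemma const_mul (hc : BoundedTendsto μ K c c') (r : ℝ) :
    BoundedTendsto μ K (fun k x => r * c k x) fun x => r * c' x where
  aestronglyMeasurable k := (hc.aestronglyMeasurable k).const_mul r
  bound := by
    obtain ⟨C, hC⟩ := hc.bound
    exact ⟨|r| * C, fun k x => by rw [abs_mul]; exact mul_le_mul_of_nonneg_left (hC k x) (abs_nonneg _)⟩
  eq_zero k x hx := by rw [hc.eq_zero k x hx, mul_zero]
  ae_tendsto := by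
    filter_upwards [hc.ae_tendsto] with x h1 using h1.const_mul r

lemma finset_sum {ι : Type*} (s : Finset ι) {c : ι → ℕ → α → ℝ} {c' : ι → α → ℝ}
    (hc : ∀ i ∈ s, BoundedTendsto μ K (c i) (c' i)) :
    BoundedTendsto μ K (fun k x => ∑ i ∈ s, c i k x) fun x => ∑ i ∈ s, c' i x := by
  classical
  induction s using Finset.induction_on with
  | empty => exact ⟨fun k => by simp [aestronglyMeasurable_const], ⟨0, by simp⟩, by simp, by simp⟩
  | insert i s hi ih =>
    simp only [Finset.sum_insert hi]
    exact (hc i (by simp)).add (ih fun j hj => hc j (by simp [hj]))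

lemma ae_eq_zero (hc : BoundedTendsto μ K c c') : ∀ᵐ x ∂μ, x ∉ K → c' x = 0 := by
  filter_upwards [hc.ae_tendsto] with x hx hxK
  exact tendsto_nhds_unique hx (by simp [hc.eq_zero _ x hxK])

lemma aestronglyMeasurable_lim (hc : BoundedTendsto μ K c c') : AEStronglyMeasurable c' μ :=
  aestronglyMeasurable_of_tendsto_ae atTop hc.aestronglyMeasurable hc.ae_tendsto

lemma exists_bound_lim (hc : BoundedTendsto μ K c c') :
    ∃ C, 0 ≤ C ∧ (∀ k x, |c k x| ≤ C) ∧ ∀ᵐ x ∂μ, |c' x| ≤ C := by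
  obtain ⟨C, hC⟩ := hc.bound
  refine ⟨|C|, abs_nonneg _, fun k x => (hC k x).trans (le_abs_self C), ?_⟩
  filter_upwards [hc.ae_tendsto] with x hx
  exact le_of_tendsto hx.abs (Eventually.of_forall fun k => (hC k x).trans (le_abs_self C))

variable {a : ℕ → α → ℝ} {v : α → ℝ}

/-- Splits `a c - v c'` as `(a - v) c + v (c - c')`. The first term is small because `c` is bounded
and lives in `K`; the second by dominated convergence, with majorant a multiple of `|v|²`. -/
lemma lintegral_mul_tendsto (hK : MeasurableSet K) (hc : BoundedTendsto μ K c c')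
    (ha : ∀ k, AEStronglyMeasurable (a k) μ) (hv : MemLp v 2 (μ.restrict K))
    (hvm : AEStronglyMeasurable v μ)
    (hav : Tendsto (fun k => ∫⁻ x in K, ‖a k x - v x‖ₑ ^ 2 ∂μ) atTop (𝓝 0)) :
    Tendsto (fun k => ∫⁻ x, ‖a k x * c k x - v x * c' x‖ₑ ^ 2 ∂μ) atTop (𝓝 0) := by
  obtain ⟨C, hC0, hC, hC'⟩ := hc.exists_bound_lim
  have hc'm := hc.aestronglyMeasurable_lim
  have hvK : ∫⁻ x in K, ‖v x‖ₑ ^ 2 ∂μ < ∞ := by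
    rw [← eLpNorm_two_sq]
    exact ENNReal.pow_lt_top hv.2
  have h2 : Tendsto (fun k => ∫⁻ x in K, ‖v x * (c k x - c' x)‖ₑ ^ 2 ∂μ) atTop (𝓝 0) := by
    have := tendsto_lintegral_of_dominated_convergence' (μ := μ.restrict K)
      (F := fun k x => ‖v x * (c k x - c' x)‖ₑ ^ 2) (f := fun _ => 0)
      (fun x => ENNReal.ofReal (2 * C) ^ 2 * ‖v x‖ₑ ^ 2) (fun k => ?_) (fun k => ?_) ?_ ?_
    · simpa using this
    · exact ((hv.1.mul ((hc.aestronglyMeasurable k).restrict.sub hc'm.restrict)).enorm.pow_const 2)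
    · filter_upwards [ae_restrict_of_ae hC'] with x hx
      rw [enorm_mul, mul_pow, mul_comm]
      gcongr
      rw [Real.enorm_eq_ofReal_abs]
      apply ENNReal.ofReal_le_ofReal
      calc |c k x - c' x| ≤ |c k x| + |c' x| := abs_sub _ _
        _ ≤ 2 * C := by linarith [hC k x]
    · rw [lintegral_const_mul' _ _ (by finiteness)]
      exact (ENNReal.mul_lt_top (by finiteness) hvK).ne
    · filter_upwards [ae_restrict_of_ae hc.ae_tendsto] with x hx
      have h3 : Tendsto (fun k => v x * (c k x - c' x)) atTop (𝓝 0) := by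
        simpa using (hx.sub_const (c' x)).const_mul (v x)
      have := (ENNReal.continuous_pow 2).tendsto _ |>.comp h3.enorm
      simpa [Function.comp_def] using this
  have h1 : Tendsto (fun k => 2 * ENNReal.ofReal C ^ 2 * ∫⁻ x in K, ‖a k x - v x‖ₑ ^ 2 ∂μ) atTop (𝓝 0) := by
    simpa using ENNReal.Tendsto.const_mul hav (Or.inr (by finiteness))
  have h3 : Tendsto (fun k => 2 * ENNReal.ofReal C ^ 2 * ∫⁻ x in K, ‖a k x - v x‖ₑ ^ 2 ∂μ
      + 2 * ∫⁻ x in K, ‖v x * (c k x - c' x)‖ₑ ^ 2 ∂μ) atTop (𝓝 0) := by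
    have := h1.add (ENNReal.Tendsto.const_mul h2 (Or.inr (by finiteness : (2 : ℝ≥0∞) ≠ ∞)))
    simpa using this
  refine tendsto_of_tendsto_of_tendsto_of_le_of_le tendsto_const_nhds h3 (fun k => bot_le)
    fun k => ?_
  have hm1 : AEMeasurable (fun x => ‖a k x - v x‖ₑ ^ 2) (μ.restrict K) :=
    (((ha k).sub hvm).enorm.pow_const 2).restrict
  calc ∫⁻ x, ‖a k x * c k x - v x * c' x‖ₑ ^ 2 ∂μ
      = ∫⁻ x in K, ‖a k x * c k x - v x * c' x‖ₑ ^ 2 ∂μ := by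
        rw [← lintegral_indicator hK]
        refine lintegral_congr_ae ?_
        filter_upwards [hc.ae_eq_zero] with x hx
        by_cases hxK : x ∈ K
        · simp [hxK]
        · simp [hxK, hx hxK, hc.eq_zero k x hxK]
    _ ≤ ∫⁻ x in K, (2 * ENNReal.ofReal C ^ 2 * ‖a k x - v x‖ₑ ^ 2
        + 2 * ‖v x * (c k x - c' x)‖ₑ ^ 2) ∂μ := by
        refine lintegral_mono fun x => ?_
        have e : a k x * c k x - v x * c' x = (a k x - v x) * c k x + v x * (c k x - c' x) := by ring
        have hCx : (c k x) ^ 2 ≤ C ^ 2 := sq_le_sq' (abs_le.1 (hC k x)).1 (abs_le.1 (hC k x)).2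
        have : (a k x * c k x - v x * c' x) ^ 2
            ≤ 2 * C ^ 2 * (a k x - v x) ^ 2 + 2 * (v x * (c k x - c' x)) ^ 2 := by
          rw [e]
          nlinarith [sq_nonneg ((a k x - v x) * c k x - v x * (c k x - c' x)),
            mul_le_mul_of_nonneg_left hCx (sq_nonneg (a k x - v x))]
        calc _ = ENNReal.ofReal ((a k x * c k x - v x * c' x) ^ 2) := enorm_sq_eq_ofReal _
          _ ≤ _ := ENNReal.ofReal_le_ofReal this
          _ = _ := by
            rw [ENNReal.ofReal_add (by positivity) (by positivity), ENNReal.ofReal_mul (by positivity),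
              ENNReal.ofReal_mul (by positivity), ENNReal.ofReal_mul (by positivity),
              enorm_sq_eq_ofReal, enorm_sq_eq_ofReal, ENNReal.ofReal_pow hC0]
            simp
    _ = _ := by
        rw [lintegral_add_left' (hm1.const_mul _), lintegral_const_mul'' _ hm1,
          lintegral_const_mul' _ _ (by finiteness)]

lemma memLp_mul (hK : MeasurableSet K) (hc : BoundedTendsto μ K c c')
    (hv : MemLp v 2 (μ.restrict K)) (hvm : AEStronglyMeasurable v μ) :
    MemLp (fun x => v x * c' x) 2 μ := by
  obtain ⟨C, hC0, -, hC'⟩ := hc.exists_bound_lim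
  have h1 : MemLp (K.indicator v) 2 μ := (memLp_indicator_iff_restrict hK).2 hv
  refine h1.of_le_mul (c := C) (hvm.mul hc.aestronglyMeasurable_lim) ?_
  filter_upwards [hc.ae_eq_zero, hC'] with x hx hx'
  by_cases hxK : x ∈ K
  · simp only [hxK, indicator_of_mem, norm_mul, Real.norm_eq_abs]
    rw [mul_comm]
    exact mul_le_mul_of_nonneg_right hx' (abs_nonneg _)
  · simp [hxK, hx hxK]

lemma memLp_mul_seq (hK : MeasurableSet K) (hc : BoundedTendsto μ K c c')
    (hv : MemLp v 2 (μ.restrict K)) (hvm : AEStronglyMeasurable v μ) (k : ℕ) :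
    MemLp (fun x => v x * c k x) 2 μ := by
  have hc' : BoundedTendsto μ K (fun _ => c k) (c k) :=
    ⟨fun _ => hc.aestronglyMeasurable k, hc.bound.imp fun C hC _ x => hC k x,
      fun _ => hc.eq_zero k, Eventually.of_forall fun x => tendsto_const_nhds⟩
  exact hc'.memLp_mul hK hv hvm

lemma memLp_lim (hK : MeasurableSet K) (hμK : μ K ≠ ∞) (hc : BoundedTendsto μ K c c') :
    MemLp c' 2 μ := by
  have : IsFiniteMeasure (μ.restrict K) := ⟨by simpa using hμK.lt_top⟩
  simpa using hc.memLp_mul hK (memLp_const (1 : ℝ)) aestronglyMeasurable_const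

lemma memLp_seq (hK : MeasurableSet K) (hμK : μ K ≠ ∞) (hc : BoundedTendsto μ K c c') (k : ℕ) :
    MemLp (c k) 2 μ := by
  have : IsFiniteMeasure (μ.restrict K) := ⟨by simpa using hμK.lt_top⟩
  simpa using hc.memLp_mul_seq hK (memLp_const (1 : ℝ)) aestronglyMeasurable_const k

lemma integral_mul_tendsto (hK : MeasurableSet K) (hc : BoundedTendsto μ K c c')
    (ha : ∀ k, AEStronglyMeasurable (a k) μ) (hv : MemLp v 2 (μ.restrict K))
    (hvm : AEStronglyMeasurable v μ)
    (hav : Tendsto (fun k => ∫⁻ x in K, ‖a k x - v x‖ₑ ^ 2 ∂μ) atTop (𝓝 0)) :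
    Tendsto (fun k => ∫ x, (a k x * c k x - v x * c' x) ^ 2 ∂μ) atTop (𝓝 0) := by
  have := (ENNReal.tendsto_toReal (by finiteness)).comp (hc.lintegral_mul_tendsto hK ha hv hvm hav)
  refine this.congr fun k => ?_
  have hm : AEStronglyMeasurable (fun x => a k x * c k x - v x * c' x) μ :=
    ((ha k).mul (hc.aestronglyMeasurable k)).sub (hvm.mul hc.aestronglyMeasurable_lim)
  rw [integral_eq_lintegral_of_nonneg_ae (Eventually.of_forall fun x => sq_nonneg _) (hm.pow 2)]
  simp only [Function.comp_def, enorm_sq_eq_ofReal]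

lemma integral_sub_sq_tendsto (hK : MeasurableSet K) (hμK : μ K ≠ ∞)
    (hc : BoundedTendsto μ K c c') :
    Tendsto (fun k => ∫ x, (c k x - c' x) ^ 2 ∂μ) atTop (𝓝 0) := by
  have : IsFiniteMeasure (μ.restrict K) := ⟨by simpa using hμK.lt_top⟩
  simpa using hc.integral_mul_tendsto hK (a := fun _ _ => 1) (v := fun _ => 1)
    (fun _ => aestronglyMeasurable_const) (memLp_const (1 : ℝ)) aestronglyMeasurable_const (by simp)

/-- Functions obtained by evaluating a test function at points which approach the argument. -/
lemma of_eval {V : Type*} [NormedAddCommGroup V] [MeasurableSpace V] [BorelSpace V]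
    [SecondCountableTopologyEither V ℝ] {μ : Measure V} {R : ℝ} {F : V → ℝ} (hF : Continuous F)
    (hFc : ∀ x, R < ‖x‖ → F x = 0) (hFC : ∃ C, ∀ x, |F x| ≤ C) {G : ℕ → V → ℝ}
    (hG : ∀ k, Continuous (G k)) {ρ : ℕ → ℝ} (hρ : Tendsto ρ atTop (𝓝 0)) {S : ℝ} (hρS : ∀ k, ρ k ≤ S)
    (h : ∀ k x, ∃ ξ, dist ξ x ≤ ρ k ∧ G k x = F ξ) :
    BoundedTendsto μ (Metric.closedBall 0 (R + S)) G F where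
  aestronglyMeasurable k := (hG k).aestronglyMeasurable
  bound := by
    obtain ⟨C, hC⟩ := hFC
    refine ⟨C, fun k x => ?_⟩
    obtain ⟨ξ, -, h2⟩ := h k x
    rw [h2]; exact hC ξ
  eq_zero k x hx := by
    obtain ⟨ξ, h1, h2⟩ := h k x
    rw [h2]
    refine hFc ξ ?_
    rw [mem_closedBall_zero_iff, not_le] at hx
    have h3 : ‖x‖ ≤ ‖ξ‖ + dist ξ x := by
      rw [dist_eq_norm]
      calc ‖x‖ = ‖ξ - (ξ - x)‖ := by rw [sub_sub_cancel]
        _ ≤ _ := norm_sub_le _ _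
    linarith [hρS k]
  ae_tendsto := Eventually.of_forall fun x => by
    choose ξ h1 h2 using fun k => h k x
    have : Tendsto ξ atTop (𝓝 x) := by
      rw [tendsto_iff_dist_tendsto_zero]
      exact squeeze_zero (fun k => dist_nonneg) h1 hρ
    simp only [h2]
    exact (hF.tendsto x).comp this

lemma mono_set {L : Set α} (hc : BoundedTendsto μ K c c') (hKL : K ⊆ L) : BoundedTendsto μ L c c' :=
  ⟨hc.aestronglyMeasurable, hc.bound, fun k x hx => hc.eq_zero k x fun h => hx (hKL h), hc.ae_tendsto⟩

/-- Space functions which are cut off at times approaching `t`, seen as functions on space-time. -/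
lemma timeCutoff {c : ℕ → E3 → ℝ} {c' : E3 → ℝ} {K : Set E3} (hc : BoundedTendsto volume K c c')
    {σ : ℕ → ℝ} {t : ℝ} (hσ : Tendsto σ atTop (𝓝 t)) (T : ℝ) :
    BoundedTendsto (slab T) (univ ×ˢ K)
      (fun k p => (Ioc 0 (σ k)).indicator (fun _ => c k p.2) p.1)
      (fun p => (Ioc 0 t).indicator (fun _ => c' p.2) p.1) where
  aestronglyMeasurable k := by
    have h1 : AEStronglyMeasurable (fun p : ℝ × E3 => c k p.2) (slab T) :=
      (hc.aestronglyMeasurable k).comp_snd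
    have := h1.indicator (measurableSet_Ioc.prod MeasurableSet.univ : MeasurableSet
      (Ioc 0 (σ k) ×ˢ (univ : Set E3)))
    convert this using 1
    ext p
    by_cases hp : p.1 ∈ Ioc 0 (σ k) <;> simp [indicator, hp]
  bound := by
    obtain ⟨C, hC⟩ := hc.bound
    refine ⟨C, fun k p => ?_⟩
    by_cases hp : p.1 ∈ Ioc 0 (σ k)
    · simp only [hp, indicator_of_mem]; exact hC k p.2
    · simpa [hp] using (abs_nonneg _).trans (hC k p.2)
  eq_zero k p hp := by
    have : p.2 ∉ K := fun h => hp ⟨mem_univ _, h⟩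
    by_cases hp : p.1 ∈ Ioc 0 (σ k) <;> simp [hp, hc.eq_zero k _ this]
  ae_tendsto := by
    -- The moving indicators may fail to converge only at time `t` itself, a null set.
    have h1 : ∀ᵐ p ∂slab T, p.1 ≠ t := by
      have : ∀ᵐ s ∂(volume.restrict (Ioc 0 T)), s ≠ t :=
        ae_restrict_of_ae (Measure.ae_ne volume t)
      exact Measure.quasiMeasurePreserving_fst.ae this
    have h2 : ∀ᵐ p ∂slab T, Tendsto (fun k => c k p.2) atTop (𝓝 (c' p.2)) :=
      Measure.quasiMeasurePreserving_snd.ae hc.ae_tendsto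
    filter_upwards [h1, h2] with p hp hp'
    by_cases h0 : 0 < p.1
    · rcases lt_or_gt_of_ne hp with h | h
      · have e : ∀ᶠ k in atTop, p.1 < σ k := hσ.eventually_const_lt h
        rw [indicator_of_mem (show p.1 ∈ Ioc 0 t from ⟨h0, h.le⟩)]
        refine hp'.congr' ?_
        filter_upwards [e] with k hk
        rw [indicator_of_mem (show p.1 ∈ Ioc 0 (σ k) from ⟨h0, hk.le⟩)]
      · have e : ∀ᶠ k in atTop, σ k < p.1 := hσ.eventually_lt_const h
        rw [indicator_of_notMem (show p.1 ∉ Ioc 0 t from fun h' => absurd h'.2 (not_le.2 h))]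
        refine tendsto_const_nhds.congr' ?_
        filter_upwards [e] with k hk
        rw [indicator_of_notMem (show p.1 ∉ Ioc 0 (σ k) from fun h' => absurd h'.2 (not_le.2 hk))]
    · simp [h0]

end BoundedTendsto

lemma slab_univ_prod_lt_top (T : ℝ) {K : Set E3} (hK : volume K ≠ ∞) : slab T (univ ×ˢ K) ≠ ∞ := by
  rw [slab, Measure.prod_prod]
  simp only [Measure.restrict_apply_univ, Real.volume_Ioc]
  finiteness

end BoundedConvergence

/-! ### Averaging over time steps and random offsets -/

/-- The uniform probability measure on the `n`-th time step `[n τ, (n + 1) τ)`. -/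
noncomputable def timeStep (τ : ℝ) (n : ℕ) : Measure ℝ :=
  ENNReal.ofReal τ⁻¹ • volume.restrict (Ico (n * τ) ((n + 1) * τ))

lemma isProbabilityMeasure_timeStep {τ : ℝ} (hτ : 0 < τ) (n : ℕ) :
    IsProbabilityMeasure (timeStep τ n) := by
  constructor
  rw [timeStep, Measure.smul_apply, Measure.restrict_apply_univ, Real.volume_Ico, smul_eq_mul,
    ← ENNReal.ofReal_mul (by positivity), ← ENNReal.ofReal_one]
  congr 1
  field_simp
  ring

lemma timeStep_index {τ : ℝ} (hτ : 0 < τ) {n : ℕ} {s : ℝ} (hs : s ∈ Ico (n * τ) ((n + 1) * τ)) :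
    ⌊s / τ⌋₊ = n := by
  have h0 : 0 ≤ s := le_trans (by positivity) hs.1
  rw [Nat.floor_eq_iff (by positivity), le_div_iff₀ hτ, div_lt_iff₀ hτ]
  exact hs

lemma mem_timeStep_index {τ : ℝ} (hτ : 0 < τ) {s : ℝ} (hs : 0 ≤ s) :
    s ∈ Ico ((⌊s / τ⌋₊ : ℕ) * τ) (((⌊s / τ⌋₊ : ℕ) + 1) * τ) := by
  rw [mem_Ico, ← le_div_iff₀ hτ, ← div_lt_iff₀ hτ]
  exact ⟨Nat.floor_le (by positivity), Nat.lt_floor_add_one _⟩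

lemma iUnion_timeStep {τ : ℝ} (hτ : 0 < τ) : ⋃ n : ℕ, Ico (n * τ) ((n + 1) * τ) = Ici (0 : ℝ) := by
  ext s
  rw [mem_iUnion, mem_Ici]
  exact ⟨fun ⟨n, hn⟩ => le_trans (by positivity) hn.1, fun hs => ⟨_, mem_timeStep_index hτ hs⟩⟩

lemma pairwise_disjoint_timeStep {τ : ℝ} (hτ : 0 < τ) :
    Pairwise (Function.onFun Disjoint fun n : ℕ => Ico (n * τ) ((n + 1) * τ)) := by
  intro m n hmn
  refine Set.disjoint_left.2 fun s h1 h2 => hmn ?_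
  rw [← timeStep_index hτ h1, ← timeStep_index hτ h2]

lemma lintegral_Ioi_eq_tsum {τ : ℝ} (hτ : 0 < τ) (u : ℝ → ℝ≥0∞) :
    ∫⁻ s in Ioi 0, u s = ∑' n : ℕ, ∫⁻ s in Ico (n * τ) ((n + 1) * τ), u s := by
  rw [setLIntegral_congr Ioi_ae_eq_Ici, ← iUnion_timeStep hτ,
    lintegral_iUnion (fun n => measurableSet_Ico) (pairwise_disjoint_timeStep hτ)]

lemma lintegral_timeStep (τ : ℝ) (n : ℕ) (u : ℝ → ℝ≥0∞) :
    ∫⁻ s, u s ∂timeStep τ n = ENNReal.ofReal τ⁻¹ * ∫⁻ s in Ico (n * τ) ((n + 1) * τ), u s := by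
  rw [timeStep, lintegral_smul_measure, smul_eq_mul]

lemma lintegral_const_timeStep {τ : ℝ} (n : ℕ) (c : ℕ → ℝ≥0∞) (hτ : 0 < τ) :
    ∫⁻ s in Ico (n * τ) ((n + 1) * τ), c ⌊s / τ⌋₊ = ENNReal.ofReal τ * c n := by
  rw [setLIntegral_congr_fun measurableSet_Ico (g := fun _ => c n)
    (fun s hs => by simp only [timeStep_index hτ hs])]
  rw [setLIntegral_const, Real.volume_Ico, mul_comm]
  congr 2
  ring

section Averaging

variable {Y : Type*} [MeasurableSpace Y] {P : Measure Y} [IsProbabilityMeasure P] {o : Y → E3}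
  {τ : ℝ}

/-- The average of `f` over the `n`-th time step and over the random space offset `o`. -/
noncomputable def gridAverage (P : Measure Y) (o : Y → E3) (τ : ℝ) (f : ℝ × E3 → ℝ) (n : ℕ)
    (x : E3) : ℝ :=
  ∫ q, f (q.1, x + o q.2) ∂(timeStep τ n).prod P

lemma lintegral_lintegral_gridAverage (hτ : 0 < τ) (ho : Measurable o) {u : ℝ × E3 → ℝ≥0∞}
    (hu : Measurable u) (n : ℕ) :
    ∫⁻ x, ∫⁻ q, u (q.1, x + o q.2) ∂(timeStep τ n).prod P
      = ENNReal.ofReal τ⁻¹ * ∫⁻ s in Ico (n * τ) ((n + 1) * τ), ∫⁻ x, u (s, x) := by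
  have := isProbabilityMeasure_timeStep hτ n
  rw [lintegral_lintegral_swap (by fun_prop), ← lintegral_timeStep]
  have : ∀ q : ℝ × Y, ∫⁻ x, u (q.1, x + o q.2) = ∫⁻ x, u (q.1, x) := fun q =>
    lintegral_add_right_eq_self (fun x => u (q.1, x)) (o q.2)
  simp only [this]
  have hm : Measurable fun s => ∫⁻ x, u (s, x) := Measurable.lintegral_prod_right hu
  rw [lintegral_prod _ (by fun_prop)]
  simp

/-- Offsets disappear by translation invariance, and averaging over each step preserves the total
over that step. Together with Jensen's inequality this makes grid averaging a contraction of `L²`,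
whatever the grid. -/
lemma lintegral_Ioi_gridAverage (hτ : 0 < τ) (ho : Measurable o) {u : ℝ × E3 → ℝ≥0∞}
    (hu : Measurable u) :
    ∫⁻ s in Ioi 0, ∫⁻ x, ∫⁻ q, u (q.1, x + o q.2) ∂(timeStep τ ⌊s / τ⌋₊).prod P
      = ∫⁻ s in Ioi 0, ∫⁻ x, u (s, x) := by
  rw [lintegral_Ioi_eq_tsum hτ, lintegral_Ioi_eq_tsum hτ]
  congr 1; ext n
  rw [lintegral_const_timeStep n
    (fun n => ∫⁻ x, ∫⁻ q, u (q.1, x + o q.2) ∂(timeStep τ n).prod P) hτ,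
    lintegral_lintegral_gridAverage hτ ho hu, ← mul_assoc, ← ENNReal.ofReal_mul hτ.le,
    mul_inv_cancel₀ hτ.ne', ENNReal.ofReal_one, one_mul]

lemma enorm_integral_sq_le {Z : Type*} [MeasurableSpace Z] {Q : Measure Z} [IsProbabilityMeasure Q]
    {f : Z → ℝ} (hf : AEStronglyMeasurable f Q) : ‖∫ z, f z ∂Q‖ₑ ^ 2 ≤ ∫⁻ z, ‖f z‖ₑ ^ 2 ∂Q := by
  rw [← eLpNorm_two_sq]
  gcongr
  calc ‖∫ z, f z ∂Q‖ₑ ≤ ∫⁻ z, ‖f z‖ₑ ∂Q := enorm_integral_le_lintegral_enorm _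
    _ = eLpNorm f 1 Q := eLpNorm_one_eq_lintegral_enorm.symm
    _ ≤ eLpNorm f 2 Q := eLpNorm_le_eLpNorm_of_exponent_le (by norm_num) hf

lemma measurable_comp_floor {Z : Type*} [MeasurableSpace Z] (τ : ℝ) {u : ℕ → E3 → Z}
    (hu : ∀ n, Measurable (u n)) : Measurable fun p : ℝ × E3 => u ⌊p.1 / τ⌋₊ p.2 := by
  have h1 : Measurable (Function.uncurry u) := measurable_from_prod_countable_right hu
  have h2 : Measurable fun p : ℝ × E3 => (⌊p.1 / τ⌋₊, p.2) :=
    (Nat.measurable_floor.comp (measurable_fst.div_const τ)).prodMk measurable_snd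
  exact h1.comp h2

lemma measurable_lintegral_gridAverage (hτ : 0 < τ) (ho : Measurable o) {u : ℝ × E3 → ℝ≥0∞}
    (hu : Measurable u) (n : ℕ) :
    Measurable fun x => ∫⁻ q, u (q.1, x + o q.2) ∂(timeStep τ n).prod P := by
  have := isProbabilityMeasure_timeStep hτ n
  have h : Measurable fun p : E3 × (ℝ × Y) => u (p.2.1, p.1 + o p.2.2) := by fun_prop
  exact h.lintegral_prod_right'

lemma lintegral_halfSpaceTime_gridAverage (hτ : 0 < τ) (ho : Measurable o) {u : ℝ × E3 → ℝ≥0∞}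
    (hu : Measurable u) :
    ∫⁻ p : ℝ × E3, ∫⁻ q, u (q.1, p.2 + o q.2) ∂(timeStep τ ⌊p.1 / τ⌋₊).prod P ∂halfSpaceTime
      = ∫⁻ p, u p ∂halfSpaceTime := by
  rw [halfSpaceTime, lintegral_prod _ hu.aemeasurable, ← lintegral_Ioi_gridAverage (P := P) hτ ho hu,
    lintegral_prod]
  exact (measurable_comp_floor τ (measurable_lintegral_gridAverage hτ ho hu)).aemeasurable

lemma lintegral_gridAverage_sq_le (hτ : 0 < τ) (ho : Measurable o) {f : ℝ × E3 → ℝ}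
    (hf : Measurable f) (n : ℕ) :
    ∫⁻ x, ‖gridAverage P o τ f n x‖ₑ ^ 2
      ≤ ENNReal.ofReal τ⁻¹ * ∫⁻ s in Ico (n * τ) ((n + 1) * τ), ∫⁻ x, ‖f (s, x)‖ₑ ^ 2 := by
  have := isProbabilityMeasure_timeStep hτ n
  rw [← lintegral_lintegral_gridAverage (P := P) hτ ho (u := fun p => ‖f p‖ₑ ^ 2) (by fun_prop)]
  refine lintegral_mono fun x => enorm_integral_sq_le (Q := (timeStep τ n).prod P) ?_
  exact Measurable.aestronglyMeasurable (by fun_prop)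

lemma enorm_add_four_sq_le (a b c d : ℝ) :
    ‖a + b + c + d‖ₑ ^ 2 ≤ 4 * (‖a‖ₑ ^ 2 + ‖b‖ₑ ^ 2 + ‖c‖ₑ ^ 2 + ‖d‖ₑ ^ 2) := by
  simp only [enorm_sq_eq_ofReal]
  rw [← ENNReal.ofReal_add (by positivity) (by positivity),
    ← ENNReal.ofReal_add (by positivity) (by positivity),
    ← ENNReal.ofReal_add (by positivity) (by positivity),
    show (4 : ℝ≥0∞) = ENNReal.ofReal 4 by simp, ← ENNReal.ofReal_mul (by norm_num)]
  apply ENNReal.ofReal_le_ofReal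
  nlinarith [sq_nonneg (a - b), sq_nonneg (a - c), sq_nonneg (a - d), sq_nonneg (b - c),
    sq_nonneg (b - d), sq_nonneg (c - d)]

/-- Averages of `L²` functions over shrinking grids converge in `L²`. -/
lemma tendsto_gridAverage {P : ℕ → Measure Y} (hP : ∀ k, IsProbabilityMeasure (P k))
    {o : ℕ → Y → E3} {τ : ℕ → ℝ}
    (ho : ∀ k, Measurable (o k)) {r : ℕ → ℝ} (hor : ∀ k, ∀ᵐ y ∂P k, ‖o k y‖ ≤ r k)
    (hr : Tendsto r atTop (𝓝 0)) (hτ : ∀ k, 0 < τ k) (hτ0 : Tendsto τ atTop (𝓝 0))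
    {F : ℝ × E3 → ℝ} (hF : Measurable F) (hF2 : MemLp F 2 halfSpaceTime)
    {f : ℕ → ℝ × E3 → ℝ} (hf : ∀ k, Measurable (f k))
    (hf2 : ∀ k, MemLp (f k) 2 halfSpaceTime)
    (hfF : Tendsto (fun k => ∫⁻ p, ‖f k p - F p‖ₑ ^ 2 ∂halfSpaceTime) atTop (𝓝 0))
    {T : ℝ} {K : Set E3} (hK : volume K ≠ ∞) :
    Tendsto (fun k => ∫⁻ p in univ ×ˢ K, ‖gridAverage (P k) (o k) (τ k) (f k) ⌊p.1 / τ k⌋₊ p.2 - F p‖ₑ ^ 2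
      ∂slab T) atTop (𝓝 0) := by
  set μ := (slab T).restrict (univ ×ˢ K)
  have hμ : μ ≤ halfSpaceTime := Measure.restrict_le_self.trans (slab_le_halfSpaceTime T)
  have hμT : μ univ ≠ ∞ := by
    simp only [μ, Measure.restrict_apply_univ]; exact slab_univ_prod_lt_top T hK
  rw [ENNReal.tendsto_nhds_zero]
  intro ε hε
  obtain ⟨δ, hδ0, hδ⟩ : ∃ δ : ℝ≥0∞, 0 < δ ∧ 4 * (δ + δ + δ + δ) ≤ ε := by
    refine ⟨ε / 16, ENNReal.div_pos hε.ne' (by norm_num), le_of_eq ?_⟩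
    rw [show 4 * (ε / 16 + ε / 16 + ε / 16 + ε / 16) = ε / 16 * 16 by ring]
    exact ENNReal.div_mul_cancel (by norm_num) (by norm_num)
  -- With `g` continuous and compactly supported, the error is split into four parts: `f k - F` and
  -- `F - g` under the average, both controlled by the contraction property; the oscillation of `g`
  -- at the scale of the grid; and `F - g` at the point itself.
  obtain ⟨g, hgc, hgδ, hg, -⟩ : ∃ g : ℝ × E3 → ℝ, HasCompactSupport g ∧
      ∫⁻ p, ‖F p - g p‖ₑ ^ 2 ∂halfSpaceTime ≤ δ ∧ Continuous g ∧ True := by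
    have hS : MeasurableSet (spaceTime : Set (ℝ × E3)) := spaceTime.isOpen.measurableSet
    have h1 : MemLp ((spaceTime : Set (ℝ × E3)).indicator F) 2 volume := by
      rw [memLp_indicator_iff_restrict hS, ← halfSpaceTime_eq_restrict]; exact hF2
    obtain ⟨δ', hδ'0, hδ'⟩ : ∃ δ' : ℝ≥0∞, δ' ≠ 0 ∧ δ' ^ 2 ≤ δ := by
      refine ⟨min 1 δ, by simp [hδ0.ne'], ?_⟩
      calc min 1 δ ^ 2 = min 1 δ * min 1 δ := sq _
        _ ≤ 1 * δ := mul_le_mul' (min_le_left _ _) (min_le_right _ _)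
        _ = δ := one_mul _
    obtain ⟨g, hgc, hgδ, hg, -⟩ := h1.exists_hasCompactSupport_eLpNorm_sub_le (by norm_num) hδ'0
    refine ⟨g, hgc, ?_, hg, trivial⟩
    refine le_trans ?_ ((pow_le_pow_left' hgδ 2).trans hδ')
    rw [eLpNorm_two_sq, halfSpaceTime_eq_restrict, ← lintegral_indicator hS]
    refine lintegral_mono fun p => ?_
    by_cases hp : p ∈ (spaceTime : Set (ℝ × E3)) <;> simp [hp]
  obtain ⟨η, hη0, hη⟩ : ∃ η : ℝ, 0 < η ∧ ENNReal.ofReal (η ^ 2) * μ univ ≤ δ := by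
    have : Tendsto (fun η : ℝ => ENNReal.ofReal (η ^ 2) * μ univ) (𝓝[>] 0) (𝓝 0) := by
      have h1 : Tendsto (fun η : ℝ => ENNReal.ofReal (η ^ 2)) (𝓝[>] 0) (𝓝 0) := by
        have : Continuous fun η : ℝ => ENNReal.ofReal (η ^ 2) :=
          ENNReal.continuous_ofReal.comp (continuous_pow 2)
        simpa using (this.tendsto 0).mono_left nhdsWithin_le_nhds
      simpa using ENNReal.Tendsto.mul_const h1 (Or.inr hμT)
    have h2 := (this.eventually_lt_const hδ0).and self_mem_nhdsWithin
    obtain ⟨η, h3, h4⟩ := h2.exists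
    exact ⟨η, h4, h3.le⟩
  obtain ⟨ζ, hζ0, hζ⟩ := Metric.uniformContinuous_iff.1
    (hgc.uniformContinuous_of_continuous hg) η hη0
  have ev1 : ∀ᶠ k in atTop, τ k < ζ := hτ0.eventually_lt_const hζ0
  have ev2 : ∀ᶠ k in atTop, r k < ζ := hr.eventually_lt_const hζ0
  have ev3 : ∀ᶠ k in atTop, ∫⁻ p, ‖f k p - F p‖ₑ ^ 2 ∂halfSpaceTime ≤ δ :=
    hfF.eventually_le_const hδ0
  filter_upwards [ev1, ev2, ev3] with k h1 h2 h3
  have := hP k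
  have hgm := hg.measurable
  have hfk := hf k
  set W : (ℝ × E3 → ℝ≥0∞) → ℝ × E3 → ℝ≥0∞ := fun u p =>
    ∫⁻ q, u (q.1, p.2 + o k q.2) ∂(timeStep (τ k) ⌊p.1 / τ k⌋₊).prod (P k) with hW
  have hWm : ∀ {u}, Measurable u → Measurable (W u) := fun hu =>
    measurable_comp_floor (τ k) (measurable_lintegral_gridAverage (hτ k) (ho k) hu)
  have hWμ : ∀ {u}, Measurable u → ∫⁻ p, W u p ∂μ ≤ ∫⁻ p, u p ∂halfSpaceTime := fun hu =>
    (lintegral_mono' hμ le_rfl).trans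
      (lintegral_halfSpaceTime_gridAverage (P := P k) (hτ k) (ho k) hu).le
  -- At almost every point the averaged function is square integrable. This is needed for the
  -- Bochner average to be a genuine integral rather than the default value zero.
  have hfin : ∀ᵐ p ∂μ, W (fun p => ‖f k p‖ₑ ^ 2) p < ∞ := by
    refine ae_lt_top (hWm (u := fun p => ‖f k p‖ₑ ^ 2) (by fun_prop))
      ((hWμ (u := fun p => ‖f k p‖ₑ ^ 2) (by fun_prop)).trans_lt ?_).ne
    rw [← eLpNorm_two_sq]
    exact ENNReal.pow_lt_top (hf2 k).2
  have hpos : ∀ᵐ p ∂μ, 0 < p.1 := by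
    refine ae_restrict_of_ae ?_
    rw [slab_eq_restrict]
    filter_upwards [ae_restrict_mem (measurableSet_Ioc.prod MeasurableSet.univ)] with p hp
    exact hp.1.1
  calc ∫⁻ p, ‖gridAverage (P k) (o k) (τ k) (f k) ⌊p.1 / τ k⌋₊ p.2 - F p‖ₑ ^ 2 ∂μ
      ≤ ∫⁻ p, 4 * (W (fun p => ‖f k p - F p‖ₑ ^ 2) p + W (fun p => ‖F p - g p‖ₑ ^ 2) p
          + ENNReal.ofReal (η ^ 2) + ‖F p - g p‖ₑ ^ 2) ∂μ := by
        refine lintegral_mono_ae ?_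
        filter_upwards [hfin, hpos] with p hp hp0
        have := isProbabilityMeasure_timeStep (hτ k) ⌊p.1 / τ k⌋₊
        set Q := (timeStep (τ k) ⌊p.1 / τ k⌋₊).prod (P k) with hQ
        have hm : Measurable fun q : ℝ × Y => f k (q.1, p.2 + o k q.2) := by
          have := ho k; fun_prop
        have hm2 : ∀ {u : ℝ × E3 → ℝ}, Measurable u → Measurable fun q : ℝ × Y =>
            ‖u (q.1, p.2 + o k q.2)‖ₑ ^ 2 := fun hu => by
          have := ho k; fun_prop
        have hint : Integrable (fun q : ℝ × Y => f k (q.1, p.2 + o k q.2)) Q := by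
          refine MemLp.integrable (q := 2) (by norm_num) ⟨hm.aestronglyMeasurable, ?_⟩
          rw [eLpNorm_lt_top_iff_lintegral_rpow_enorm_lt_top (by norm_num) (by norm_num)]
          simpa using hp
        have e : gridAverage (P k) (o k) (τ k) (f k) ⌊p.1 / τ k⌋₊ p.2 - F p
            = ∫ q, (f k (q.1, p.2 + o k q.2) - F p) ∂Q := by
          rw [integral_sub hint (integrable_const _), integral_const]
          simp [gridAverage, hQ]
        have hnear : ∀ᵐ q ∂Q, dist (q.1, p.2 + o k q.2) p < ζ := by
          have a1 : ∀ᵐ s ∂timeStep (τ k) ⌊p.1 / τ k⌋₊, dist s p.1 < ζ := by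
            refine Measure.ae_smul_measure ?_ _
            filter_upwards [ae_restrict_mem measurableSet_Ico] with s hs
            have hp' := mem_timeStep_index (hτ k) hp0.le
            rw [Real.dist_eq, abs_lt]
            constructor <;> nlinarith [hs.1, hs.2, hp'.1, hp'.2]
          have a2 : ∀ᵐ q ∂Q, dist q.1 p.1 < ζ := Measure.quasiMeasurePreserving_fst.ae a1
          have a3 : ∀ᵐ q ∂Q, ‖o k q.2‖ ≤ r k := Measure.quasiMeasurePreserving_snd.ae (hor k)
          filter_upwards [a2, a3] with q h4 h5
          rw [Prod.dist_eq]
          refine max_lt h4 ?_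
          rw [dist_eq_norm, add_sub_cancel_left]
          exact h5.trans_lt h2
        calc ‖gridAverage (P k) (o k) (τ k) (f k) ⌊p.1 / τ k⌋₊ p.2 - F p‖ₑ ^ 2
            ≤ ∫⁻ q, ‖f k (q.1, p.2 + o k q.2) - F p‖ₑ ^ 2 ∂Q := by
              rw [e]
              exact enorm_integral_sq_le (hm.sub_const _).aestronglyMeasurable
          _ ≤ ∫⁻ q, 4 * (‖f k (q.1, p.2 + o k q.2) - F (q.1, p.2 + o k q.2)‖ₑ ^ 2
                + ‖F (q.1, p.2 + o k q.2) - g (q.1, p.2 + o k q.2)‖ₑ ^ 2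
                + ENNReal.ofReal (η ^ 2) + ‖F p - g p‖ₑ ^ 2) ∂Q := by
              refine lintegral_mono_ae ?_
              filter_upwards [hnear] with q hq
              have e2 : f k (q.1, p.2 + o k q.2) - F p
                  = (f k (q.1, p.2 + o k q.2) - F (q.1, p.2 + o k q.2))
                    + (F (q.1, p.2 + o k q.2) - g (q.1, p.2 + o k q.2))
                    + (g (q.1, p.2 + o k q.2) - g p) + (g p - F p) := by ring
              rw [e2]
              refine (enorm_add_four_sq_le _ _ _ _).trans ?_
              rw [← enorm_neg (g p - F p), neg_sub]
              gcongr
              rw [enorm_sq_eq_ofReal]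
              apply ENNReal.ofReal_le_ofReal
              rw [sq_le_sq, abs_of_pos hη0]
              exact (hζ hq).le
          _ = _ := by
              rw [lintegral_const_mul' _ _ (by norm_num), lintegral_add_right _ measurable_const,
                lintegral_add_right _ measurable_const,
                lintegral_add_left (hm2 (u := fun p => f k p - F p) (by fun_prop))]
              simp [hW, hQ]
    _ = 4 * (∫⁻ p, W (fun p => ‖f k p - F p‖ₑ ^ 2) p ∂μ + ∫⁻ p, W (fun p => ‖F p - g p‖ₑ ^ 2) p ∂μ
          + ENNReal.ofReal (η ^ 2) * μ univ + ∫⁻ p, ‖F p - g p‖ₑ ^ 2 ∂μ) := by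
        have w1 := hWm (u := fun p => ‖f k p - F p‖ₑ ^ 2) (by fun_prop)
        rw [lintegral_const_mul' _ _ (by norm_num), lintegral_add_right _ (by fun_prop),
          lintegral_add_right _ measurable_const, lintegral_add_left w1, lintegral_const]
    _ ≤ 4 * (δ + δ + δ + δ) := by
        gcongr
        · exact (hWμ (by fun_prop)).trans h3
        · exact (hWμ (by fun_prop)).trans hgδ
        · exact (lintegral_mono' hμ le_rfl).trans hgδ
    _ ≤ ε := hδ

end Averaging

/-! ### Lower semicontinuity and estimates in the homogeneous Sobolev space -/

section LowerSemicontinuity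

variable {F : Type*} [NormedAddCommGroup F]

lemma lintegral_le_of_forall_closedBall {u : E3 → ℝ≥0∞} {c : ℝ≥0∞}
    (h : ∀ n : ℕ, ∫⁻ x in Metric.closedBall 0 n, u x ≤ c) : ∫⁻ x, u x ≤ c := by
  have hU : ⋃ n : ℕ, Metric.closedBall (0 : E3) n = univ := Metric.iUnion_closedBall_nat 0
  rw [← setLIntegral_univ, ← hU, setLIntegral_iUnion_of_directed]
  · exact iSup_le h
  · refine (monotone_nat_of_le_succ fun n => ?_).directed_le
    exact Metric.closedBall_subset_closedBall (by simp)

/-- Lower semicontinuity of the `L^p` norm under convergence in `L¹_loc`. -/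
lemma eLpNorm_le_of_tendsto_locally {w : ℕ → E3 → F} {u : E3 → F} {p : ℝ≥0∞} (hp0 : p ≠ 0)
    (hp : p ≠ ∞) (hw : ∀ n, AEStronglyMeasurable (w n) volume) (hu : AEStronglyMeasurable u volume)
    (hwu : ∀ K : Set E3, IsCompact K → Tendsto (fun n => ∫⁻ x in K, ‖w n x - u x‖ₑ) atTop (𝓝 0))
    {c : ℕ → ℝ≥0∞} {c' : ℝ≥0∞} (hc : ∀ n, eLpNorm (w n) p volume ≤ c n)
    (hcc : Tendsto c atTop (𝓝 c')) : eLpNorm u p volume ≤ c' := by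
  have hR : ∀ R : ℕ, eLpNorm u p (volume.restrict (Metric.closedBall 0 R)) ≤ c' := by
    intro R
    -- Convergence holds only locally: on each ball a subsequence converges almost everywhere and
    -- Fatou's lemma applies; the balls then exhaust the space.
    have h1 : Tendsto (fun n => eLpNorm (w n - u) 1 (volume.restrict (Metric.closedBall 0 R)))
        atTop (𝓝 0) := by
      simpa [eLpNorm_one_eq_lintegral_enorm] using hwu _ (isCompact_closedBall 0 (R : ℝ))
    obtain ⟨ns, hns, hae⟩ := (tendstoInMeasure_of_tendsto_eLpNorm one_ne_zero
      (fun n => (hw n).restrict) hu.restrict h1).exists_seq_tendsto_ae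
    refine (Lp.eLpNorm_lim_le_liminf_eLpNorm (fun n => (hw (ns n)).restrict) u hae).trans ?_
    calc _ ≤ liminf (fun n => c (ns n)) atTop := by
          refine liminf_le_liminf (Eventually.of_forall fun n => ?_)
          exact (eLpNorm_mono_measure _ Measure.restrict_le_self).trans (hc _)
      _ = c' := (hcc.comp hns.tendsto_atTop).liminf_eq
  have hpos : 0 < p.toReal := ENNReal.toReal_pos hp0 hp
  rw [eLpNorm_eq_lintegral_rpow_enorm_toReal hp0 hp, one_div, ENNReal.rpow_inv_le_iff hpos]
  refine lintegral_le_of_forall_closedBall fun n => ?_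
  have := hR n
  rwa [eLpNorm_eq_lintegral_rpow_enorm_toReal hp0 hp, one_div, ENNReal.rpow_inv_le_iff hpos] at this

end LowerSemicontinuity

section Sobolev

variable {F : Type*} [NormedAddCommGroup F] [NormedSpace ℝ F]

/-- Difference quotients of a test function are controlled by the derivative. -/
lemma eLpNorm_diffQuot_le [CompleteSpace F] {f : E3 → F} (hf : ContDiff ℝ 1 f) (d : E3) (r : ℝ) :
    eLpNorm (diffQuot d r f) 2 volume ≤ eLpNorm (fun x => fderiv ℝ f x d) 2 volume := by
  rcases eq_or_ne r 0 with rfl | hr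
  · have : diffQuot d 0 f = 0 := by ext x; simp [diffQuot]
    simp [this]
  have hcont : Continuous fun y => fderiv ℝ f y d :=
    (hf.continuous_fderiv (by norm_num)).clm_apply continuous_const
  -- The difference quotient is the mean of the derivative along the segment; Jensen's inequality
  -- and translation invariance then give constant one.
  have key : ∀ x, diffQuot d r f x = ∫ t in Ioc (0 : ℝ) 1, fderiv ℝ f (x + t • (r • d)) d := by
    intro x
    have hd : ∀ t : ℝ, HasDerivAt (fun t => f (x + t • (r • d))) (r • fderiv ℝ f (x + t • (r • d)) d) t := by
      intro t
      have h1 : HasDerivAt (fun t : ℝ => x + t • (r • d)) (r • d) t := by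
        simpa using ((hasDerivAt_id t).smul_const (r • d)).const_add x
      have := ((hf.differentiable (by norm_num)) (x + t • (r • d))).hasFDerivAt.comp_hasDerivAt t h1
      rwa [map_smul] at this
    have hc : Continuous fun t : ℝ => r • fderiv ℝ f (x + t • (r • d)) d := by
      have : Continuous fun t : ℝ => x + t • (r • d) := by fun_prop
      exact (hcont.comp this).const_smul r
    have := intervalIntegral.integral_eq_sub_of_hasDerivAt (fun t _ => hd t)
      (hc.intervalIntegrable 0 1)
    rw [intervalIntegral.integral_of_le zero_le_one, integral_smul] at this
    rw [diffQuot, ← inv_smul_smul₀ hr (∫ t in Ioc (0 : ℝ) 1, fderiv ℝ f (x + t • (r • d)) d), this]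
    simp
  have : IsProbabilityMeasure (volume.restrict (Ioc (0 : ℝ) 1)) := ⟨by simp⟩
  rw [← ENNReal.pow_le_pow_left_iff two_ne_zero, eLpNorm_two_sq, eLpNorm_two_sq]
  calc ∫⁻ x, ‖diffQuot d r f x‖ₑ ^ 2
      ≤ ∫⁻ x, ∫⁻ t in Ioc (0 : ℝ) 1, ‖fderiv ℝ f (x + t • (r • d)) d‖ₑ ^ 2 := by
        refine lintegral_mono fun x => ?_
        have hm : AEStronglyMeasurable (fun t : ℝ => fderiv ℝ f (x + t • (r • d)) d)
            (volume.restrict (Ioc (0 : ℝ) 1)) := by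
          have : Continuous fun t : ℝ => x + t • (r • d) := by fun_prop
          exact (hcont.comp this).aestronglyMeasurable
        rw [key, ← eLpNorm_two_sq]
        gcongr
        refine (enorm_integral_le_lintegral_enorm _).trans ?_
        rw [← eLpNorm_one_eq_lintegral_enorm]
        exact eLpNorm_le_eLpNorm_of_exponent_le (by norm_num) hm
    _ = ∫⁻ t in Ioc (0 : ℝ) 1, ∫⁻ x, ‖fderiv ℝ f (x + t • (r • d)) d‖ₑ ^ 2 := by
        refine lintegral_lintegral_swap ?_
        have : Continuous fun q : E3 × ℝ => q.1 + q.2 • (r • d) := by fun_prop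
        have h2 : Continuous fun q : E3 × ℝ => ‖fderiv ℝ f (q.1 + q.2 • (r • d)) d‖ₑ ^ 2 :=
          (ENNReal.continuous_pow 2).comp (hcont.comp this).enorm
        exact h2.measurable.aemeasurable
    _ = ∫⁻ x, ‖fderiv ℝ f x d‖ₑ ^ 2 := by
        have : ∀ t : ℝ, ∫⁻ x, ‖fderiv ℝ f (x + t • (r • d)) d‖ₑ ^ 2 = ∫⁻ x, ‖fderiv ℝ f x d‖ₑ ^ 2 :=
          fun t => lintegral_add_right_eq_self (fun x => ‖fderiv ℝ f x d‖ₑ ^ 2) _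
        simp [this]

variable {u : E3 → F} {Du : Fin 3 → E3 → F}

lemma MemHomSobolev.aestronglyMeasurable (h : MemHomSobolev u Du) :
    AEStronglyMeasurable u volume := by
  have := (h.weakDeriv 0).1
  simp only [Opens.coe_top, locallyIntegrableOn_univ] at this
  exact this.aestronglyMeasurable

/-- Passes from test functions to the completion by lower semicontinuity. The constant one matters,
since it reappears in the final energy inequality. -/
lemma MemHomSobolev.eLpNorm_diffQuot_le [CompleteSpace F] (h : MemHomSobolev u Du) (j : Fin 3)
    (r : ℝ) : eLpNorm (diffQuot (stdVec j) r u) 2 volume ≤ eLpNorm (Du j) 2 volume := by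
  obtain ⟨w, hw, hDw⟩ := h.approx
  have hwm : ∀ n, AEStronglyMeasurable (w n) volume := fun n => (w n).continuous.aestronglyMeasurable
  have shift : ∀ {g : E3 → F}, AEStronglyMeasurable g volume →
      AEStronglyMeasurable (fun x => g (x + r • stdVec j)) volume := fun hg =>
    hg.comp_measurePreserving (measurePreserving_add_right volume _)
  have hm : ∀ {g : E3 → F}, AEStronglyMeasurable g volume →
      AEStronglyMeasurable (diffQuot (stdVec j) r g) volume := fun hg =>
    ((shift hg).sub hg).const_smul _
  refine eLpNorm_le_of_tendsto_locally (w := fun n => diffQuot (stdVec j) r (w n))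
    (c := fun n => eLpNorm (fun x => fderiv ℝ (w n) x (stdVec j) - Du j x) 2 volume
      + eLpNorm (Du j) 2 volume) (by norm_num) (by norm_num) (fun n => hm (hwm n))
    (hm h.aestronglyMeasurable) (fun K hK => ?_) (fun n => ?_) ?_
  · have hK' : IsCompact ((fun x => x + r • stdVec j) '' K) := hK.image (by fun_prop)
    have hsh : ∀ n, ∫⁻ x in K, ‖w n (x + r • stdVec j) - u (x + r • stdVec j)‖ₑ
        = ∫⁻ x in (fun x => x + r • stdVec j) '' K, ‖w n x - u x‖ₑ := fun n =>
      ((measurePreserving_add_right volume (r • stdVec j)).setLIntegral_comp_emb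
        (MeasurableEquiv.addRight (r • stdVec j)).measurableEmbedding
        (fun x => ‖w n x - u x‖ₑ) K)
    have h1 := (hw _ hK').add (hw K hK)
    have h2 := ENNReal.Tendsto.const_mul h1 (Or.inr (by finiteness : ‖r⁻¹‖ₑ ≠ ∞))
    simp only [add_zero, mul_zero] at h2
    refine tendsto_of_tendsto_of_tendsto_of_le_of_le tendsto_const_nhds h2 (fun n => bot_le)
      fun n => ?_
    dsimp only
    rw [← hsh, ← lintegral_add_left', ← lintegral_const_mul' _ _ (by finiteness)]
    · refine lintegral_mono fun x => ?_
      have e : diffQuot (stdVec j) r (w n) x - diffQuot (stdVec j) r u x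
          = r⁻¹ • ((w n (x + r • stdVec j) - u (x + r • stdVec j)) - (w n x - u x)) := by
        simp only [diffQuot, ← smul_sub]; congr 1; abel
      rw [e, enorm_smul]
      gcongr
      exact enorm_sub_le
    · exact ((shift (hwm n)).sub (shift h.aestronglyMeasurable)).enorm.restrict
  · refine (_root_.eLpNorm_diffQuot_le ((w n).contDiff.of_le (by norm_num)) _ r).trans ?_
    have hD : AEStronglyMeasurable (fun x => fderiv ℝ (w n) x (stdVec j)) volume :=
      (((w n).contDiff.continuous_fderiv (by norm_num)).clm_apply
        continuous_const).aestronglyMeasurable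
    calc _ = eLpNorm ((fun x => fderiv ℝ (w n) x (stdVec j) - Du j x) + Du j) 2 volume := by
          congr 1; ext x; simp
      _ ≤ _ := eLpNorm_add_le (hD.sub (h.memLp j).1) (h.memLp j).1 (by norm_num)
  · simpa using (hDw j).add_const (eLpNorm (Du j) 2 volume)

lemma norm_clm_le_sum (L : E3 →L[ℝ] F) : ‖L‖ ≤ ∑ j, ‖L (stdVec j)‖ := by
  refine L.opNorm_le_bound (Finset.sum_nonneg fun j _ => norm_nonneg _) fun x => ?_
  have hx : x = ∑ j, x j • stdVec j := by
    have := (EuclideanSpace.basisFun (Fin 3) ℝ).sum_repr x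
    simpa [stdVec] using this.symm
  conv_lhs => rw [hx]
  rw [map_sum, Finset.sum_mul]
  refine (norm_sum_le _ _).trans (Finset.sum_le_sum fun j _ => ?_)
  rw [map_smul, norm_smul, mul_comm]
  gcongr
  exact PiLp.norm_apply_le x j

/-- Gagliardo–Nirenberg–Sobolev in dimension three, `1/6 = 1/2 - 1/3`, for the approximating test
functions and then in the limit. The realization of `Ḣ¹` by test functions is essential, as it
excludes nonzero constants. -/
lemma exists_sobolev_const [FiniteDimensional ℝ F] : ∃ C : NNReal, ∀ {u : E3 → F} {Du : Fin 3 → E3 → F},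
    MemHomSobolev u Du → eLpNorm u 6 volume ≤ C * ∑ j, eLpNorm (Du j) 2 volume := by
  refine ⟨SNormLESNormFDerivOfEqConst F (volume : Measure E3) ((2 : NNReal) : ℝ), fun {u Du} h => ?_⟩
  obtain ⟨w, hw, hDw⟩ := h.approx
  set C := SNormLESNormFDerivOfEqConst F (volume : Measure E3) ((2 : NNReal) : ℝ)
  have hwm : ∀ n, AEStronglyMeasurable (w n) volume := fun n => (w n).continuous.aestronglyMeasurable
  refine eLpNorm_le_of_tendsto_locally (w := fun n => w n)
    (c := fun n => C * ∑ j, (eLpNorm (fun x => fderiv ℝ (w n) x (stdVec j) - Du j x) 2 volume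
      + eLpNorm (Du j) 2 volume)) (by norm_num) (by norm_num) hwm
    h.aestronglyMeasurable hw (fun n => ?_) ?_
  · have h1 := eLpNorm_le_eLpNorm_fderiv_of_eq (F := F) (volume : Measure E3)
      ((w n).contDiff.of_le (by norm_num)) (w n).hasCompactSupport (p := 2) (p' := 6) (by norm_num)
      (by simp) (by simp; norm_num)
    refine h1.trans (mul_le_mul' le_rfl ?_)
    rw [ENNReal.coe_ofNat]
    have hD : ∀ j, AEStronglyMeasurable (fun x => fderiv ℝ (w n) x (stdVec j)) volume := fun j =>
      (((w n).contDiff.continuous_fderiv (by norm_num)).clm_apply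
        continuous_const).aestronglyMeasurable
    calc eLpNorm (fderiv ℝ (w n)) 2 volume
        ≤ eLpNorm (fun x => ∑ j, ‖fderiv ℝ (w n) x (stdVec j)‖) 2 volume := by
          refine eLpNorm_mono_real fun x => norm_clm_le_sum _
      _ ≤ ∑ j, eLpNorm (fun x => ‖fderiv ℝ (w n) x (stdVec j)‖) 2 volume := by
          have := eLpNorm_sum_le (s := Finset.univ) (μ := volume) (p := 2)
            (f := fun (j : Fin 3) x => ‖fderiv ℝ (w n) x (stdVec j)‖) (fun j _ => (hD j).norm)
            (by norm_num)
          convert this using 2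
          ext x; simp
      _ ≤ _ := by
          refine Finset.sum_le_sum fun j _ => ?_
          rw [eLpNorm_norm]
          calc _ = eLpNorm ((fun x => fderiv ℝ (w n) x (stdVec j) - Du j x) + Du j) 2 volume := by
                congr 1; ext x; simp
            _ ≤ _ := eLpNorm_add_le ((hD j).sub (h.memLp j).1) (h.memLp j).1 (by norm_num)
  · refine ENNReal.Tendsto.const_mul ?_ (Or.inr (by simp))
    refine tendsto_finsetSum _ fun j _ => ?_
    simpa using (hDw j).add_const (eLpNorm (Du j) 2 volume)

end Sobolev

/-! ### Edge velocities as face fluxes of a mollified field -/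

/-- The probability measure with density `mollifier m`. -/
noncomputable def mollifierMeasure (m : ℕ) : Measure E3 :=
  volume.withDensity fun z => ENNReal.ofReal (mollifier m z)

lemma lintegral_mollifierMeasure (m : ℕ) (u : E3 → ℝ≥0∞) :
    ∫⁻ z, u z ∂mollifierMeasure m = ∫⁻ z, ENNReal.ofReal (mollifier m z) * u z := by
  have hm := (continuous_mollifier m).measurable
  rw [mollifierMeasure, lintegral_withDensity_eq_lintegral_mul_non_measurable _ (by fun_prop)
    (Eventually.of_forall fun z => ENNReal.ofReal_lt_top)]
  rfl

lemma integral_mollifierMeasure (m : ℕ) (u : E3 → ℝ) :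
    ∫ z, u z ∂mollifierMeasure m = ∫ z, mollifier m z * u z := by
  have hm := (continuous_mollifier m).measurable
  rw [mollifierMeasure, integral_withDensity_eq_integral_toReal_smul (by fun_prop)
    (Eventually.of_forall fun z => ENNReal.ofReal_lt_top)]
  simp [ENNReal.toReal_ofReal (mollifier_nonneg m _)]

instance (m : ℕ) : IsProbabilityMeasure (mollifierMeasure m) := by
  constructor
  rw [← lintegral_one, lintegral_mollifierMeasure]
  simp only [mul_one]
  rw [← ofReal_integral_eq_lintegral_ofReal, integral_mollifier, ENNReal.ofReal_one]
  · exact (continuous_mollifier m).integrable_of_hasCompactSupport (hasCompactSupport_mollifier m)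
  · exact Eventually.of_forall fun z => mollifier_nonneg m z

lemma ae_norm_le_mollifierMeasure (m : ℕ) : ∀ᵐ z ∂mollifierMeasure m, ‖z‖ ≤ 2 / (m + 1 : ℝ) := by
  have hm := (continuous_mollifier m).measurable
  rw [mollifierMeasure, ae_withDensity_iff (by fun_prop)]
  refine Eventually.of_forall fun z hz => ?_
  by_contra! h
  exact hz (by rw [mollifier_eq_zero h.le, ENNReal.ofReal_zero])

/-- Averages against a mollifier are controlled by the `L⁶` norm. -/
lemma exists_lintegral_mollifierMeasure_le (m : ℕ) : ∃ C : NNReal, ∀ u : E3 → ℝ≥0∞, Measurable u →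
    ∀ x, ∫⁻ z, u (x - z) ∂mollifierMeasure m ≤ C * (∫⁻ z, u z ^ (6 : ℝ)) ^ (1 / 6 : ℝ) := by
  obtain ⟨B, hB⟩ := (continuous_mollifier m).bounded_above_of_compact_support
    (hasCompactSupport_mollifier m)
  have hm := (continuous_mollifier m).measurable
  refine ⟨(B.toNNReal) ^ (1 / 6 : ℝ), fun u hu x => ?_⟩
  calc ∫⁻ z, u (x - z) ∂mollifierMeasure m
      -- Hölder's inequality against the constant one, on a probability measure.
      ≤ (∫⁻ z, u (x - z) ^ (6 : ℝ) ∂mollifierMeasure m) ^ (1 / 6 : ℝ) := by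
        have := ENNReal.lintegral_mul_le_Lp_mul_Lq (mollifierMeasure m)
          (Real.HolderConjugate.conjExponent (p := 6) (by norm_num))
          (f := fun z => u (x - z)) (g := fun _ => 1) (by fun_prop) (by fun_prop)
        simpa using this
    _ ≤ (∫⁻ z, ENNReal.ofReal B * u (x - z) ^ (6 : ℝ)) ^ (1 / 6 : ℝ) := by
        rw [lintegral_mollifierMeasure]
        gcongr with z
        exact (le_abs_self _).trans (hB z)
    _ = _ := by
        rw [lintegral_const_mul _ (by fun_prop), ENNReal.mul_rpow_of_nonneg _ _ (by norm_num),
          lintegral_sub_left_eq_self (fun z => u z ^ (6 : ℝ)) x,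
          ENNReal.coe_rpow_of_nonneg _ (by norm_num)]
        rfl

/-- A divergence free vector field which is bounded in `L⁶`, uniformly in time. -/
structure BoundedField (V : ℝ × E3 → E3) (N : NNReal) : Prop where
  measurable : Measurable V
  lintegral_le : ∀ s, ∫⁻ x, ‖V (s, x)‖ₑ ^ (6 : ℝ) ≤ (N : ℝ≥0∞) ^ (6 : ℝ)
  divFree : ∀ s, ∀ ψ : E3 → ℝ, ContDiff ℝ ((⊤ : ℕ∞) : WithTop ℕ∞) ψ → HasCompactSupport ψ →
    ∫ x, ∑ i, V (s, x) i * fderiv ℝ ψ x (stdVec i) = 0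

/-- The mollification in space of the `i`-th component of a vector field. -/
noncomputable def mollifiedField (m : ℕ) (V : ℝ × E3 → E3) (i : Fin 3) (p : ℝ × E3) : ℝ :=
  ∫ z, mollifier m z * V (p.1, p.2 - z) i

/-- The face of the unit cube on which the `i`-th coordinate is `1`. -/
def unitFace (i : Fin 3) (y : Fin 2 → ℝ) : E3 := WithLp.toLp 2 (i.insertNth 1 y)

/-- The uniform probability on the parameters of a face, times the mollifier. -/
noncomputable def faceMeasure (m : ℕ) : Measure ((Fin 2 → ℝ) × E3) :=
  (volume.restrict (Icc 0 1)).prod (mollifierMeasure m)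

/-- A point of the face of size `h`, moved by the mollification variable. -/
def faceOffset (h : ℝ) (i : Fin 3) (y : (Fin 2 → ℝ) × E3) : E3 := h • unitFace i y.1 - y.2

/-- The edge velocities given by the flux of the mollified field through the faces of a cell. -/
noncomputable def faceVelocity (h τ : ℝ) (m : ℕ) (V : ℝ × E3 → E3) (n : ℕ) (i : Fin 3) : E3 → ℝ :=
  gridAverage (faceMeasure m) (faceOffset h i) τ (fun p => V p i) n

instance : IsProbabilityMeasure ((volume : Measure (Fin 2 → ℝ)).restrict (Icc 0 1)) := by
  constructor
  rw [Measure.restrict_apply_univ, Real.volume_Icc_pi]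
  simp

instance (m : ℕ) : IsProbabilityMeasure (faceMeasure m) := by unfold faceMeasure; infer_instance

lemma continuous_unitFace (i : Fin 3) : Continuous (unitFace i) := by
  unfold unitFace
  refine (PiLp.continuous_toLp 2 _).comp ?_
  exact Continuous.finInsertNth i continuous_const continuous_id

lemma measurable_faceOffset (h : ℝ) (i : Fin 3) : Measurable (faceOffset h i) := by
  have := (continuous_unitFace i).measurable
  unfold faceOffset
  fun_prop

lemma norm_unitFace_le (i : Fin 3) {y : Fin 2 → ℝ} (hy : y ∈ Icc 0 1) : ‖unitFace i y‖ ≤ 2 := by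
  have h1 : ∀ j, ‖unitFace i y j‖ ≤ 1 := by
    intro j
    change ‖(i.insertNth 1 y : Fin 3 → ℝ) j‖ ≤ 1
    rcases eq_or_ne j i with rfl | hj
    · simp
    · obtain ⟨l, rfl⟩ := Fin.exists_succAbove_eq hj
      rw [Fin.insertNth_apply_succAbove, Real.norm_eq_abs, abs_le]
      exact ⟨by linarith [hy.1 l, show (0 : Fin 2 → ℝ) l = 0 from rfl], hy.2 l⟩
  rw [EuclideanSpace.norm_eq, Real.sqrt_le_left (by norm_num)]
  calc ∑ j, ‖unitFace i y j‖ ^ 2 ≤ ∑ j : Fin 3, (1 : ℝ) :=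
        Finset.sum_le_sum fun j _ => pow_le_one₀ (norm_nonneg _) (h1 j)
    _ ≤ 2 ^ 2 := by norm_num

lemma ae_norm_faceOffset_le {h : ℝ} (hh : 0 ≤ h) (m : ℕ) (i : Fin 3) :
    ∀ᵐ y ∂faceMeasure m, ‖faceOffset h i y‖ ≤ 2 * h + 2 / (m + 1 : ℝ) := by
  have h1 : ∀ᵐ y ∂faceMeasure m, y.1 ∈ Icc (0 : Fin 2 → ℝ) 1 :=
    Measure.quasiMeasurePreserving_fst.ae (ae_restrict_mem measurableSet_Icc)
  have h2 : ∀ᵐ y ∂faceMeasure m, ‖y.2‖ ≤ 2 / (m + 1 : ℝ) :=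
    Measure.quasiMeasurePreserving_snd.ae (ae_norm_le_mollifierMeasure m)
  filter_upwards [h1, h2] with y hy1 hy2
  refine (norm_sub_le _ _).trans (add_le_add ?_ hy2)
  rw [norm_smul, Real.norm_eq_abs, abs_of_nonneg hh, mul_comm]
  exact mul_le_mul_of_nonneg_right (norm_unitFace_le i hy1) hh

namespace BoundedField

variable {V : ℝ × E3 → E3} {N : NNReal} {h τ : ℝ} {m : ℕ}

lemma measurable_apply (hV : BoundedField V N) (i : Fin 3) : Measurable fun p => V p i := by
  have h1 := hV.measurable
  have h2 : Measurable fun x : E3 => x i := (EuclideanSpace.proj i : E3 →L[ℝ] ℝ).continuous.measurable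
  exact h2.comp h1

lemma lintegral_mollifier_le (hV : BoundedField V N) {C : NNReal}
    (hC : ∀ u : E3 → ℝ≥0∞, Measurable u → ∀ x, ∫⁻ z, u (x - z) ∂mollifierMeasure m
      ≤ C * (∫⁻ z, u z ^ (6 : ℝ)) ^ (1 / 6 : ℝ)) (i : Fin 3) (s : ℝ) (x : E3) :
    ∫⁻ z, ‖V (s, x - z) i‖ₑ ∂mollifierMeasure m ≤ (C * N : NNReal) := by
  have hm := hV.measurable
  calc ∫⁻ z, ‖V (s, x - z) i‖ₑ ∂mollifierMeasure m
      ≤ ∫⁻ z, ‖V (s, x - z)‖ₑ ∂mollifierMeasure m := by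
        refine lintegral_mono fun z => ?_
        exact enorm_le_iff_norm_le.2 (PiLp.norm_apply_le _ i)
    _ ≤ C * (∫⁻ z, ‖V (s, z)‖ₑ ^ (6 : ℝ)) ^ (1 / 6 : ℝ) :=
        hC (fun x => ‖V (s, x)‖ₑ) (by fun_prop) x
    _ ≤ C * ((N : ℝ≥0∞) ^ (6 : ℝ)) ^ (1 / 6 : ℝ) := by
        gcongr
        exact hV.lintegral_le s
    _ = _ := by
        rw [← ENNReal.rpow_mul]
        simp

lemma lintegral_faceMeasure_le (hV : BoundedField V N) {C : NNReal}
    (hC : ∀ u : E3 → ℝ≥0∞, Measurable u → ∀ x, ∫⁻ z, u (x - z) ∂mollifierMeasure m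
      ≤ C * (∫⁻ z, u z ^ (6 : ℝ)) ^ (1 / 6 : ℝ)) (hτ : 0 < τ) (n : ℕ) (i : Fin 3) (x : E3) :
    ∫⁻ q, ‖V (q.1, x + faceOffset h i q.2) i‖ₑ ∂(timeStep τ n).prod (faceMeasure m)
      ≤ (C * N : NNReal) := by
  have := isProbabilityMeasure_timeStep hτ n
  have hm := hV.measurable_apply i
  have ho := measurable_faceOffset h i
  have h1 : Measurable fun q : ℝ × ((Fin 2 → ℝ) × E3) => (q.1, x + faceOffset h i q.2) := by
    fun_prop
  have h2 (s : ℝ) : Measurable fun y : (Fin 2 → ℝ) × E3 => (s, x + faceOffset h i y) := by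
    fun_prop
  rw [lintegral_prod (fun q : ℝ × ((Fin 2 → ℝ) × E3) => ‖V (q.1, x + faceOffset h i q.2) i‖ₑ)
    (hm.comp h1).enorm.aemeasurable]
  calc _ ≤ ∫⁻ s, (C * N : NNReal) ∂timeStep τ n := by
        refine lintegral_mono fun s => ?_
        rw [faceMeasure, lintegral_prod (fun y => ‖V (s, x + faceOffset h i y) i‖ₑ)
          (hm.comp (h2 s)).enorm.aemeasurable]
        calc _ ≤ ∫⁻ y, (C * N : NNReal) ∂(volume.restrict (Icc (0 : Fin 2 → ℝ) 1)) := by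
              refine lintegral_mono fun y => ?_
              have := hV.lintegral_mollifier_le hC i s (x + h • unitFace i y)
              simpa only [faceOffset, add_sub_assoc] using this
          _ = _ := by rw [lintegral_const]; simp
    _ = _ := by rw [lintegral_const]; simp

lemma integrable_faceMeasure (hV : BoundedField V N) (hτ : 0 < τ) (n : ℕ) (i : Fin 3) (x : E3) :
    Integrable (fun q : ℝ × ((Fin 2 → ℝ) × E3) => V (q.1, x + faceOffset h i q.2) i)
      ((timeStep τ n).prod (faceMeasure m)) := by
  obtain ⟨C, hC⟩ := exists_lintegral_mollifierMeasure_le m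
  have hm := hV.measurable_apply i
  have ho := measurable_faceOffset h i
  have h1 : Measurable fun q : ℝ × ((Fin 2 → ℝ) × E3) => (q.1, x + faceOffset h i q.2) := by
    fun_prop
  refine ⟨(hm.comp h1).aestronglyMeasurable, ?_⟩
  exact (hV.lintegral_faceMeasure_le hC hτ n i x).trans_lt ENNReal.coe_lt_top

lemma abs_faceVelocity_le (hV : BoundedField V N) {C : NNReal}
    (hC : ∀ u : E3 → ℝ≥0∞, Measurable u → ∀ x, ∫⁻ z, u (x - z) ∂mollifierMeasure m
      ≤ C * (∫⁻ z, u z ^ (6 : ℝ)) ^ (1 / 6 : ℝ)) (hτ : 0 < τ) (n : ℕ) (i : Fin 3) (x : E3) :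
    |faceVelocity h τ m V n i x| ≤ C * N := by
  have h1 := (enorm_integral_le_lintegral_enorm _).trans
    (hV.lintegral_faceMeasure_le (h := h) hC hτ n i x)
  rw [← Real.norm_eq_abs]
  exact_mod_cast (enorm_le_coe.1 h1 : _ ≤ C * N)

/-- Averaging commutes with translations. Hence bounds on difference quotients of the field pass to
the edge velocities without loss. -/
lemma diffQuot_faceVelocity (hV : BoundedField V N) (hτ : 0 < τ) (n : ℕ) (i : Fin 3) (d : E3)
    (r : ℝ) (x : E3) :
    diffQuot d r (faceVelocity h τ m V n i) x
      = gridAverage (faceMeasure m) (faceOffset h i) τ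
        (fun p => diffQuot d r (fun y => V (p.1, y)) p.2 i) n x := by
  rw [diffQuot, faceVelocity, gridAverage, gridAverage, ← integral_sub
    (hV.integrable_faceMeasure hτ n i _) (hV.integrable_faceMeasure hτ n i _), gridAverage,
    ← integral_smul]
  congr 1; ext q
  simp only [diffQuot, PiLp.smul_apply, PiLp.sub_apply]
  rw [add_right_comm]

end BoundedField

namespace BoundedField

variable {V : ℝ × E3 → E3} {N : NNReal} {h τ : ℝ} {m : ℕ}

lemma locallyIntegrable_apply (hV : BoundedField V N) (i : Fin 3) (s : ℝ) :
    LocallyIntegrable fun y => V (s, y) i := by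
  have hm := hV.measurable_apply i
  have h1 : Measurable fun y : E3 => (s, y) := by fun_prop
  have : MemLp (fun y => V (s, y) i) 6 volume := by
    refine ⟨(hm.comp h1).aestronglyMeasurable, ?_⟩
    rw [eLpNorm_lt_top_iff_lintegral_rpow_enorm_lt_top (by norm_num) (by norm_num)]
    simp only [ENNReal.toReal_ofNat]
    refine lt_of_le_of_lt ?_ (ENNReal.rpow_lt_top_of_nonneg (by norm_num)
      (ENNReal.coe_ne_top (r := N)) : (N : ℝ≥0∞) ^ (6 : ℝ) < ∞)
    refine le_trans (lintegral_mono fun y => ?_) (hV.lintegral_le s)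
    gcongr
    exact enorm_le_iff_norm_le.2 (PiLp.norm_apply_le _ i)
  exact this.locallyIntegrable (by norm_num)

lemma mollifiedField_eq_convolution (m : ℕ) (V : ℝ × E3 → E3) (i : Fin 3) (s : ℝ) :
    (fun x => mollifiedField m V i (s, x))
      = convolution (fun y => V (s, y) i) (mollifier m) (ContinuousLinearMap.lsmul ℝ ℝ) volume := by
  ext x
  simp only [mollifiedField, convolution, ContinuousLinearMap.lsmul_apply, smul_eq_mul]
  rw [← integral_sub_left_eq_self (fun z => mollifier m z * V (s, x - z) i) volume x]
  simp only [sub_sub_cancel]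
  congr 1; ext z; ring

lemma contDiff_mollifiedField (hV : BoundedField V N) (i : Fin 3) (s : ℝ) :
    ContDiff ℝ 1 fun x => mollifiedField m V i (s, x) := by
  rw [mollifiedField_eq_convolution]
  exact (hasCompactSupport_mollifier m).contDiff_convolution_right (n := 1) _
    (hV.locallyIntegrable_apply i s) ((contDiff_mollifier m).of_le (mod_cast le_top))

lemma contDiff_one_mollifier (m : ℕ) : ContDiff ℝ 1 (mollifier m) :=
  (contDiff_mollifier m).of_le (mod_cast le_top)

lemma fderiv_mollifiedField (hV : BoundedField V N) (i : Fin 3) (s : ℝ) (x d : E3) :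
    fderiv ℝ (fun x => mollifiedField m V i (s, x)) x d
      = ∫ y, V (s, y) i * fderiv ℝ (mollifier m) (x - y) d := by
  rw [mollifiedField_eq_convolution, ((hasCompactSupport_mollifier m).hasFDerivAt_convolution_right
    _ (hV.locallyIntegrable_apply i s) (contDiff_one_mollifier m) x).fderiv,
    convolution_precompR_apply _ (hV.locallyIntegrable_apply i s)
      ((hasCompactSupport_mollifier m).fderiv ℝ)
      ((contDiff_one_mollifier m).continuous_fderiv (by norm_num))]
  rfl

/-- The derivative of the mollified field is the field tested against `y ↦ mollifier m (x - y)`, up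
to a sign, so the weak divergence condition becomes a pointwise one. -/
lemma sum_fderiv_mollifiedField (hV : BoundedField V N) (s : ℝ) (x : E3) :
    ∑ i, fderiv ℝ (fun x => mollifiedField m V i (s, x)) x (stdVec i) = 0 := by
  simp only [hV.fderiv_mollifiedField]
  have hd := hV.divFree s (fun y => mollifier m (x - y))
    ((contDiff_mollifier m).comp (contDiff_const.sub contDiff_id))
    (hasCompactSupport_comp_const_sub (hasCompactSupport_mollifier m) x)
  have e (y d : E3) : fderiv ℝ (fun y => mollifier m (x - y)) y d
      = - fderiv ℝ (mollifier m) (x - y) d := by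
    have h1 := ((contDiff_one_mollifier m).differentiable (by norm_num) (x - y)).hasFDerivAt
    have h2 : HasFDerivAt (fun y => mollifier m (x - y)) _ y :=
      h1.comp y ((hasFDerivAt_id y).const_sub x)
    rw [h2.fderiv]
    simp
  simp only [e, mul_neg, Finset.sum_neg_distrib] at hd
  rw [integral_neg, neg_eq_zero] at hd
  rw [← integral_finsetSum, hd]
  intro i _
  have h1 := (hV.locallyIntegrable_apply i s).integrable_smul_left_of_hasCompactSupport
    (g := fun y => fderiv ℝ (mollifier m) (x - y) (stdVec i))
    ((continuous_fderiv_apply (contDiff_one_mollifier m) _).comp (by fun_prop))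
    (hasCompactSupport_comp_const_sub ((hasCompactSupport_mollifier m).fderiv_apply ℝ _) x)
  refine h1.congr (Eventually.of_forall fun y => ?_)
  simp [mul_comm]

/-- The measure on the time and face parameters. -/
local notation "λ₂" => (volume.restrict (Icc (0 : Fin 2 → ℝ) 1))

lemma integrable_prodAssoc (hV : BoundedField V N) (hτ : 0 < τ) (n : ℕ) (i : Fin 3) (x : E3) :
    Integrable (fun q : (ℝ × (Fin 2 → ℝ)) × E3 => V (q.1.1, x + (h • unitFace i q.1.2 - q.2)) i)
      (((timeStep τ n).prod λ₂).prod (mollifierMeasure m)) := by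
  have := isProbabilityMeasure_timeStep hτ n
  exact (measurePreserving_prodAssoc (timeStep τ n) λ₂ (mollifierMeasure m)).integrable_comp_of_integrable
    (hV.integrable_faceMeasure (h := h) hτ n i x)

lemma integral_mollifierMeasure_apply (i : Fin 3) (x : E3) (s : ℝ) (y : Fin 2 → ℝ) :
    ∫ z, V (s, x + (h • unitFace i y - z)) i ∂mollifierMeasure m
      = mollifiedField m V i (s, x + h • unitFace i y) := by
  rw [integral_mollifierMeasure]
  simp only [mollifiedField, add_sub_assoc]

lemma integrable_mollifiedField (hV : BoundedField V N) (hτ : 0 < τ) (n : ℕ) (i : Fin 3) (x : E3) :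
    Integrable (fun q : ℝ × (Fin 2 → ℝ) => mollifiedField m V i (q.1, x + h • unitFace i q.2))
      ((timeStep τ n).prod λ₂) := by
  have := (hV.integrable_prodAssoc (h := h) (m := m) hτ n i x).integral_prod_left
  simpa only [integral_mollifierMeasure_apply] using this

/-- Fubini, integrating out the mollification variable: the edge velocity becomes a flux of a field
smooth in space, to which continuity arguments and the divergence theorem apply. -/
lemma faceVelocity_eq (hV : BoundedField V N) (hτ : 0 < τ) (n : ℕ) (i : Fin 3) (x : E3) :
    faceVelocity h τ m V n i x
      = ∫ q, mollifiedField m V i (q.1, x + h • unitFace i q.2) ∂(timeStep τ n).prod λ₂ := by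
  have := isProbabilityMeasure_timeStep hτ n
  have h1 := (measurePreserving_prodAssoc (timeStep τ n) λ₂ (mollifierMeasure m)).integral_comp
    MeasurableEquiv.prodAssoc.measurableEmbedding (fun q => V (q.1, x + faceOffset h i q.2) i)
  rw [faceVelocity, gridAverage, faceMeasure, ← h1]
  have h2 := integral_prod _ (hV.integrable_prodAssoc (h := h) (m := m) hτ n i x)
  simp only [integral_mollifierMeasure_apply] at h2
  exact h2

lemma abs_mollifiedField_le (hV : BoundedField V N) (m : ℕ) : ∃ C : ℝ, ∀ i p,
    |mollifiedField m V i p| ≤ C := by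
  obtain ⟨C, hC⟩ := exists_lintegral_mollifierMeasure_le m
  refine ⟨C * N, fun i p => ?_⟩
  have h1 := (enorm_integral_le_lintegral_enorm _).trans (hV.lintegral_mollifier_le hC i p.1 p.2)
  rw [integral_mollifierMeasure] at h1
  rw [← Real.norm_eq_abs]
  exact_mod_cast (enorm_le_coe.1 h1 : _ ≤ C * N)

lemma continuous_faceVelocity (hV : BoundedField V N) (hτ : 0 < τ) (n : ℕ) (i : Fin 3) :
    Continuous (faceVelocity h τ m V n i) := by
  have := isProbabilityMeasure_timeStep hτ n
  have e : faceVelocity h τ m V n i = fun x =>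
      ∫ q, mollifiedField m V i (q.1, x + h • unitFace i q.2) ∂(timeStep τ n).prod λ₂ := by
    ext x; exact hV.faceVelocity_eq hτ n i x
  obtain ⟨C, hC⟩ := hV.abs_mollifiedField_le m
  rw [e]
  refine continuous_of_dominated (bound := fun _ => C)
    (fun x => (hV.integrable_mollifiedField hτ n i x).aestronglyMeasurable)
    (fun x => Eventually.of_forall fun q => hC i _) (integrable_const _)
    (Eventually.of_forall fun q => ?_)
  exact (hV.contDiff_mollifiedField (m := m) i q.1).continuous.comp (by fun_prop)

lemma toLp_insertNth_zero (i : Fin 3) (y : Fin 2 → ℝ) :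
    (WithLp.toLp 2 (i.insertNth 0 y : Fin 3 → ℝ) : E3) = unitFace i y - stdVec i := by
  ext j
  change (i.insertNth 0 y : Fin 3 → ℝ) j = (i.insertNth 1 y : Fin 3 → ℝ) j - stdVec i j
  rcases eq_or_ne j i with rfl | hj
  · simp [stdVec]
  · obtain ⟨l, rfl⟩ := Fin.exists_succAbove_eq hj
    simp [stdVec]

/-- The divergence theorem on the cube with corner `x` and side `h`, pulled back to the unit cube by
`L`. The face opposite to the one with coordinate 1 is its translate by `-h e_i`, so the flux
through it is the edge flux at `x - h e_i`. -/
lemma sum_face_flux (hV : BoundedField V N) (s : ℝ) (x : E3) :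
    ∑ i, ((∫ y in Icc (0 : Fin 2 → ℝ) 1, mollifiedField m V i (s, x + h • unitFace i y))
      - ∫ y in Icc (0 : Fin 2 → ℝ) 1,
        mollifiedField m V i (s, (x - h • stdVec i) + h • unitFace i y)) = 0 := by
  set L : (Fin 3 → ℝ) →L[ℝ] E3 :=
    h • ((EuclideanSpace.equiv (Fin 3) ℝ).symm : (Fin 3 → ℝ) →L[ℝ] E3) with hL
  have hLa (w : Fin 3 → ℝ) : L w = h • WithLp.toLp 2 w := rfl
  have hd (i : Fin 3) (w : Fin 3 → ℝ) :
      HasFDerivAt (fun w => mollifiedField m V i (s, x + L w))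
        ((fderiv ℝ (fun x => mollifiedField m V i (s, x)) (x + L w)).comp L) w := by
    have h1 := ((hV.contDiff_mollifiedField (m := m) i s).differentiable (by norm_num)
      (x + L w)).hasFDerivAt
    exact h1.comp w (L.hasFDerivAt.const_add x)
  have hz (w : Fin 3 → ℝ) : ∑ i, ((fderiv ℝ (fun x => mollifiedField m V i (s, x))
      (x + L w)).comp L) (Pi.single i 1) = 0 := by
    have : ∀ i, L (Pi.single i 1) = h • stdVec i := fun i => by rw [hLa]; rfl
    simp only [ContinuousLinearMap.comp_apply, this, map_smul]
    rw [← Finset.smul_sum, hV.sum_fderiv_mollifiedField, smul_zero]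
  have key := integral_divergence_of_hasFDerivAt_off_countable' (0 : Fin 3 → ℝ) 1 zero_le_one
    (fun i w => mollifiedField m V i (s, x + L w)) _ ∅ countable_empty
    (fun i => fun w _ => (hd i w).continuousAt.continuousWithinAt) (fun w _ i => hd i w)
    (by simp only [hz]; exact integrableOn_zero)
  simp only [hz, integral_zero] at key
  rw [key]
  refine Finset.sum_congr rfl fun i _ => ?_
  congr 1
  refine integral_congr_ae (Eventually.of_forall fun y => ?_)
  simp only [hLa, Pi.zero_apply, toLp_insertNth_zero, smul_sub]
  congr 2
  abel

lemma discreteDivFree_faceVelocity (hV : BoundedField V N) (hτ : 0 < τ) (n : ℕ) :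
    DiscreteDivFree h (faceVelocity h τ m V n) := by
  have := isProbabilityMeasure_timeStep hτ n
  intro x
  have hi (i : Fin 3) (x : E3) := hV.integrable_mollifiedField (h := h) (m := m) hτ n i x
  have e (i : Fin 3) : faceVelocity h τ m V n i x - faceVelocity h τ m V n i (x - h • stdVec i)
      = ∫ s, ((∫ y in Icc (0 : Fin 2 → ℝ) 1, mollifiedField m V i (s, x + h • unitFace i y))
      - ∫ y in Icc (0 : Fin 2 → ℝ) 1,
        mollifiedField m V i (s, (x - h • stdVec i) + h • unitFace i y)) ∂timeStep τ n := by
    rw [integral_sub (hi i x).integral_prod_left (hi i (x - h • stdVec i)).integral_prod_left,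
      hV.faceVelocity_eq hτ, hV.faceVelocity_eq hτ, integral_prod _ (hi i x),
      integral_prod _ (hi i (x - h • stdVec i))]
  simp only [e]
  rw [← integral_finsetSum]
  · simp only [hV.sum_face_flux, integral_zero]
  · exact fun i _ => (hi i x).integral_prod_left.sub (hi i (x - h • stdVec i)).integral_prod_left

end BoundedField

/-! ### Truncation of `v` and construction of the approximating velocities -/

lemma lintegral_enorm_sq_le_of_eLpNorm_six {u : E3 → E3} (hu : AEStronglyMeasurable u volume)
    (K : Set E3) :
    ∫⁻ x in K, ‖u x‖ₑ ^ 2 ≤ eLpNorm u 6 volume ^ 2 * (volume K ^ (1 / 2 - 1 / 6 : ℝ)) ^ 2 := by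
  have h1 := eLpNorm_le_eLpNorm_mul_rpow_measure_univ (p := 2) (q := 6) (by norm_num)
    (hu.restrict (s := K))
  rw [← eLpNorm_two_sq, ← mul_pow]
  gcongr
  refine h1.trans ?_
  simp only [Measure.restrict_apply_univ, ENNReal.toReal_ofNat]
  gcongr
  exact Measure.restrict_le_self

lemma diffQuot_congr_ae {F : Type*} [NormedAddCommGroup F] [NormedSpace ℝ F] {u w : E3 → F}
    (h : u =ᵐ[volume] w) (d : E3) (r : ℝ) : diffQuot d r u =ᵐ[volume] diffQuot d r w := by
  have h2 := (measurePreserving_add_right (volume : Measure E3) (r • d)).quasiMeasurePreserving.ae_eq_comp h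
  filter_upwards [h, h2] with x hx hx2
  simp only [Function.comp_apply] at hx2
  simp only [diffQuot, hx, hx2]

/-- The truncation acts on time only: a slice is kept if its `L⁶` norm is at most `N` and replaced
by zero otherwise. It therefore preserves the divergence condition and the difference-quotient
bound, which a truncation of values would not. The Sobolev inequality makes almost every slice
admissible for large `N`. -/
lemma exists_truncations {v : ℝ → E3 → E3} {Dv : Fin 3 → ℝ → E3 → E3}
    (hv : MemL2HomSobolev v Dv) (hdiv : IsDivergenceFree v) :
    ∃ (v' : ℝ × E3 → E3) (V : ℕ → ℝ × E3 → E3), Measurable v' ∧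
      v' =ᵐ[halfSpaceTime] Function.uncurry v ∧
      (∀ K : Set E3, volume K ≠ ∞ →
        ∫⁻ p in univ ×ˢ K, ‖v' p‖ₑ ^ 2 ∂halfSpaceTime < ∞) ∧
      (∀ N, BoundedField (V N) N) ∧ (∀ N p, ‖V N p‖ ≤ ‖v' p‖) ∧
      (∀ᵐ p ∂halfSpaceTime, ∀ᶠ N in atTop, V N p = v' p) ∧
      ∀ N j r s, ∫⁻ x, ‖diffQuot (stdVec j) r (fun y => V N (s, y)) x‖ₑ ^ 2
        ≤ (Ioi (0 : ℝ)).indicator (fun s => ∫⁻ x, ‖Dv j s x‖ₑ ^ 2) s := by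
  obtain ⟨C, hC⟩ := exists_sobolev_const (F := E3)
  have hvm := hv.aestronglyMeasurable
  rw [← halfSpaceTime_eq_restrict] at hvm
  set v' := hvm.mk with hv'
  have hm : Measurable v' := hvm.stronglyMeasurable_mk.measurable
  have hvv' : v' =ᵐ[halfSpaceTime] Function.uncurry v := hvm.ae_eq_mk.symm
  have hsl : ∀ᵐ t ∂(volume.restrict (Ioi (0 : ℝ))), (fun x => v' (t, x)) =ᵐ[volume] v t :=
    Measure.ae_ae_of_ae_prod (by rw [halfSpaceTime] at hvv'; exact hvv')
  -- A measurable set of full measure of times at which everything known almost everywhere holds at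
  -- once.
  obtain ⟨G, hG, hGm, hGp⟩ := ((hsl.and hv.slice).and
    (hdiv.and (ae_restrict_mem measurableSet_Ioi))).exists_measurable_mem
  set I : ℝ → ℝ≥0∞ := fun s => ∫⁻ x, ‖v' (s, x)‖ₑ ^ (6 : ℝ) with hI
  have hIm : Measurable I := Measurable.lintegral_prod_right' (f := fun p => ‖v' p‖ₑ ^ (6 : ℝ))
    (by fun_prop)
  have hIe (s : ℝ) : I s = eLpNorm (fun x => v' (s, x)) 6 volume ^ (6 : ℝ) := by
    rw [eLpNorm_eq_lintegral_rpow_enorm_toReal (by norm_num) (by norm_num), ← ENNReal.rpow_mul]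
    simp [I]
  have h6 (s : ℝ) (hs : s ∈ G) :
      eLpNorm (fun x => v' (s, x)) 6 volume ≤ C * ∑ j, eLpNorm (Dv j s) 2 volume := by
    rw [eLpNorm_congr_ae (hGp s hs).1.1]
    exact hC (hGp s hs).1.2
  have h6' (s : ℝ) (hs : s ∈ G) : I s < ∞ := by
    rw [hIe]
    refine ENNReal.rpow_lt_top_of_nonneg (by norm_num) ((h6 s hs).trans_lt ?_).ne
    refine ENNReal.mul_lt_top (by simp) ?_
    exact ENNReal.sum_lt_top.2 fun j _ => ((hGp s hs).1.2.memLp j).eLpNorm_lt_top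
  set S : ℕ → Set ℝ := fun N => G ∩ {s | I s ≤ (N : ℝ≥0∞) ^ (6 : ℝ)} with hS
  have hSm (N : ℕ) : MeasurableSet (S N) := hGm.inter (hIm measurableSet_Iic)
  set V : ℕ → ℝ × E3 → E3 := fun N => (S N ×ˢ univ).indicator v' with hV
  have hVin {N : ℕ} {s : ℝ} (hs : s ∈ S N) (x : E3) : V N (s, x) = v' (s, x) :=
    indicator_of_mem (by simp [hs]) _
  have hVout {N : ℕ} {s : ℝ} (hs : s ∉ S N) (x : E3) : V N (s, x) = 0 :=
    indicator_of_notMem (by simp [hs]) _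
  have hGae : ∀ᵐ p ∂halfSpaceTime, p.1 ∈ G := by
    rw [halfSpaceTime]; exact Measure.quasiMeasurePreserving_fst.ae hG
  have hDm (j : Fin 3) : ∫⁻ s in Ioi (0 : ℝ), ∫⁻ x, ‖Dv j s x‖ₑ ^ 2 < ∞ := by
    have h1 := hv.memLp j
    rw [← halfSpaceTime_eq_restrict] at h1
    have h2 : ∫⁻ p, ‖Function.uncurry (Dv j) p‖ₑ ^ 2 ∂halfSpaceTime < ∞ := by
      rw [← eLpNorm_two_sq]; exact ENNReal.pow_lt_top h1.eLpNorm_lt_top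
    rw [halfSpaceTime, lintegral_prod] at h2
    · exact h2
    · have := h1.1.enorm.pow_const 2
      rwa [halfSpaceTime] at this
  refine ⟨v', V, hm, hvv', ?_, ?_, ?_, ?_, ?_⟩
  · intro K hK
    have e : halfSpaceTime.restrict (univ ×ˢ K)
        = (volume.restrict (Ioi (0 : ℝ))).prod (volume.restrict K) := by
      rw [halfSpaceTime, ← Measure.prod_restrict, Measure.restrict_univ]
    rw [e, lintegral_prod _ (by fun_prop)]
    set c : ℝ≥0∞ := (volume K ^ (1 / 2 - 1 / 6 : ℝ)) ^ 2
    have hc : c ≠ ∞ := ENNReal.pow_ne_top (ENNReal.rpow_ne_top_of_nonneg (by norm_num) hK)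
    calc ∫⁻ s in Ioi (0 : ℝ), ∫⁻ x in K, ‖v' (s, x)‖ₑ ^ 2
        ≤ ∫⁻ s in Ioi (0 : ℝ), c * (C ^ 2 * (3 * ∑ j, ∫⁻ x, ‖Dv j s x‖ₑ ^ 2)) := by
          refine lintegral_mono_ae ?_
          filter_upwards [hG] with s hs
          refine (lintegral_enorm_sq_le_of_eLpNorm_six
            (hm.comp measurable_prodMk_left).aestronglyMeasurable K).trans ?_
          rw [mul_comm]
          gcongr
          refine (pow_le_pow_left' (h6 s hs) 2).trans ?_
          rw [mul_pow]
          gcongr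
          simp only [← eLpNorm_two_sq]
          -- Cauchy–Schwarz over the three directions, the source of the factor 3.
          have := ENNReal.inner_le_Lp_mul_Lq (Finset.univ : Finset (Fin 3)) (fun _ => 1)
            (fun j => eLpNorm (Dv j s) 2 volume) (p := 2) (q := 2)
            (Real.HolderConjugate.two_two)
          have h3 := pow_le_pow_left' this 2
          rw [mul_pow, ← ENNReal.rpow_natCast, ← ENNReal.rpow_natCast (_ ^ (1 / (2 : ℝ))),
            ← ENNReal.rpow_natCast ((∑ i : Fin 3, _) ^ (1 / (2 : ℝ))),
            ← ENNReal.rpow_mul, ← ENNReal.rpow_mul] at h3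
          simpa using h3
      _ < ∞ := by
          rw [lintegral_const_mul' _ _ hc, lintegral_const_mul' _ _ (by simp),
            lintegral_const_mul' _ _ (by simp)]
          refine ENNReal.mul_lt_top hc.lt_top (ENNReal.mul_lt_top (by simp)
            (ENNReal.mul_lt_top (by simp) ?_))
          rw [lintegral_finsetSum']
          · exact ENNReal.sum_lt_top.2 fun j _ => hDm j
          · intro j _
            have h1 := (hv.memLp j).1
            rw [← halfSpaceTime_eq_restrict, halfSpaceTime] at h1
            exact (h1.enorm.pow_const 2).lintegral_prod_right'
  · intro N
    refine ⟨hm.indicator ((hSm N).prod MeasurableSet.univ), fun s => ?_, fun s ψ hψ hψc => ?_⟩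
    · by_cases hs : s ∈ S N
      · simp only [hVin hs]
        exact hs.2
      · simp [hVout hs]
    · by_cases hs : s ∈ S N
      · simp only [hVin hs]
        have h1 := (hGp s hs.1).2.1 ⟨ψ, hψ, hψc, by simp⟩
        rw [← h1]
        refine integral_congr_ae ?_
        filter_upwards [(hGp s hs.1).1.1] with x hx
        rw [hx]
        rfl
      · simp [hVout hs]
  · intro N p
    exact norm_indicator_le_norm_self _ _
  · filter_upwards [hGae] with p hp
    obtain ⟨N₀, hN₀⟩ := ENNReal.exists_nat_gt (h6' p.1 hp).ne
    -- `N ≥ 1` is needed for `N ≤ N⁶`.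
    filter_upwards [eventually_ge_atTop (max N₀ 1)] with N hN
    refine hVin ⟨hp, ?_⟩ p.2
    have h1 : (1 : ℝ≥0∞) ≤ N := by exact_mod_cast (le_max_right _ _).trans hN
    calc I p.1 ≤ N₀ := hN₀.le
      _ ≤ N := by exact_mod_cast (le_max_left _ _).trans hN
      _ = (N : ℝ≥0∞) ^ (1 : ℝ) := (ENNReal.rpow_one _).symm
      _ ≤ _ := ENNReal.rpow_le_rpow_of_exponent_le h1 (by norm_num)
  · intro N j r s
    by_cases hs : s ∈ S N
    · simp only [hVin hs]
      rw [indicator_of_mem (show s ∈ Ioi (0 : ℝ) from (hGp s hs.1).2.2), ← eLpNorm_two_sq,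
        ← eLpNorm_two_sq, eLpNorm_congr_ae (diffQuot_congr_ae (hGp s hs.1).1.1 _ _)]
      exact pow_le_pow_left' ((hGp s hs.1).1.2.eLpNorm_diffQuot_le j r) 2
    · simp [hVout hs, diffQuot]

/-- Stable edge velocities on finer and finer grids, which approximate `v` and satisfy the same
bounds on derivatives as `v`. -/
structure ApproximatingVelocity (v : ℝ × E3 → E3) (B : Fin 3 → ℝ) (h τ : ℕ → ℝ)
    (a : ℕ → ℕ → Fin 3 → E3 → ℝ) : Prop where
  stable : ∀ k, StableVelocity (h k) (τ k) (a k)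
  h_le_one : ∀ k, h k ≤ 1
  tendsto_h : Tendsto h atTop (𝓝 0)
  tendsto_ratio : Tendsto (fun k => τ k / h k ^ 2) atTop (𝓝 0)
  integrable_sq : ∀ k n i j, Integrable fun x => diffQuot (stdVec j) (h k) (a k n i) x ^ 2
  sum_le : ∀ k N j, ∑ n ∈ Finset.range N,
    τ k * ∑ i, ∫ x, diffQuot (stdVec j) (h k) (a k n i) x ^ 2 ≤ B j
  tendsto : ∀ i T R, Tendsto (fun k => ∫⁻ p in univ ×ˢ Metric.closedBall (0 : E3) R,
    ‖a k ⌊p.1 / τ k⌋₊ i p.2 - v p i‖ₑ ^ 2 ∂slab T) atTop (𝓝 0)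

lemma gridAverage_congr_closedBall {Y : Type*} [MeasurableSpace Y] {P : Measure Y}
    [IsProbabilityMeasure P] {o : Y → E3} {τ c R : ℝ} (hτ : 0 < τ) (ho : ∀ᵐ y ∂P, ‖o y‖ ≤ c)
    (f : ℝ × E3 → ℝ) (n : ℕ) {x : E3} (hx : x ∈ Metric.closedBall (0 : E3) R) :
    gridAverage P o τ f n x
      = gridAverage P o τ ((univ ×ˢ Metric.closedBall (0 : E3) (R + c)).indicator f) n x := by
  have := isProbabilityMeasure_timeStep hτ n
  have h1 : ∀ᵐ q ∂(timeStep τ n).prod P, ‖o q.2‖ ≤ c :=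
    Measure.quasiMeasurePreserving_snd.ae ho
  refine integral_congr_ae ?_
  filter_upwards [h1] with q hq
  rw [indicator_of_mem]
  rw [mem_closedBall_zero_iff] at hx
  refine ⟨mem_univ _, ?_⟩
  simp only [mem_closedBall_zero_iff]
  exact (norm_add_le _ _).trans (add_le_add hx hq)

lemma enorm_sq_apply_sum (w : E3) : ∑ i, ‖w i‖ₑ ^ 2 = ‖w‖ₑ ^ 2 := by
  rw [← ofReal_norm (x := w), ← ENNReal.ofReal_pow (norm_nonneg _), EuclideanSpace.norm_sq_eq,
    ENNReal.ofReal_sum_of_nonneg (fun i _ => sq_nonneg _)]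
  simp only [enorm_sq_eq_ofReal, Real.norm_eq_abs, sq_abs]

/-- One index `k` drives mollification and truncation, and `h k` is then taken small enough for the
resulting edge velocities to be stable. No rate of convergence is required, so this diagonal choice
is harmless. -/
lemma exists_approximatingVelocity {v : ℝ → E3 → E3} {Dv : Fin 3 → ℝ → E3 → E3}
    (hv : MemL2HomSobolev v Dv) (hdiv : IsDivergenceFree v) :
    ∃ (v' : ℝ × E3 → E3) (h τ : ℕ → ℝ) (a : ℕ → ℕ → Fin 3 → E3 → ℝ), Measurable v' ∧
      v' =ᵐ[halfSpaceTime] Function.uncurry v ∧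
      (∀ K : Set E3, volume K ≠ ∞ →
        ∫⁻ p in univ ×ˢ K, ‖v' p‖ₑ ^ 2 ∂halfSpaceTime < ∞) ∧
      ApproximatingVelocity v'
        (fun j => (∫⁻ p, ‖Function.uncurry (Dv j) p‖ₑ ^ 2 ∂halfSpaceTime).toReal) h τ a := by
  obtain ⟨v', V, hm, hvv', hK, hV, hVle, hVlim, hVD⟩ := exists_truncations hv hdiv
  refine ⟨v', ?_⟩
  choose C hC using exists_lintegral_mollifierMeasure_le
  -- The edge velocities are at most `C k * k`, and this choice makes `1 / h k` larger; it also
  -- gives `h k ≤ 1 / (k + 1)`.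
  set h : ℕ → ℝ := fun k => 1 / (k + 1 + C k * k) with hh
  have hpos (k : ℕ) : 0 < h k := by positivity
  have hle (k : ℕ) : h k ≤ 1 / ((k : ℝ) + 1) := by
    have : (0 : ℝ) ≤ C k * k := by positivity
    exact one_div_le_one_div_of_le (by positivity) (by linarith)
  have hle1 (k : ℕ) : h k ≤ 1 := (hle k).trans (by
    rw [div_le_one (by positivity)]; linarith [(Nat.cast_nonneg k : (0 : ℝ) ≤ k)])
  have ht : Tendsto h atTop (𝓝 0) :=
    squeeze_zero (fun k => (hpos k).le) hle tendsto_one_div_add_atTop_nhds_zero_nat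
  -- The cube of `h` gives the CFL condition, because `h ≤ 1`, and also `τ / h² = h / 108 → 0`.
  set τ : ℕ → ℝ := fun k => h k ^ 3 / 108 with hτd
  have hτ (k : ℕ) : 0 < τ k := by have := hpos k; positivity
  have hτt : Tendsto τ atTop (𝓝 0) := by
    have := (ht.pow 3).div_const 108
    simpa using this
  set a : ℕ → ℕ → Fin 3 → E3 → ℝ := fun k => faceVelocity (h k) (τ k) k (V k) with ha
  have hDm (j : Fin 3) : AEStronglyMeasurable (Function.uncurry (Dv j)) halfSpaceTime ∧
      ∫⁻ p, ‖Function.uncurry (Dv j) p‖ₑ ^ 2 ∂halfSpaceTime < ∞ := by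
    have h1 := hv.memLp j
    rw [← halfSpaceTime_eq_restrict] at h1
    refine ⟨h1.1, ?_⟩
    rw [← eLpNorm_two_sq]; exact ENNReal.pow_lt_top h1.eLpNorm_lt_top
  have hDe (j : Fin 3) : ∫⁻ p, ‖Function.uncurry (Dv j) p‖ₑ ^ 2 ∂halfSpaceTime
      = ∫⁻ s in Ioi (0 : ℝ), ∫⁻ x, ‖Dv j s x‖ₑ ^ 2 := by
    have := (hDm j).1.enorm.pow_const 2
    rw [halfSpaceTime] at this ⊢
    rw [lintegral_prod _ this]
    rfl
  have hfm (k : ℕ) (j i : Fin 3) :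
      Measurable fun p : ℝ × E3 => diffQuot (stdVec j) (h k) (fun y => V k (p.1, y)) p.2 i := by
    have h1 := (hV k).measurable_apply i
    have h2 : Measurable fun p : ℝ × E3 => (p.1, p.2 + h k • stdVec j) := by fun_prop
    have := (((h1.comp h2).sub h1).const_mul (h k)⁻¹)
    simpa [diffQuot] using this
  -- Jensen's inequality is applied to each component; summing over components before using the
  -- slice bound recovers the Euclidean norm, so the constant stays one.
  have hstep (k n : ℕ) (j : Fin 3) :
      ∑ i, ∫⁻ x, ‖diffQuot (stdVec j) (h k) (a k n i) x‖ₑ ^ 2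
        ≤ ENNReal.ofReal (τ k)⁻¹ * ∫⁻ s in Ico (n * τ k) ((n + 1) * τ k),
          (Ioi (0 : ℝ)).indicator (fun s => ∫⁻ x, ‖Dv j s x‖ₑ ^ 2) s := by
    have e (i : Fin 3) : diffQuot (stdVec j) (h k) (a k n i) = gridAverage (faceMeasure k)
        (faceOffset (h k) i) (τ k)
        (fun p => diffQuot (stdVec j) (h k) (fun y => V k (p.1, y)) p.2 i) n := by
      ext x; exact (hV k).diffQuot_faceVelocity (hτ k) n i _ _ x
    simp only [e]
    calc _ ≤ ∑ i, ENNReal.ofReal (τ k)⁻¹ * ∫⁻ s in Ico (n * τ k) ((n + 1) * τ k),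
          ∫⁻ x, ‖diffQuot (stdVec j) (h k) (fun y => V k (s, y)) x i‖ₑ ^ 2 :=
          Finset.sum_le_sum fun i _ => lintegral_gridAverage_sq_le (hτ k)
            (measurable_faceOffset _ _) (hfm k j i) n
      _ = ENNReal.ofReal (τ k)⁻¹ * ∫⁻ s in Ico (n * τ k) ((n + 1) * τ k),
          ∑ i, ∫⁻ x, ‖diffQuot (stdVec j) (h k) (fun y => V k (s, y)) x i‖ₑ ^ 2 := by
          rw [lintegral_finsetSum, Finset.mul_sum]
          intro i _
          exact ((hfm k j i).enorm.pow_const 2).lintegral_prod_right'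
      _ ≤ _ := by
          gcongr with s
          rw [← lintegral_finsetSum]
          · simp only [enorm_sq_apply_sum]
            exact hVD k j (h k) s
          · intro i _
            exact ((hfm k j i).comp measurable_prodMk_left).enorm.pow_const 2
  have hsum (k : ℕ) (j : Fin 3) :
      ∑' n, ENNReal.ofReal (τ k) * ∑ i, ∫⁻ x, ‖diffQuot (stdVec j) (h k) (a k n i) x‖ₑ ^ 2
        ≤ ∫⁻ p, ‖Function.uncurry (Dv j) p‖ₑ ^ 2 ∂halfSpaceTime := by
    calc _ ≤ ∑' n : ℕ, ∫⁻ s in Ico (n * τ k) ((n + 1) * τ k),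
          (Ioi (0 : ℝ)).indicator (fun s => ∫⁻ x, ‖Dv j s x‖ₑ ^ 2) s := by
          refine ENNReal.tsum_le_tsum fun n => ?_
          refine (mul_le_mul' le_rfl (hstep k n j)).trans (le_of_eq ?_)
          rw [← mul_assoc, ← ENNReal.ofReal_mul (hτ k).le, mul_inv_cancel₀ (hτ k).ne',
            ENNReal.ofReal_one, one_mul]
      _ = _ := by
          rw [← lintegral_Ioi_eq_tsum (hτ k), hDe]
          exact setLIntegral_congr_fun measurableSet_Ioi fun s hs => indicator_of_mem hs _
  have hac (k n : ℕ) (i : Fin 3) : Continuous (a k n i) :=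
    (hV k).continuous_faceVelocity (hτ k) n i
  have hdc (k n : ℕ) (i j : Fin 3) : Continuous (diffQuot (stdVec j) (h k) (a k n i)) :=
    continuous_diffQuot _ _ (hac k n i)
  have hfin (k n : ℕ) (i j : Fin 3) :
      ∫⁻ x, ‖diffQuot (stdVec j) (h k) (a k n i) x‖ₑ ^ 2 < ∞ := by
    have h1 := (ENNReal.le_tsum n).trans_lt ((hsum k j).trans_lt (hDm j).2)
    have h2 : ∑ i, ∫⁻ x, ‖diffQuot (stdVec j) (h k) (a k n i) x‖ₑ ^ 2 < ∞ :=
      ENNReal.lt_top_of_mul_ne_top_right h1.ne (by simpa using hτ k)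
    exact ENNReal.sum_lt_top.1 h2 i (Finset.mem_univ i)
  have hL2 (k n : ℕ) (i j : Fin 3) : MemLp (diffQuot (stdVec j) (h k) (a k n i)) 2 volume :=
    memLp_two_of_lintegral_le (hdc k n i j).aestronglyMeasurable
      (C := (∫⁻ x, ‖diffQuot (stdVec j) (h k) (a k n i) x‖ₑ ^ 2).toReal)
      (by rw [ENNReal.ofReal_toReal (hfin k n i j).ne])
  refine ⟨h, τ, a, hm, hvv', hK, ⟨fun k => ⟨hpos k, hτ k, ?_, hac k, ?_, ?_⟩, hle1, ht, ?_, ?_, ?_, ?_⟩⟩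
  · have := hpos k
    have h2 : h k ^ 3 ≤ h k ^ 2 := pow_le_pow_of_le_one this.le (hle1 k) (by norm_num)
    simp only [hτd]
    linarith
  · intro n i x
    refine ((hV k).abs_faceVelocity_le (hC k) (hτ k) n i x).trans ?_
    simp only [hh, one_div, inv_inv, NNReal.coe_natCast]
    have : (0 : ℝ) ≤ k := Nat.cast_nonneg k
    linarith
  · exact fun n => (hV k).discreteDivFree_faceVelocity (hτ k) n
  · have e : ∀ k, τ k / h k ^ 2 = h k / 108 := by
      intro k
      have := (hpos k).ne'
      simp only [hτd]
      field_simp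
    simp only [e]
    simpa using ht.div_const 108
  · exact fun k n i j => (hL2 k n i j).integrable_sq
  · intro k N j
    have h1 := (ENNReal.sum_le_tsum (Finset.range N)).trans (hsum k j)
    rw [← ENNReal.ofReal_le_iff_le_toReal (hDm j).2.ne]
    refine le_trans (le_of_eq ?_) h1
    rw [ENNReal.ofReal_sum_of_nonneg]
    · refine Finset.sum_congr rfl fun n _ => ?_
      rw [ENNReal.ofReal_mul (hτ k).le, ENNReal.ofReal_sum_of_nonneg
        (fun i _ => integral_nonneg fun x => sq_nonneg _)]
      simp only [← lintegral_enorm_sq_eq_ofReal_integral (hL2 k n _ j)]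
    · exact fun n _ => mul_nonneg (hτ k).le
        (Finset.sum_nonneg fun i _ => integral_nonneg fun x => sq_nonneg _)
  · intro i T R
    set r : ℕ → ℝ := fun k => 2 * h k + 2 / (k + 1 : ℝ) with hr
    have hr4 (k : ℕ) : r k ≤ 4 := by
      have : 2 / ((k : ℝ) + 1) ≤ 2 := by
        rw [div_le_iff₀ (by positivity)]; linarith [(Nat.cast_nonneg k : (0 : ℝ) ≤ k)]
      linarith [hle1 k]
    have hr0 : Tendsto r atTop (𝓝 0) := by
      have h1 := (ht.const_mul 2).add
        ((tendsto_one_div_add_atTop_nhds_zero_nat (𝕜 := ℝ)).const_mul 2)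
      simp only [mul_zero, add_zero] at h1
      refine h1.congr fun k => ?_
      simp only [hr]; ring
    -- Offsets are bounded by 4, so averages at points of the ball of radius `R` see the field only
    -- in the ball of radius `R + 4`. The cut-off field is globally square integrable, whereas the
    -- field itself need be so only locally in space.
    set D : Set (ℝ × E3) := univ ×ˢ Metric.closedBall (0 : E3) (R + 4) with hD
    have hDms : MeasurableSet D := MeasurableSet.univ.prod measurableSet_closedBall
    have hvi : Measurable fun p => v' p i :=
      (EuclideanSpace.proj i : E3 →L[ℝ] ℝ).continuous.measurable.comp hm
    have hFb : ∫⁻ p, ‖D.indicator (fun p => v' p i) p‖ₑ ^ 2 ∂halfSpaceTime < ∞ := by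
      have e (p : ℝ × E3) : ‖D.indicator (fun p => v' p i) p‖ₑ ^ 2
          = D.indicator (fun p => ‖v' p i‖ₑ ^ 2) p := by
        by_cases hp : p ∈ D <;> simp [hp]
      simp only [e]
      rw [lintegral_indicator hDms]
      refine lt_of_le_of_lt (lintegral_mono fun p => ?_)
        (hK (Metric.closedBall 0 (R + 4)) measure_closedBall_lt_top.ne)
      gcongr
      exact enorm_le_iff_norm_le.2 (PiLp.norm_apply_le _ i)
    have hF2 : MemLp (D.indicator fun p => v' p i) 2 halfSpaceTime :=
      memLp_two_of_lintegral_le (hvi.indicator hDms).aestronglyMeasurable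
        (C := (∫⁻ p, ‖D.indicator (fun p => v' p i) p‖ₑ ^ 2 ∂halfSpaceTime).toReal)
        (by rw [ENNReal.ofReal_toReal hFb.ne])
    have hfle (k : ℕ) (p : ℝ × E3) : ‖D.indicator (fun p => V k p i) p‖ₑ
        ≤ ‖D.indicator (fun p => ‖v' p‖) p‖ₑ := by
      by_cases hp : p ∈ D
      · simp only [hp, indicator_of_mem]
        rw [enorm_le_iff_norm_le, norm_norm]
        exact (PiLp.norm_apply_le _ i).trans (hVle k p)
      · simp [hp]
    have hGb : ∫⁻ p, ‖D.indicator (fun p => ‖v' p‖) p‖ₑ ^ 2 ∂halfSpaceTime < ∞ := by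
      have e (p : ℝ × E3) : ‖D.indicator (fun p => ‖v' p‖) p‖ₑ ^ 2
          = D.indicator (fun p => ‖v' p‖ₑ ^ 2) p := by
        by_cases hp : p ∈ D <;> simp [hp]
      simp only [e]
      rw [lintegral_indicator hDms]
      exact hK (Metric.closedBall 0 (R + 4)) measure_closedBall_lt_top.ne
    have hGm : Measurable (D.indicator fun p => ‖v' p‖) := (by fun_prop : Measurable fun p => ‖v' p‖).indicator hDms
    have hfm' (k : ℕ) : Measurable (D.indicator fun p => V k p i) :=
      ((hV k).measurable_apply i).indicator hDms
    have hf2 (k : ℕ) : MemLp (D.indicator fun p => V k p i) 2 halfSpaceTime := by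
      refine memLp_two_of_lintegral_le (hfm' k).aestronglyMeasurable
        (C := (∫⁻ p, ‖D.indicator (fun p => ‖v' p‖) p‖ₑ ^ 2 ∂halfSpaceTime).toReal) ?_
      rw [ENNReal.ofReal_toReal hGb.ne]
      exact lintegral_mono fun p => pow_le_pow_left' (hfle k p) 2
    have hlim : Tendsto (fun k => ∫⁻ p, ‖D.indicator (fun p => V k p i) p
        - D.indicator (fun p => v' p i) p‖ₑ ^ 2 ∂halfSpaceTime) atTop (𝓝 0) := by
      have h1 := tendsto_lintegral_of_dominated_convergence' (μ := halfSpaceTime)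
        (F := fun k p => ‖D.indicator (fun p => V k p i) p - D.indicator (fun p => v' p i) p‖ₑ ^ 2)
        (f := fun _ => 0) (fun p => (2 * ‖D.indicator (fun p => ‖v' p‖) p‖ₑ) ^ 2)
        (fun k => (((hfm' k).sub (hvi.indicator hDms)).enorm.pow_const 2).aemeasurable)
        (fun k => Eventually.of_forall fun p => ?_) ?_ ?_
      · simpa using h1
      · dsimp only
        gcongr
        refine enorm_sub_le.trans ?_
        rw [two_mul]
        refine add_le_add (hfle k p) ?_
        by_cases hp : p ∈ D
        · simp only [hp, indicator_of_mem]
          rw [enorm_le_iff_norm_le, norm_norm]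
          exact PiLp.norm_apply_le _ i
        · simp [hp]
      · simp only [mul_pow]
        rw [lintegral_const_mul' _ _ (by finiteness)]
        exact (ENNReal.mul_lt_top (by finiteness) hGb).ne
      · filter_upwards [hVlim] with p hp
        refine tendsto_const_nhds.congr' ?_
        filter_upwards [hp] with k hk
        by_cases hpD : p ∈ D <;> simp [hpD, hk]
    have key := tendsto_gridAverage (P := faceMeasure) (fun k => inferInstance)
      (o := fun k => faceOffset (h k) i) (fun k => measurable_faceOffset _ _) (r := r)
      (fun k => ae_norm_faceOffset_le (hpos k).le k i) hr0 hτ hτt (hvi.indicator hDms) hF2 hfm' hf2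
      hlim (T := T) (K := Metric.closedBall 0 R) measure_closedBall_lt_top.ne
    refine key.congr fun k => ?_
    refine setLIntegral_congr_fun (MeasurableSet.univ.prod measurableSet_closedBall) fun p hp => ?_
    simp only
    have h4 : ∀ᵐ y ∂faceMeasure k, ‖faceOffset (h k) i y‖ ≤ 4 := by
      filter_upwards [ae_norm_faceOffset_le (hpos k).le k i] with y hy
      exact hy.trans (hr4 k)
    rw [← gridAverage_congr_closedBall (hτ k) h4 (fun p => V k p i) _ hp.2,
      indicator_of_mem (show p ∈ D from ⟨mem_univ _,
        Metric.closedBall_subset_closedBall (by linarith) hp.2⟩)]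
    rfl

/-! ### Convergence of difference quotients of test functions -/

section TestQuotients

variable {V : Type*} [NormedAddCommGroup V] {Ψ : V → ℝ} {R : ℝ}

lemma eq_zero_of_tsupport_subset (hR : tsupport Ψ ⊆ Metric.closedBall 0 R) {x : V} (hx : R < ‖x‖) :
    Ψ x = 0 := by
  refine image_eq_zero_of_notMem_tsupport fun h => ?_
  have := hR h
  rw [mem_closedBall_zero_iff] at this
  linarith

lemma HasCompactSupport.exists_tsupport_subset (hc : HasCompactSupport Ψ) :
    ∃ R, tsupport Ψ ⊆ Metric.closedBall 0 R :=
  hc.isBounded.subset_closedBall 0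

lemma HasCompactSupport.exists_abs_le (hc : HasCompactSupport Ψ) (hΨ : Continuous Ψ) :
    ∃ C, ∀ x, |Ψ x| ≤ C :=
  hΨ.bounded_above_of_compact_support hc

variable [NormedSpace ℝ V]

lemma tsupport_fderiv_apply_subset_closedBall (hR : tsupport Ψ ⊆ Metric.closedBall 0 R) (d : V) :
    tsupport (fun x => fderiv ℝ Ψ x d) ⊆ Metric.closedBall 0 R :=
  (tsupport_fderiv_apply_subset ℝ d).trans hR

variable [MeasurableSpace V] [BorelSpace V] [SecondCountableTopologyEither V ℝ] {μ : Measure V} {d : V}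
  {r : ℕ → ℝ}

lemma BoundedTendsto.shift (hΨ : Continuous Ψ) (hc : HasCompactSupport Ψ)
    (hR : tsupport Ψ ⊆ Metric.closedBall 0 R) (hd : ‖d‖ ≤ 1) (hr : Tendsto r atTop (𝓝 0))
    (hr1 : ∀ k, |r k| ≤ 1) :
    BoundedTendsto μ (Metric.closedBall 0 (R + 2)) (fun k x => Ψ (x + r k • d)) Ψ := by
  refine .of_eval hΨ (fun x => eq_zero_of_tsupport_subset hR) (hc.exists_abs_le hΨ)
    (fun k => by fun_prop) (ρ := fun k => |r k|) (by simpa using hr.abs)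
    (fun k => (hr1 k).trans (by norm_num)) fun k x => ⟨_, ?_, rfl⟩
  rw [dist_eq_norm, add_sub_cancel_left, norm_smul, Real.norm_eq_abs]
  exact mul_le_of_le_one_right (abs_nonneg _) hd

lemma BoundedTendsto.diffQuot (hΨ : ContDiff ℝ 1 Ψ) (hc : HasCompactSupport Ψ)
    (hR : tsupport Ψ ⊆ Metric.closedBall 0 R) (hd : ‖d‖ ≤ 1) (hr : Tendsto r atTop (𝓝 0))
    (hr0 : ∀ k, r k ≠ 0) (hr1 : ∀ k, |r k| ≤ 1) :
    BoundedTendsto μ (Metric.closedBall 0 (R + 2)) (fun k => diffQuot d (r k) Ψ)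
      (fun x => fderiv ℝ Ψ x d) := by
  refine .of_eval (continuous_fderiv_apply hΨ d)
    (fun x => eq_zero_of_tsupport_subset (tsupport_fderiv_apply_subset_closedBall hR d))
    ((hc.fderiv_apply ℝ d).exists_abs_le (continuous_fderiv_apply hΨ d))
    (fun k => (contDiff_diffQuot hΨ d (r k)).continuous) (ρ := fun k => |r k|) (by simpa using hr.abs)
    (fun k => (hr1 k).trans (by norm_num)) fun k x => ?_
  obtain ⟨ξ, h1, h2⟩ := exists_diffQuot_eq_fderiv hΨ d (hr0 k) x
  exact ⟨ξ, h1.trans (mul_le_of_le_one_right (abs_nonneg _) hd), h2⟩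

lemma BoundedTendsto.diffQuot_diffQuot (hΨ : ContDiff ℝ 2 Ψ) (hc : HasCompactSupport Ψ)
    (hR : tsupport Ψ ⊆ Metric.closedBall 0 R) (hd : ‖d‖ ≤ 1) (hr : Tendsto r atTop (𝓝 0))
    (hr0 : ∀ k, r k ≠ 0) (hr1 : ∀ k, |r k| ≤ 1) :
    BoundedTendsto μ (Metric.closedBall 0 (R + 2))
      (fun k => _root_.diffQuot d (- r k) (_root_.diffQuot d (r k) Ψ))
      (fun x => fderiv ℝ (fun y => fderiv ℝ Ψ y d) x d) := by
  refine .of_eval (continuous_fderiv_fderiv_apply hΨ d d)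
    (fun x => eq_zero_of_tsupport_subset
      (tsupport_fderiv_apply_subset_closedBall (tsupport_fderiv_apply_subset_closedBall hR d) d))
    (((hc.fderiv_apply ℝ d).fderiv_apply ℝ d).exists_abs_le (continuous_fderiv_fderiv_apply hΨ d d))
    (fun k => (contDiff_diffQuot (contDiff_diffQuot hΨ d (r k)) d _).continuous)
    (ρ := fun k => 2 * |r k|) (by simpa using hr.abs.const_mul 2)
    (fun k => by linarith [hr1 k]) fun k x => ?_
  obtain ⟨ξ, h1, h2⟩ := exists_diffQuot_diffQuot_eq_fderiv hΨ d d (hr0 k) (neg_ne_zero.2 (hr0 k)) x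
  refine ⟨ξ, h1.trans ?_, h2⟩
  rw [abs_neg, two_mul]
  have := mul_le_of_le_one_right (abs_nonneg (r k)) hd
  exact add_le_add this this

end TestQuotients

lemma norm_stdVec (i : Fin 3) : ‖stdVec i‖ = 1 := by simp [stdVec]

lemma norm_spaceDir (i : Fin 3) : ‖spaceDir i‖ = 1 := by simp [spaceDir, Prod.norm_def, norm_stdVec]

lemma norm_timeDir : ‖timeDir‖ = 1 := by simp [timeDir, Prod.norm_def]

lemma discreteLaplacian_eq_sum {h : ℝ} (f : E3 → ℝ) (x : E3) :
    discreteLaplacian h f x = ∑ i, diffQuot (stdVec i) (-h) (diffQuot (stdVec i) h f) x := by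
  simp only [discreteLaplacian, diffQuot]
  refine Finset.sum_congr rfl fun i _ => ?_
  simp only [neg_smul, ← sub_eq_add_neg, sub_add_cancel, smul_eq_mul, inv_neg]
  ring

/-! ### Functions piecewise constant in time and the summed weak form -/

section StepSums

variable {τ : ℝ}

lemma integrable_comp_floor (hτ : 0 < τ) {u : ℕ → E3 → ℝ} (hu : ∀ n, Continuous (u n))
    (huc : ∀ n, HasCompactSupport (u n)) (T : ℝ) :
    Integrable (fun p : ℝ × E3 => u ⌊p.1 / τ⌋₊ p.2) (slab T) := by
  have hm := measurable_comp_floor τ fun n => (hu n).measurable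
  refine ⟨hm.aestronglyMeasurable, ?_⟩
  rw [HasFiniteIntegral, slab, lintegral_prod _ hm.enorm.aemeasurable]
  calc _ ≤ ∫⁻ s in Ioc 0 T, ∑ n ∈ Finset.range (⌊T / τ⌋₊ + 1), ∫⁻ x, ‖u n x‖ₑ := by
        refine setLIntegral_mono' measurableSet_Ioc fun s hs => ?_
        refine Finset.single_le_sum (f := fun n => ∫⁻ x, ‖u n x‖ₑ) (a := ⌊s / τ⌋₊) (fun n _ => bot_le) ?_
        rw [Finset.mem_range, Nat.lt_succ_iff]
        exact Nat.floor_le_floor (div_le_div_of_nonneg_right hs.2 hτ.le)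
    _ < ∞ := by
        rw [setLIntegral_const]
        refine ENNReal.mul_lt_top (ENNReal.sum_lt_top.2 fun n _ => ?_) (by simp)
        exact ((hu n).integrable_of_hasCompactSupport (huc n)).2

lemma setIntegral_comp_floor (hτ : 0 < τ) (g : ℕ → ℝ) (N : ℕ) :
    IntegrableOn (fun s => g ⌊s / τ⌋₊) (Ico 0 (N * τ)) ∧
      ∫ s in Ico 0 (N * τ), g ⌊s / τ⌋₊ = ∑ n ∈ Finset.range N, τ * g n := by
  induction N with
  | zero => simp
  | succ N ih =>
    have hN : 0 ≤ (N : ℝ) * τ := by positivity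
    have h1 : Ico 0 (((N + 1 : ℕ) : ℝ) * τ) = Ico 0 (N * τ) ∪ Ico (N * τ) ((N + 1) * τ) := by
      rw [Ico_union_Ico_eq_Ico hN (by nlinarith)]
      push_cast
      rfl
    have h2 : EqOn (fun s => g ⌊s / τ⌋₊) (fun _ => g N) (Ico (N * τ) ((N + 1) * τ)) := fun s hs => by
      simp only [timeStep_index hτ hs]
    have h3 : IntegrableOn (fun s => g ⌊s / τ⌋₊) (Ico (N * τ) ((N + 1) * τ)) :=
      (integrableOn_const (by simp)).congr_fun h2.symm measurableSet_Ico
    rw [h1]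
    refine ⟨ih.1.union h3, ?_⟩
    rw [setIntegral_union (Ico_disjoint_Ico_same) measurableSet_Ico ih.1 h3, ih.2,
      setIntegral_congr_fun measurableSet_Ico h2, Finset.sum_range_succ, setIntegral_const]
    simp only [Measure.real, Real.volume_Ico, smul_eq_mul]
    rw [ENNReal.toReal_ofReal (by nlinarith)]
    ring

lemma integral_slab_comp_floor (hτ : 0 < τ) {u : ℕ → E3 → ℝ} (hu : ∀ n, Continuous (u n))
    (huc : ∀ n, HasCompactSupport (u n)) (N : ℕ) :
    ∫ p : ℝ × E3, u ⌊p.1 / τ⌋₊ p.2 ∂slab (N * τ) = ∑ n ∈ Finset.range N, τ * ∫ x, u n x := by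
  have hi := integrable_comp_floor hτ hu huc (N * τ)
  rw [slab] at hi ⊢
  rw [integral_prod _ hi, ← (setIntegral_comp_floor hτ (fun n => ∫ x, u n x) N).2,
    ← setIntegral_congr_set Ico_ae_eq_Ioc]

end StepSums

/-- The solution of the scheme as a function on space-time, piecewise constant in time. -/
noncomputable def schemeField (h τ : ℝ) (a : ℕ → Fin 3 → E3 → ℝ) (f : E3 → ℝ) (p : ℝ × E3) : ℝ :=
  eulerScheme h τ a f ⌊p.1 / τ⌋₊ p.2

/-- The difference quotients of the solution of the scheme. -/
noncomputable def schemeGrad (h τ : ℝ) (a : ℕ → Fin 3 → E3 → ℝ) (f : E3 → ℝ) (i : Fin 3)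
    (p : ℝ × E3) : ℝ :=
  diffQuot (stdVec i) h (eulerScheme h τ a f ⌊p.1 / τ⌋₊) p.2

/-- The second difference quotients of the solution of the scheme. -/
noncomputable def schemeHess (h τ : ℝ) (a : ℕ → Fin 3 → E3 → ℝ) (f : E3 → ℝ) (i j : Fin 3)
    (p : ℝ × E3) : ℝ :=
  diffQuot (stdVec i) h (diffQuot (stdVec j) h (eulerScheme h τ a f ⌊p.1 / τ⌋₊)) p.2

namespace StableVelocity

variable {h τ : ℝ} {a : ℕ → Fin 3 → E3 → ℝ} {f : E3 → ℝ}

lemma integral_eulerScheme_mul (H : StableVelocity h τ a) (hf : Continuous f)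
    (hfc : HasCompactSupport f) {g : E3 → ℝ} (hg : Continuous g) (N : ℕ) :
    ∫ x, eulerScheme h τ a f N x * g x = (∫ x, f x * g x) + ∑ n ∈ Finset.range N,
      τ * ∫ x, (eulerScheme h τ a f n x * discreteLaplacian h g x
        + ∑ i, diffQuot (stdVec i) h (eulerScheme h τ a f n) x
          * (a n i x * ((g x + g (x + h • stdVec i)) / 2))) := by
  have hint (n : ℕ) : Integrable fun x => eulerScheme h τ a f n x * g x :=
    ((H.continuous_eulerScheme hf n).fun_mul hg).integrable_of_hasCompactSupport
      (hasCompactSupport_eulerScheme hfc n).mul_right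
  induction N with
  | zero => simp [eulerScheme]
  | succ N ih =>
    rw [Finset.sum_range_succ, ← add_assoc, ← ih, ← integral_eulerStep_sub_mul H.h_pos
      (H.continuous N) (H.divFree N) (H.continuous_eulerScheme hf N)
      (hasCompactSupport_eulerScheme hfc N) hg]
    simp only [sub_mul]
    have h1 := integral_sub (hint (N + 1)) (hint N)
    simp only [eulerScheme] at h1 ⊢
    rw [h1]
    ring

lemma measurable_schemeField (H : StableVelocity h τ a) (hf : Continuous f) :
    Measurable (schemeField h τ a f) :=
  measurable_comp_floor τ fun n => (H.continuous_eulerScheme hf n).measurable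

lemma measurable_schemeGrad (H : StableVelocity h τ a) (hf : Continuous f) (i : Fin 3) :
    Measurable (schemeGrad h τ a f i) :=
  measurable_comp_floor τ fun n =>
    (continuous_diffQuot (stdVec i) h (H.continuous_eulerScheme hf n)).measurable

lemma measurable_schemeHess (H : StableVelocity h τ a) (hf : Continuous f) (i j : Fin 3) :
    Measurable (schemeHess h τ a f i j) :=
  measurable_comp_floor τ fun n => (continuous_diffQuot (stdVec i) h
    (continuous_diffQuot (stdVec j) h (H.continuous_eulerScheme hf n))).measurable

lemma measurable_velocity (H : StableVelocity h τ a) (i : Fin 3) :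
    Measurable fun p : ℝ × E3 => a ⌊p.1 / τ⌋₊ i p.2 :=
  measurable_comp_floor (u := fun n => a n i) τ fun n => (H.continuous n i).measurable

/-- The weak form of the scheme, in space-time. -/
lemma integral_eulerScheme_mul_eq_integral_slab (H : StableVelocity h τ a) (hf : Continuous f)
    (hfc : HasCompactSupport f) {g : E3 → ℝ} (hg : Continuous g) (N : ℕ) :
    ∫ x, eulerScheme h τ a f N x * g x = (∫ x, f x * g x)
      + ∫ p, (schemeField h τ a f p * discreteLaplacian h g p.2
        + ∑ i, schemeGrad h τ a f i p
          * (a ⌊p.1 / τ⌋₊ i p.2 * ((g p.2 + g (p.2 + h • stdVec i)) / 2))) ∂slab (N * τ) := by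
  rw [H.integral_eulerScheme_mul hf hfc hg N]
  congr 1
  symm
  refine integral_slab_comp_floor H.τ_pos (u := fun n x =>
    eulerScheme h τ a f n x * discreteLaplacian h g x
        + ∑ i, diffQuot (stdVec i) h (eulerScheme h τ a f n) x
          * (a n i x * ((g x + g (x + h • stdVec i)) / 2))) (fun n => ?_) (fun n => ?_) N
  · refine ((H.continuous_eulerScheme hf n).fun_mul (continuous_discreteLaplacian h hg)).add ?_
    refine continuous_finsetSum _ fun i _ => ?_
    have h1 := continuous_diffQuot (stdVec i) h (H.continuous_eulerScheme hf n)
    have h2 := H.continuous n i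
    fun_prop
  · refine HasCompactSupport.add (hasCompactSupport_eulerScheme hfc n).mul_right ?_
    refine hasCompactSupport_finset_sum _ fun i _ => ?_
    exact (hasCompactSupport_diffQuot _ _ (hasCompactSupport_eulerScheme hfc n)).mul_right

end StableVelocity

lemma memLp_two_of_hasCompactSupport {u : E3 → ℝ} (hu : Continuous u) (huc : HasCompactSupport u) :
    MemLp u 2 volume :=
  (memLp_two_iff_integrable_sq hu.aestronglyMeasurable).2 (integrable_sq_of_hasCompactSupport hu huc)

lemma integral_sq_diffQuot_le {f : E3 → ℝ} (hf : ContDiff ℝ 1 f) (hfc : HasCompactSupport f)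
    (d : E3) (r : ℝ) : ∫ x, diffQuot d r f x ^ 2 ≤ ∫ x, fderiv ℝ f x d ^ 2 := by
  have h1 : MemLp (fun x => fderiv ℝ f x d) 2 volume :=
    memLp_two_of_hasCompactSupport (continuous_fderiv_apply hf d) (hfc.fderiv_apply ℝ d)
  refine integral_sq_le_of_lintegral_le (continuous_diffQuot d r hf.continuous).aestronglyMeasurable
    (integral_nonneg fun x => sq_nonneg _) ?_
  rw [← lintegral_enorm_sq_eq_ofReal_integral h1, ← eLpNorm_two_sq, ← eLpNorm_two_sq]
  exact pow_le_pow_left' (eLpNorm_diffQuot_le hf d r) 2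

/-! ### Uniform bounds and weak limits of the scheme -/

namespace ApproximatingVelocity

variable {v : ℝ × E3 → E3} {B : Fin 3 → ℝ} {h τ : ℕ → ℝ} {a : ℕ → ℕ → Fin 3 → E3 → ℝ}
  {f : E3 → ℝ} {M : ℝ}

lemma comp_subseq (A : ApproximatingVelocity v B h τ a) {θ : ℕ → ℕ} (hθ : StrictMono θ) :
    ApproximatingVelocity v B (h ∘ θ) (τ ∘ θ) (a ∘ θ) where
  stable k := A.stable (θ k)
  h_le_one k := A.h_le_one (θ k)
  tendsto_h := A.tendsto_h.comp hθ.tendsto_atTop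
  tendsto_ratio := A.tendsto_ratio.comp hθ.tendsto_atTop
  integrable_sq k := A.integrable_sq (θ k)
  sum_le k := A.sum_le (θ k)
  tendsto i T R := (A.tendsto i T R).comp hθ.tendsto_atTop

lemma τ_le_one (A : ApproximatingVelocity v B h τ a) (k : ℕ) : τ k ≤ 1 := by
  have h1 := (A.stable k).cfl
  have h2 := pow_le_one₀ (n := 2) (A.stable k).h_pos.le (A.h_le_one k)
  linarith [(A.stable k).τ_pos]

lemma tendsto_τ (A : ApproximatingVelocity v B h τ a) : Tendsto τ atTop (𝓝 0) := by
  refine squeeze_zero (fun k => (A.stable k).τ_pos.le) (fun k => ?_) (by simpa using A.tendsto_h.pow 2)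
  linarith [(A.stable k).cfl, (A.stable k).τ_pos]

/-- The factors `1 ± 54 τ / h²` are kept since they tend to one and yield the exact constants in the
limit; `energy_le_energyBound` is the cruder form used for compactness. -/
lemma energy_le (A : ApproximatingVelocity v B h τ a) (hf : ContDiff ℝ 1 f)
    (hfc : HasCompactSupport f) (hM : ∀ x, |f x| ≤ M) (k N : ℕ) (j : Fin 3) :
    (∫ x, diffQuot (stdVec j) (h k) (eulerScheme (h k) (τ k) (a k) f N) x ^ 2)
      + (1 - 54 * τ k / h k ^ 2) * ∑ n ∈ Finset.range N, τ k * ∑ i, ∫ x, diffQuot (stdVec i) (h k)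
        (diffQuot (stdVec j) (h k) (eulerScheme (h k) (τ k) (a k) f n)) x ^ 2
      ≤ (∫ x, fderiv ℝ f x (stdVec j) ^ 2) + (1 + 54 * τ k / h k ^ 2) * M ^ 2 * B j := by
  have h1 := (A.stable k).integral_sq_diffQuot_eulerScheme_add_le hf.continuous hfc hM (stdVec j)
    (h k) (fun n i => A.integrable_sq k n i j) N
  refine h1.trans (add_le_add (integral_sq_diffQuot_le hf hfc _ _) ?_)
  refine mul_le_mul_of_nonneg_left (A.sum_le k N j) ?_
  have := (A.stable k).h_pos
  have := (A.stable k).τ_pos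
  positivity

/-- The right-hand side of the energy inequality for the scheme, without its small parameter. -/
noncomputable def energyBound (B : Fin 3 → ℝ) (f : E3 → ℝ) (M : ℝ) (j : Fin 3) : ℝ :=
  (∫ x, fderiv ℝ f x (stdVec j) ^ 2) + 2 * M ^ 2 * B j

lemma B_nonneg (A : ApproximatingVelocity v B h τ a) (j : Fin 3) : 0 ≤ B j := by
  simpa using A.sum_le 0 0 j

lemma energyBound_nonneg (A : ApproximatingVelocity v B h τ a) (f : E3 → ℝ) (M : ℝ) (j : Fin 3) :
    0 ≤ energyBound B f M j := by
  have := A.B_nonneg j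
  have : 0 ≤ ∫ x, fderiv ℝ f x (stdVec j) ^ 2 := integral_nonneg fun x => sq_nonneg _
  unfold energyBound
  positivity

lemma sum_nonneg_hess (A : ApproximatingVelocity v B h τ a) (f : E3 → ℝ) (k N : ℕ) (j : Fin 3) :
    0 ≤ ∑ n ∈ Finset.range N, τ k * ∑ i, ∫ x, diffQuot (stdVec i) (h k)
        (diffQuot (stdVec j) (h k) (eulerScheme (h k) (τ k) (a k) f n)) x ^ 2 :=
  Finset.sum_nonneg fun _ _ => mul_nonneg (A.stable k).τ_pos.le
    (Finset.sum_nonneg fun _ _ => integral_nonneg fun _ => sq_nonneg _)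

lemma energy_le_energyBound (A : ApproximatingVelocity v B h τ a) (hf : ContDiff ℝ 1 f)
    (hfc : HasCompactSupport f) (hM : ∀ x, |f x| ≤ M) (k N : ℕ) (j : Fin 3) :
    (∫ x, diffQuot (stdVec j) (h k) (eulerScheme (h k) (τ k) (a k) f N) x ^ 2)
      + 1 / 2 * ∑ n ∈ Finset.range N, τ k * ∑ i, ∫ x, diffQuot (stdVec i) (h k)
        (diffQuot (stdVec j) (h k) (eulerScheme (h k) (τ k) (a k) f n)) x ^ 2
      ≤ energyBound B f M j := by
  have h1 := A.energy_le hf hfc hM k N j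
  have h2 := (A.stable k).one_sub_pos
  have h3 := mul_le_mul_of_nonneg_right h2 (A.sum_nonneg_hess f k N j)
  have h4 : (1 + 54 * τ k / h k ^ 2) * (M ^ 2 * B j) ≤ 2 * (M ^ 2 * B j) :=
    mul_le_mul_of_nonneg_right (by linarith) (mul_nonneg (sq_nonneg _) (A.B_nonneg j))
  unfold energyBound
  linarith

lemma integral_sq_diffQuot_le_energyBound (A : ApproximatingVelocity v B h τ a)
    (hf : ContDiff ℝ 1 f) (hfc : HasCompactSupport f) (hM : ∀ x, |f x| ≤ M) (k N : ℕ) (j : Fin 3) :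
    ∫ x, diffQuot (stdVec j) (h k) (eulerScheme (h k) (τ k) (a k) f N) x ^ 2
      ≤ energyBound B f M j := by
  linarith [A.energy_le_energyBound hf hfc hM k N j, A.sum_nonneg_hess f k N j]

lemma memLp_eulerScheme (A : ApproximatingVelocity v B h τ a) (hf : Continuous f)
    (hfc : HasCompactSupport f) (k n : ℕ) :
    MemLp (eulerScheme (h k) (τ k) (a k) f n) 2 volume :=
  memLp_two_of_hasCompactSupport ((A.stable k).continuous_eulerScheme hf n)
    (StableVelocity.hasCompactSupport_eulerScheme hfc n)

lemma memLp_diffQuot_eulerScheme (A : ApproximatingVelocity v B h τ a) (hf : Continuous f)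
    (hfc : HasCompactSupport f) (k n : ℕ) (j : Fin 3) :
    MemLp (diffQuot (stdVec j) (h k) (eulerScheme (h k) (τ k) (a k) f n)) 2 volume :=
  memLp_two_of_hasCompactSupport
    (continuous_diffQuot _ _ ((A.stable k).continuous_eulerScheme hf n))
    (hasCompactSupport_diffQuot _ _ (StableVelocity.hasCompactSupport_eulerScheme hfc n))

lemma memLp_diffQuot_diffQuot_eulerScheme (A : ApproximatingVelocity v B h τ a) (hf : Continuous f)
    (hfc : HasCompactSupport f) (k n : ℕ) (i j : Fin 3) :
    MemLp (diffQuot (stdVec i) (h k) (diffQuot (stdVec j) (h k)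
      (eulerScheme (h k) (τ k) (a k) f n))) 2 volume :=
  memLp_two_of_hasCompactSupport
    (continuous_diffQuot _ _ (continuous_diffQuot _ _ ((A.stable k).continuous_eulerScheme hf n)))
    (hasCompactSupport_diffQuot _ _
      (hasCompactSupport_diffQuot _ _ (StableVelocity.hasCompactSupport_eulerScheme hfc n)))

lemma memLp_slab_comp_floor {τ T : ℝ} {u : ℕ → E3 → ℝ} {C : ℝ} (hu : ∀ n, MemLp (u n) 2 volume)
    (hum : ∀ n, Continuous (u n)) (hC : ∀ n, ∫ x, u n x ^ 2 ≤ C) :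
    MemLp (fun p : ℝ × E3 => u ⌊p.1 / τ⌋₊ p.2) 2 (slab T) ∧
      ∫ p : ℝ × E3, u ⌊p.1 / τ⌋₊ p.2 ^ 2 ∂slab T ≤ |T| * C := by
  have hC0 : 0 ≤ C := (integral_nonneg fun x => sq_nonneg _).trans (hC 0)
  have hm := measurable_comp_floor τ fun n => (hum n).measurable
  have key : ∫⁻ p : ℝ × E3, ‖u ⌊p.1 / τ⌋₊ p.2‖ₑ ^ 2 ∂slab T ≤ ENNReal.ofReal (|T| * C) := by
    rw [slab, lintegral_prod _ (hm.enorm.pow_const 2).aemeasurable]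
    calc _ ≤ ∫⁻ s in Ioc 0 T, ENNReal.ofReal C := by
          refine lintegral_mono fun s => ?_
          dsimp only
          rw [lintegral_enorm_sq_eq_ofReal_integral (hu _)]
          exact ENNReal.ofReal_le_ofReal (hC _)
      _ ≤ _ := by
          rw [setLIntegral_const, Real.volume_Ioc, sub_zero, mul_comm, ENNReal.ofReal_mul (abs_nonneg _)]
          gcongr
          exact le_abs_self T
  exact ⟨memLp_two_of_lintegral_le hm.aestronglyMeasurable key,
    integral_sq_le_of_lintegral_le hm.aestronglyMeasurable (by positivity) key⟩

/-- Weak limits, along a subsequence, of the solutions of the scheme and of their difference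
quotients. -/
lemma exists_subseq_tendstoWeakL2 (A : ApproximatingVelocity v B h τ a) (hf : ContDiff ℝ 1 f)
    (hfc : HasCompactSupport f) (hM : ∀ x, |f x| ≤ M) :
    ∃ (θ : ℕ → ℕ) (φ : ℝ × E3 → ℝ) (Dφ : Fin 3 → ℝ × E3 → ℝ), StrictMono θ ∧
      (∀ T, MemLp φ 2 (slab T)) ∧ (∀ i T, MemLp (Dφ i) 2 (slab T)) ∧
      (∀ T, TendstoWeakL2 (slab T)
        (fun k => schemeField (h (θ k)) (τ (θ k)) (a (θ k)) f) atTop φ) ∧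
      ∀ i T, TendstoWeakL2 (slab T)
        (fun k => schemeGrad (h (θ k)) (τ (θ k)) (a (θ k)) f i) atTop (Dφ i) := by
  -- The index `none` stands for the solution and `some i` for its difference quotients, so that one
  -- subsequence serves all four.
  set F : Option (Fin 3) → ℕ → ℝ × E3 → ℝ := fun o k =>
    o.elim (schemeField (h k) (τ k) (a k) f) (schemeGrad (h k) (τ k) (a k) f) with hF
  set C : ℝ := (∫ x, f x ^ 2) + ∑ j, energyBound B f M j with hC
  have hE (j : Fin 3) : energyBound B f M j ≤ ∑ j, energyBound B f M j :=
    Finset.single_le_sum (f := fun j => energyBound B f M j)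
      (fun j _ => A.energyBound_nonneg f M j) (Finset.mem_univ j)
  have hE0 : 0 ≤ ∑ j, energyBound B f M j :=
    Finset.sum_nonneg fun j _ => A.energyBound_nonneg f M j
  have h0 : 0 ≤ ∫ x, f x ^ 2 := integral_nonneg fun x => sq_nonneg _
  have hFm : ∀ o k, Measurable (F o k) := by
    rintro (_ | i) k
    · exact (A.stable k).measurable_schemeField hf.continuous
    · exact (A.stable k).measurable_schemeGrad hf.continuous i
  have hFC : ∀ o k s, ∫⁻ x, ‖F o k (s, x)‖ₑ ^ 2 ≤ ENNReal.ofReal C := by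
    rintro (_ | i) k s
    · simp only [hF, Option.elim, schemeField]
      rw [lintegral_enorm_sq_eq_ofReal_integral (A.memLp_eulerScheme hf.continuous hfc k _)]
      refine ENNReal.ofReal_le_ofReal ?_
      linarith [(A.stable k).integral_sq_eulerScheme_le hf.continuous hfc ⌊s / τ k⌋₊]
    · simp only [hF, Option.elim, schemeGrad]
      rw [lintegral_enorm_sq_eq_ofReal_integral
        (A.memLp_diffQuot_eulerScheme hf.continuous hfc k _ i)]
      refine ENNReal.ofReal_le_ofReal ?_
      linarith [A.integral_sq_diffQuot_le_energyBound hf hfc hM k ⌊s / τ k⌋₊ i, hE i]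
  obtain ⟨θ, f', hθ, -, h2, h3⟩ := exists_tendstoWeakL2_slab hFm hFC
  exact ⟨θ, f' none, fun i => f' (some i), hθ, h2 none, fun i => h2 (some i), h3 none,
    fun i => h3 (some i)⟩

end ApproximatingVelocity

/-- The solutions of the scheme and their difference quotients converge weakly in `L²` of any
finite time slab. -/
structure SchemeLimit (v : ℝ × E3 → E3) (B : Fin 3 → ℝ) (h τ : ℕ → ℝ)
    (a : ℕ → ℕ → Fin 3 → E3 → ℝ) (f : E3 → ℝ) (M : ℝ) (φ : ℝ × E3 → ℝ) (Dφ : Fin 3 → ℝ × E3 → ℝ) :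
    Prop extends ApproximatingVelocity v B h τ a where
  measurable : Measurable v
  lintegral_lt_top : ∀ K : Set E3, volume K ≠ ∞ →
    ∫⁻ p in univ ×ˢ K, ‖v p‖ₑ ^ 2 ∂halfSpaceTime < ∞
  contDiff : ContDiff ℝ ((⊤ : ℕ∞) : WithTop ℕ∞) f
  hasCompactSupport : HasCompactSupport f
  abs_le : ∀ x, |f x| ≤ M
  memLp : ∀ T, MemLp φ 2 (slab T)
  memLp_grad : ∀ i T, MemLp (Dφ i) 2 (slab T)
  tendsto_field : ∀ T, TendstoWeakL2 (slab T) (fun k => schemeField (h k) (τ k) (a k) f) atTop φ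
  tendsto_grad : ∀ i T,
    TendstoWeakL2 (slab T) (fun k => schemeGrad (h k) (τ k) (a k) f i) atTop (Dφ i)

namespace SchemeLimit

variable {v : ℝ × E3 → E3} {B : Fin 3 → ℝ} {h τ : ℕ → ℝ} {a : ℕ → ℕ → Fin 3 → E3 → ℝ}
  {f : E3 → ℝ} {M : ℝ} {φ : ℝ × E3 → ℝ} {Dφ : Fin 3 → ℝ × E3 → ℝ}

lemma contDiff_one (L : SchemeLimit v B h τ a f M φ Dφ) : ContDiff ℝ 1 f :=
  L.contDiff.of_le (mod_cast le_top)

lemma measurable_apply (L : SchemeLimit v B h τ a f M φ Dφ) (i : Fin 3) :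
    Measurable fun p => v p i :=
  (EuclideanSpace.proj i : E3 →L[ℝ] ℝ).continuous.measurable.comp L.measurable

lemma memLp_apply (L : SchemeLimit v B h τ a f M φ Dφ) (i : Fin 3) (T : ℝ) {K : Set E3}
    (hK : volume K ≠ ∞) : MemLp (fun p => v p i) 2 ((slab T).restrict (univ ×ˢ K)) := by
  refine MemLp.mono_measure
    (Measure.restrict_mono_measure (slab_le_halfSpaceTime T) _) ?_
  have h1 : ∫⁻ p in univ ×ˢ K, ‖v p i‖ₑ ^ 2 ∂halfSpaceTime < ∞ := by
    refine lt_of_le_of_lt (lintegral_mono fun p => ?_) (L.lintegral_lt_top K hK)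
    gcongr
    exact enorm_le_iff_norm_le.2 (PiLp.norm_apply_le _ i)
  exact memLp_two_of_lintegral_le (L.measurable_apply i).aestronglyMeasurable
    (by rw [ENNReal.ofReal_toReal h1.ne])

lemma memLp_schemeField (L : SchemeLimit v B h τ a f M φ Dφ) (T : ℝ) (k : ℕ) :
    MemLp (schemeField (h k) (τ k) (a k) f) 2 (slab T) ∧
      ∫ p, schemeField (h k) (τ k) (a k) f p ^ 2 ∂slab T ≤ |T| * ∫ x, f x ^ 2 :=
  ApproximatingVelocity.memLp_slab_comp_floor
    (fun n => L.memLp_eulerScheme L.contDiff.continuous L.hasCompactSupport k n)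
    (fun n => (L.stable k).continuous_eulerScheme L.contDiff.continuous n)
    fun n => (L.stable k).integral_sq_eulerScheme_le L.contDiff.continuous L.hasCompactSupport n

lemma memLp_schemeGrad (L : SchemeLimit v B h τ a f M φ Dφ) (T : ℝ) (k : ℕ) (i : Fin 3) :
    MemLp (schemeGrad (h k) (τ k) (a k) f i) 2 (slab T) ∧
      ∫ p, schemeGrad (h k) (τ k) (a k) f i p ^ 2 ∂slab T
        ≤ |T| * ApproximatingVelocity.energyBound B f M i :=
  ApproximatingVelocity.memLp_slab_comp_floor
    (u := fun n => diffQuot (stdVec i) (h k) (eulerScheme (h k) (τ k) (a k) f n))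
    (fun n => L.memLp_diffQuot_eulerScheme L.contDiff.continuous L.hasCompactSupport k n i)
    (fun n => continuous_diffQuot _ _
      ((L.stable k).continuous_eulerScheme L.contDiff.continuous n))
    fun n => L.integral_sq_diffQuot_le_energyBound L.contDiff_one L.hasCompactSupport L.abs_le k n i

variable {T R : ℝ} {c : ℕ → ℝ × E3 → ℝ} {c' : ℝ × E3 → ℝ}

lemma measurableSet_univ_prod_closedBall (R : ℝ) :
    MeasurableSet ((univ : Set ℝ) ×ˢ Metric.closedBall (0 : E3) R) :=
  MeasurableSet.univ.prod measurableSet_closedBall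

lemma slab_univ_prod_closedBall_ne_top (T R : ℝ) :
    slab T ((univ : Set ℝ) ×ˢ Metric.closedBall (0 : E3) R) ≠ ∞ :=
  slab_univ_prod_lt_top T measure_closedBall_lt_top.ne

lemma tendsto_integral_field (L : SchemeLimit v B h τ a f M φ Dφ)
    (hc : BoundedTendsto (slab T) (univ ×ˢ Metric.closedBall (0 : E3) R) c c') :
    Tendsto (fun k => ∫ p, schemeField (h k) (τ k) (a k) f p * c k p ∂slab T) atTop
      (𝓝 (∫ p, φ p * c' p ∂slab T)) :=
  (L.tendsto_field T).tendsto_integral_mul (fun k => (L.memLp_schemeField T k).1)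
    (fun k => (L.memLp_schemeField T k).2)
    (hc.memLp_seq (measurableSet_univ_prod_closedBall R) (slab_univ_prod_closedBall_ne_top T R))
    (hc.memLp_lim (measurableSet_univ_prod_closedBall R) (slab_univ_prod_closedBall_ne_top T R))
    (hc.integral_sub_sq_tendsto (measurableSet_univ_prod_closedBall R)
      (slab_univ_prod_closedBall_ne_top T R))

lemma tendsto_integral_grad (L : SchemeLimit v B h τ a f M φ Dφ)
    (hc : BoundedTendsto (slab T) (univ ×ˢ Metric.closedBall (0 : E3) R) c c') (i : Fin 3) :
    Tendsto (fun k => ∫ p, schemeGrad (h k) (τ k) (a k) f i p * c k p ∂slab T) atTop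
      (𝓝 (∫ p, Dφ i p * c' p ∂slab T)) :=
  (L.tendsto_grad i T).tendsto_integral_mul (fun k => (L.memLp_schemeGrad T k i).1)
    (fun k => (L.memLp_schemeGrad T k i).2)
    (hc.memLp_seq (measurableSet_univ_prod_closedBall R) (slab_univ_prod_closedBall_ne_top T R))
    (hc.memLp_lim (measurableSet_univ_prod_closedBall R) (slab_univ_prod_closedBall_ne_top T R))
    (hc.integral_sub_sq_tendsto (measurableSet_univ_prod_closedBall R)
      (slab_univ_prod_closedBall_ne_top T R))

lemma memLp_velocity_mul (L : SchemeLimit v B h τ a f M φ Dφ)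
    (hc : BoundedTendsto (slab T) (univ ×ˢ Metric.closedBall (0 : E3) R) c c') (k : ℕ) (i : Fin 3) :
    MemLp (fun p : ℝ × E3 => a k ⌊p.1 / τ k⌋₊ i p.2 * c k p) 2 (slab T) := by
  have hb : MemLp (fun p : ℝ × E3 => a k ⌊p.1 / τ k⌋₊ i p.2) 2
      ((slab T).restrict (univ ×ˢ Metric.closedBall (0 : E3) R)) := by
    have : IsFiniteMeasure ((slab T).restrict (univ ×ˢ Metric.closedBall (0 : E3) R)) :=
      ⟨by simpa using (slab_univ_prod_closedBall_ne_top T R).lt_top⟩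
    refine MemLp.of_bound ((L.stable k).measurable_velocity i).aestronglyMeasurable (1 / h k) ?_
    exact Eventually.of_forall fun p => (L.stable k).abs_le _ _ _
  exact hc.memLp_mul_seq (measurableSet_univ_prod_closedBall R) hb
    ((L.stable k).measurable_velocity i).aestronglyMeasurable k

lemma memLp_mul_lim (L : SchemeLimit v B h τ a f M φ Dφ)
    (hc : BoundedTendsto (slab T) (univ ×ˢ Metric.closedBall (0 : E3) R) c c') (i : Fin 3) :
    MemLp (fun p => v p i * c' p) 2 (slab T) :=
  hc.memLp_mul (measurableSet_univ_prod_closedBall R)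
    (L.memLp_apply i T measure_closedBall_lt_top.ne) (L.measurable_apply i).aestronglyMeasurable

/-- The only product of two varying factors apart from the test function: the difference quotients
converge weakly, while velocity times discretized test function converges strongly in `L²`. -/
lemma tendsto_integral_transport (L : SchemeLimit v B h τ a f M φ Dφ)
    (hc : BoundedTendsto (slab T) (univ ×ˢ Metric.closedBall (0 : E3) R) c c') (i : Fin 3) :
    Tendsto (fun k => ∫ p, schemeGrad (h k) (τ k) (a k) f i p * (a k ⌊p.1 / τ k⌋₊ i p.2 * c k p)
      ∂slab T) atTop (𝓝 (∫ p, Dφ i p * (v p i * c' p) ∂slab T)) :=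
  (L.tendsto_grad i T).tendsto_integral_mul (fun k => (L.memLp_schemeGrad T k i).1)
    (fun k => (L.memLp_schemeGrad T k i).2) (fun k => L.memLp_velocity_mul hc k i)
    (L.memLp_mul_lim hc i)
    (hc.integral_mul_tendsto (a := fun k (p : ℝ × E3) => a k ⌊p.1 / τ k⌋₊ i p.2)
      (v := fun p => v p i) (measurableSet_univ_prod_closedBall R)
      (fun k => ((L.stable k).measurable_velocity i).aestronglyMeasurable)
      (L.memLp_apply i T measure_closedBall_lt_top.ne) (L.measurable_apply i).aestronglyMeasurable
      (L.tendsto i T R))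

end SchemeLimit

/-! ### Convergence and continuity in time of pairings with functions of space -/

/-- The Laplacian of a function on `ℝ³`. -/
noncomputable def laplacianE3 (g : E3 → ℝ) (x : E3) : ℝ :=
  ∑ i, fderiv ℝ (fun y => fderiv ℝ g y (stdVec i)) x (stdVec i)

lemma boundedTendsto_discreteLaplacian {g : E3 → ℝ} (hg : ContDiff ℝ 2 g)
    (hgc : HasCompactSupport g) {R : ℝ} (hR : tsupport g ⊆ Metric.closedBall 0 R) {h : ℕ → ℝ}
    (hh : Tendsto h atTop (𝓝 0)) (hpos : ∀ k, 0 < h k) (hle : ∀ k, h k ≤ 1) :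
    BoundedTendsto volume (Metric.closedBall 0 (R + 2)) (fun k => discreteLaplacian (h k) g)
      (laplacianE3 g) := by
  have h1 := BoundedTendsto.finset_sum (μ := (volume : Measure E3)) Finset.univ fun (i : Fin 3) _ =>
    BoundedTendsto.diffQuot_diffQuot (μ := (volume : Measure E3)) hg hgc hR (norm_stdVec i).le hh
      (fun k => (hpos k).ne') (fun k => by rw [abs_of_pos (hpos k)]; exact hle k)
  have e : (fun k => discreteLaplacian (h k) g) = fun k x =>
      ∑ i, diffQuot (stdVec i) (-h k) (diffQuot (stdVec i) (h k) g) x := by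
    ext k x; exact discreteLaplacian_eq_sum g x
  rw [e]
  exact h1

lemma BoundedTendsto.average_shift {V : Type*} [NormedAddCommGroup V] [NormedSpace ℝ V]
    [MeasurableSpace V] [BorelSpace V] [SecondCountableTopologyEither V ℝ] {μ : Measure V}
    {Ψ : V → ℝ} {R : ℝ} {d : V} {r : ℕ → ℝ} (hΨ : Continuous Ψ) (hc : HasCompactSupport Ψ)
    (hR : tsupport Ψ ⊆ Metric.closedBall 0 R) (hd : ‖d‖ ≤ 1) (hr : Tendsto r atTop (𝓝 0))
    (hr1 : ∀ k, |r k| ≤ 1) :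
    BoundedTendsto μ (Metric.closedBall 0 (R + 2)) (fun k x => (Ψ x + Ψ (x + r k • d)) / 2) Ψ := by
  have h1 := BoundedTendsto.shift (μ := μ) hΨ hc hR hd (r := fun _ => 0) tendsto_const_nhds (by simp)
  have h2 := (h1.add (BoundedTendsto.shift (μ := μ) hΨ hc hR hd hr hr1)).const_mul (1 / 2)
  convert h2 using 1
  · ext k x; simp only [zero_smul, add_zero]; ring
  · ext x; ring

lemma tendsto_integral_mul_of_boundedTendsto {α : Type*} [MeasurableSpace α] {μ : Measure α}
    {K : Set α} {c : ℕ → α → ℝ} {c' : α → ℝ} {u w : α → ℝ} (hu : MemLp u 2 μ)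
    (hK : MeasurableSet K) (hc : BoundedTendsto μ K c c') (hw : MemLp w 2 (μ.restrict K))
    (hwm : AEStronglyMeasurable w μ) :
    Tendsto (fun k => ∫ x, u x * (w x * c k x) ∂μ) atTop (𝓝 (∫ x, u x * (w x * c' x) ∂μ)) :=
  TendstoWeakL2.tendsto_integral_mul (f := fun _ => u) (fun _ _ => tendsto_const_nhds)
    (fun _ => hu) (fun _ => le_rfl) (fun k => hc.memLp_mul_seq hK hw hwm k) (hc.memLp_mul hK hw hwm)
    (hc.integral_mul_tendsto hK (a := fun _ => w) (fun _ => hwm) hw hwm (by simp))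

lemma integral_slab_eq_indicator {σ T : ℝ} (hσ : σ ≤ T) (F : ℝ × E3 → ℝ) :
    ∫ p, F p ∂slab σ = ∫ p, (Ioc 0 σ).indicator (fun _ => F p) p.1 ∂slab T := by
  have e : slab σ = (slab T).restrict (Ioc 0 σ ×ˢ univ) := by
    rw [slab_eq_restrict, slab_eq_restrict, Measure.restrict_restrict
      (measurableSet_Ioc.prod MeasurableSet.univ), prod_inter_prod, univ_inter,
      Ioc_inter_Ioc, max_self, min_eq_left hσ]
  rw [e, ← integral_indicator (measurableSet_Ioc.prod MeasurableSet.univ)]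
  congr 1; ext p
  by_cases hp : p.1 ∈ Ioc 0 σ <;> simp [indicator, hp]

namespace SchemeLimit

variable {v : ℝ × E3 → E3} {B : Fin 3 → ℝ} {h τ : ℕ → ℝ} {a : ℕ → ℕ → Fin 3 → E3 → ℝ}
  {f : E3 → ℝ} {M : ℝ} {φ : ℝ × E3 → ℝ} {Dφ : Fin 3 → ℝ × E3 → ℝ} {g : E3 → ℝ} {T t : ℝ}

/-- The value at time `t` of the pairing of the limit of the scheme with `g`. -/
noncomputable def pairing (v : ℝ × E3 → E3) (f : E3 → ℝ) (φ : ℝ × E3 → ℝ) (Dφ : Fin 3 → ℝ × E3 → ℝ)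
    (g : E3 → ℝ) (t : ℝ) : ℝ :=
  (∫ x, f x * g x)
    + ∫ p, (φ p * laplacianE3 g p.2 + ∑ i, Dφ i p * (v p i * g p.2)) ∂slab t

lemma abs_h_le (A : ApproximatingVelocity v B h τ a) (k : ℕ) : |h k| ≤ 1 := by
  rw [abs_of_pos (A.stable k).h_pos]; exact A.h_le_one k

lemma boundedTendsto_laplacian (hg : ContDiff ℝ 2 g) (hgc : HasCompactSupport g) {R : ℝ}
    (hR : tsupport g ⊆ Metric.closedBall 0 R) :
    BoundedTendsto volume (Metric.closedBall 0 (R + 2)) (fun _ => laplacianE3 g)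
      (laplacianE3 g) := by
  refine BoundedTendsto.finset_sum (μ := (volume : Measure E3)) Finset.univ fun (i : Fin 3) _ => ?_
  have := BoundedTendsto.shift (μ := (volume : Measure E3)) (r := fun _ => 0)
    (continuous_fderiv_fderiv_apply hg (stdVec i) (stdVec i))
    ((hgc.fderiv_apply ℝ _).fderiv_apply ℝ _)
    (tsupport_fderiv_apply_subset_closedBall (tsupport_fderiv_apply_subset_closedBall hR _) _)
    (norm_stdVec i).le tendsto_const_nhds (by simp)
  simpa using this

lemma integral_indicator_terms {u : ℝ × E3 → ℝ} {w b : Fin 3 → ℝ × E3 → ℝ} {c : E3 → ℝ}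
    {e : Fin 3 → E3 → ℝ} {σ : ℝ} (hσ : σ ≤ T) (hu : MemLp u 2 (slab T))
    (hw : ∀ i, MemLp (w i) 2 (slab T))
    (hc : MemLp (fun p : ℝ × E3 => (Ioc 0 σ).indicator (fun _ => c p.2) p.1) 2 (slab T))
    (hb : ∀ i, MemLp (fun p : ℝ × E3 => b i p * (Ioc 0 σ).indicator (fun _ => e i p.2) p.1) 2
      (slab T)) :
    ∫ p, (u p * c p.2 + ∑ i, w i p * (b i p * e i p.2)) ∂slab σ
      = (∫ p, u p * (Ioc 0 σ).indicator (fun _ => c p.2) p.1 ∂slab T)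
        + ∑ i, ∫ p, w i p * (b i p * (Ioc 0 σ).indicator (fun _ => e i p.2) p.1) ∂slab T := by
  rw [integral_slab_eq_indicator hσ, ← integral_finsetSum, ← integral_add]
  · congr 1; ext p
    by_cases hp : p.1 ∈ Ioc 0 σ <;> simp [hp]
  · exact hu.integrable_mul hc
  · exact integrable_finsetSum _ fun i _ => (hw i).integrable_mul (hb i)
  · exact fun i _ => (hw i).integrable_mul (hb i)

lemma pairing_eq (L : SchemeLimit v B h τ a f M φ Dφ) (hg : ContDiff ℝ 2 g)
    (hgc : HasCompactSupport g) (ht : t ≤ T) :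
    pairing v f φ Dφ g t = (∫ x, f x * g x)
      + ((∫ p, φ p * (Ioc 0 t).indicator (fun _ => laplacianE3 g p.2) p.1 ∂slab T)
        + ∑ i, ∫ p, Dφ i p * (v p i * (Ioc 0 t).indicator (fun _ => g p.2) p.1) ∂slab T) := by
  obtain ⟨R, hR⟩ := hgc.exists_tsupport_subset
  have h1 := (boundedTendsto_laplacian hg hgc hR).timeCutoff (σ := fun _ => t) tendsto_const_nhds T
  have h2 := (BoundedTendsto.shift (μ := (volume : Measure E3)) (r := fun _ => 0) hg.continuous hgc
    hR (norm_stdVec 0).le tendsto_const_nhds (by simp)).timeCutoff (σ := fun _ => t)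
    tendsto_const_nhds T
  rw [pairing, integral_indicator_terms ht (L.memLp T) (fun i => L.memLp_grad i T)
    (h1.memLp_lim (measurableSet_univ_prod_closedBall _) (slab_univ_prod_closedBall_ne_top T _))
    (fun i => L.memLp_mul_lim h2 i)]

/-- The scheme, tested against a function, converges at any time. -/
lemma tendsto_pairing (L : SchemeLimit v B h τ a f M φ Dφ) (hg : ContDiff ℝ 2 g)
    (hgc : HasCompactSupport g) {N : ℕ → ℕ} (hN : Tendsto (fun k => N k * τ k) atTop (𝓝 t)) :
    Tendsto (fun k => ∫ x, eulerScheme (h k) (τ k) (a k) f (N k) x * g x) atTop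
      (𝓝 (pairing v f φ Dφ g t)) := by
  obtain ⟨R, hR⟩ := hgc.exists_tsupport_subset
  -- The final times vary with `k` but are bounded, so all integrals are written on one slab, with
  -- the time cut-off absorbed into the test function.
  obtain ⟨T, hT⟩ := hN.bddAbove_range
  have hT' (k : ℕ) : N k * τ k ≤ T := hT (mem_range_self k)
  have ht : t ≤ T := le_of_tendsto' hN hT'
  have hpos (k : ℕ) := (L.stable k).h_pos
  have h1 := (boundedTendsto_discreteLaplacian hg hgc hR L.tendsto_h hpos
    L.h_le_one).timeCutoff hN T
  have h2 (i : Fin 3) := (BoundedTendsto.average_shift (μ := (volume : Measure E3)) hg.continuous hgc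
    hR (norm_stdVec i).le L.tendsto_h (abs_h_le L.toApproximatingVelocity)).timeCutoff hN T
  rw [L.pairing_eq hg hgc ht]
  have key := tendsto_const_nhds (x := ∫ x, f x * g x) |>.add ((L.tendsto_integral_field h1).add
    (tendsto_finsetSum Finset.univ fun i _ => L.tendsto_integral_transport (h2 i) i))
  refine key.congr fun k => ?_
  rw [(L.stable k).integral_eulerScheme_mul_eq_integral_slab L.contDiff.continuous
    L.hasCompactSupport hg.continuous]
  congr 1
  symm
  exact integral_indicator_terms (u := schemeField (h k) (τ k) (a k) f)
    (w := schemeGrad (h k) (τ k) (a k) f) (b := fun i p => a k ⌊p.1 / τ k⌋₊ i p.2)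
    (e := fun i x => (g x + g (x + h k • stdVec i)) / 2) (hT' k) (L.memLp_schemeField T k).1
    (fun i => (L.memLp_schemeGrad T k i).1)
    (h1.memLp_seq (measurableSet_univ_prod_closedBall _) (slab_univ_prod_closedBall_ne_top T _) k)
    (fun i => L.memLp_velocity_mul (h2 i) k i)

lemma continuous_pairing (L : SchemeLimit v B h τ a f M φ Dφ) (hg : ContDiff ℝ 2 g)
    (hgc : HasCompactSupport g) : Continuous (pairing v f φ Dφ g) := by
  rw [continuous_iff_seqContinuous]
  intro σ t hσ
  obtain ⟨R, hR⟩ := hgc.exists_tsupport_subset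
  obtain ⟨T, hT⟩ := hσ.bddAbove_range
  have hT' (k : ℕ) : σ k ≤ T := hT (mem_range_self k)
  have h1 := (boundedTendsto_laplacian hg hgc hR).timeCutoff hσ T
  have h2 := (BoundedTendsto.shift (μ := (volume : Measure E3)) (r := fun _ => 0) hg.continuous hgc
    hR (norm_stdVec 0).le tendsto_const_nhds (by simp)).timeCutoff hσ T
  simp only [zero_smul, add_zero] at h2
  rw [L.pairing_eq hg hgc (le_of_tendsto' hσ hT')]
  simp only [Function.comp_def, L.pairing_eq hg hgc (hT' _)]
  refine tendsto_const_nhds.add (Tendsto.add ?_ (tendsto_finsetSum _ fun i _ => ?_))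
  · have : IsFiniteMeasure ((slab T).restrict (univ ×ˢ Metric.closedBall (0 : E3) (R + 2))) :=
      ⟨by simpa using (slab_univ_prod_closedBall_ne_top T _).lt_top⟩
    simpa using tendsto_integral_mul_of_boundedTendsto (L.memLp T)
      (measurableSet_univ_prod_closedBall _) h1 (memLp_const (1 : ℝ)) aestronglyMeasurable_const
  · exact tendsto_integral_mul_of_boundedTendsto (L.memLp_grad i T)
      (measurableSet_univ_prod_closedBall _) h2 (L.memLp_apply i T measure_closedBall_lt_top.ne)
      (L.measurable_apply i).aestronglyMeasurable

lemma pairing_zero : pairing v f φ Dφ g 0 = ∫ x, f x * g x := by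
  simp [pairing, slab]

end SchemeLimit

/-! ### Weak limits at every time -/

lemma TendstoWeakL2.integral_sq_le {α : Type*} [MeasurableSpace α] {μ : Measure α} {l : Filter ℕ}
    [l.NeBot] {S : ℕ → α → ℝ} {u : α → ℝ} {C : ℝ} (h : TendstoWeakL2 μ S l u) (hu : MemLp u 2 μ)
    (hS : ∀ k, MemLp (S k) 2 μ) (hC : ∀ k, ∫ x, S k x ^ 2 ∂μ ≤ C) : ∫ x, u x ^ 2 ∂μ ≤ C := by
  have hC0 : 0 ≤ C := (integral_nonneg fun x => sq_nonneg _).trans (hC 0)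
  have h1 := h u hu
  have h2 : ∫ x, u x * u x ∂μ ≤ √C * √(∫ x, u x ^ 2 ∂μ) := by
    refine le_of_tendsto h1 (Eventually.of_forall fun k => ?_)
    refine (le_abs_self _).trans ((abs_integral_mul_le_sqrt (hS k) hu).trans ?_)
    exact mul_le_mul_of_nonneg_right (Real.sqrt_le_sqrt (hC k)) (Real.sqrt_nonneg _)
  simp only [← sq] at h2
  set I := ∫ x, u x ^ 2 ∂μ
  have hI : 0 ≤ I := integral_nonneg fun x => sq_nonneg _
  have h3 := Real.sq_sqrt hI
  have h4 := Real.sq_sqrt hC0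
  nlinarith [Real.sqrt_nonneg I, Real.sqrt_nonneg C, sq_nonneg (√I - √C)]

lemma contDiff_two_of_smooth {V : Type*} [NormedAddCommGroup V] [NormedSpace ℝ V] {g : V → ℝ}
    (hg : ContDiff ℝ ((⊤ : ℕ∞) : WithTop ℕ∞) g) : ContDiff ℝ 2 g :=
  hg.of_le (WithTop.coe_le_coe.2 (le_top : (2 : ℕ∞) ≤ ⊤))

lemma memLp_two_of_smooth {g : E3 → ℝ} (hg : ContDiff ℝ ((⊤ : ℕ∞) : WithTop ℕ∞) g)
    (hgc : HasCompactSupport g) : MemLp g 2 volume :=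
  memLp_two_of_hasCompactSupport hg.continuous hgc

/-- A measurable family of weak limits, at every time, for a family of functions whose pairings
with test functions have limits which are continuous in time. -/
lemma exists_measurable_slices (U : Ultrafilter ℕ) {S : ℕ → ℝ → E3 → ℝ} {C : ℝ}
    (hS : ∀ k t, MemLp (S k t) 2 volume) (hC : ∀ k t, ∫ x, S k t x ^ 2 ≤ C)
    {P : (E3 → ℝ) → ℝ → ℝ}
    (hP : ∀ g, ContDiff ℝ ((⊤ : ℕ∞) : WithTop ℕ∞) g → HasCompactSupport g → Continuous (P g))
    (hSP : ∀ g, ContDiff ℝ ((⊤ : ℕ∞) : WithTop ℕ∞) g → HasCompactSupport g →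
      ∀ t, 0 ≤ t → Tendsto (fun k => ∫ x, S k t x * g x) U (𝓝 (P g t))) :
    ∃ u : ℝ → E3 → ℝ, Measurable (Function.uncurry u) ∧ ∀ t, 0 ≤ t →
      MemLp (u t) 2 volume ∧ TendstoWeakL2 volume (fun k => S k t) U (u t) ∧
      (∫ x, u t x ^ 2 ≤ C) ∧
      ∀ g, ContDiff ℝ ((⊤ : ℕ∞) : WithTop ℕ∞) g → HasCompactSupport g →
        ∫ x, u t x * g x = P g t := by
  -- The ultrafilter gives a weak limit at each of uncountably many times, with no subsequence
  -- depending on the time.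
  choose w hw1 hw2 hw3 using fun t => exists_tendstoWeakL2_ultrafilter U (f := fun k => S k t)
    (fun k => hS k t) (fun k => hC k t)
  -- Zero at negative times, where nothing is known about the pairings; this keeps their dependence
  -- on time measurable.
  set w' : ℝ → E3 → ℝ := fun t => if 0 ≤ t then w t else 0 with hw'
  have hwg (t : ℝ) (ht : 0 ≤ t) (g : E3 → ℝ) (hg : ContDiff ℝ ((⊤ : ℕ∞) : WithTop ℕ∞) g)
      (hgc : HasCompactSupport g) : ∫ x, w t x * g x = P g t :=
    tendsto_nhds_unique (hw3 t g (memLp_two_of_smooth hg hgc)) (hSP g hg hgc t ht)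
  have hloc (t : ℝ) : LocallyIntegrable (w' t) := by
    by_cases ht : 0 ≤ t
    · simpa [hw', ht] using (hw2 t).locallyIntegrable (by norm_num)
    · have e : w' t = fun _ => 0 := by ext x; simp [hw', ht]
      rw [e]
      exact continuous_const.locallyIntegrable
  have hmeas (g : E3 → ℝ) (hg : ContDiff ℝ ((⊤ : ℕ∞) : WithTop ℕ∞) g) (hgc : HasCompactSupport g) :
      Measurable fun t => ∫ x, w' t x * g x := by
    have e : (fun t => ∫ x, w' t x * g x) = (Ici (0 : ℝ)).indicator (P g) := by
      ext t
      by_cases ht : 0 ≤ t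
      · simp [hw', ht, hwg t ht g hg hgc]
      · simp [hw', ht]
    rw [e]
    exact (hP g hg hgc).measurable.indicator measurableSet_Ici
  obtain ⟨u, hu, huw⟩ := exists_measurable_version hloc hmeas
  refine ⟨u, hu, fun t ht => ?_⟩
  have e : u t =ᵐ[volume] w t := by simpa [hw', ht] using huw t
  have hut : MemLp (u t) 2 volume := (memLp_congr_ae e).2 (hw2 t)
  have hUt : TendstoWeakL2 volume (fun k => S k t) U (u t) := by
    intro g hg
    have : ∫ x, u t x * g x = ∫ x, w t x * g x :=
      integral_congr_ae (by filter_upwards [e] with x hx; rw [hx])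
    rw [this]
    exact hw3 t g hg
  refine ⟨hut, hUt, hUt.integral_sq_le hut (fun k => hS k t) (fun k => hC k t),
    fun g hg hgc => ?_⟩
  rw [← hwg t ht g hg hgc]
  exact integral_congr_ae (by filter_upwards [e] with x hx; rw [hx])

lemma integral_diffQuot_mul {f g : E3 → ℝ} (hf : Continuous f) (hfc : HasCompactSupport f)
    (hg : Continuous g) (d : E3) (r : ℝ) :
    ∫ x, diffQuot d r f x * g x = - ∫ x, f x * diffQuot d (-r) g x := by
  have h1 : Integrable fun x => f x * g (x - r • d) :=
    (hf.fun_mul (by fun_prop : Continuous fun x => g (x - r • d))).integrable_of_hasCompactSupport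
      hfc.mul_right
  have h2 : Integrable fun x => f x * g x :=
    (hf.fun_mul hg).integrable_of_hasCompactSupport hfc.mul_right
  have h3 : Integrable fun x => f (x + r • d) * g x :=
    ((by fun_prop : Continuous fun x => f (x + r • d)).fun_mul hg).integrable_of_hasCompactSupport
      (hasCompactSupport_comp_add hfc _).mul_right
  have e1 : ∫ x, f (x + r • d) * g x = ∫ x, f x * g (x - r • d) := by
    have := integral_add_right_eq_self (μ := (volume : Measure E3))
      (fun x => f x * g (x - r • d)) (r • d)
    rw [← this]
    simp only [add_sub_cancel_right]
  have e2 (x : E3) : diffQuot d r f x * g x = r⁻¹ * (f (x + r • d) * g x - f x * g x) := by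
    simp only [diffQuot, smul_eq_mul]; ring
  have e3 (x : E3) : f x * diffQuot d (-r) g x = - r⁻¹ * (f x * g (x - r • d) - f x * g x) := by
    simp only [diffQuot, smul_eq_mul, neg_smul, ← sub_eq_add_neg, inv_neg]; ring
  simp only [e2, e3]
  rw [integral_const_mul, integral_const_mul, integral_sub h3 h2, integral_sub h1 h2, e1]
  ring

/-- The first grid time after `t`. -/
noncomputable def stepAfter (τ t : ℝ) : ℕ := ⌊t / τ⌋₊ + 1

lemma le_stepAfter_mul {τ : ℝ} (hτ : 0 < τ) (t : ℝ) : t ≤ stepAfter τ t * τ := by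
  rw [← div_le_iff₀ hτ, stepAfter]
  push_cast
  exact (Nat.lt_floor_add_one _).le

lemma floor_mul_le {τ t : ℝ} (hτ : 0 < τ) (ht : 0 ≤ t) : ⌊t / τ⌋₊ * τ ≤ t := by
  rw [← le_div_iff₀ hτ]
  exact Nat.floor_le (by positivity)

namespace ApproximatingVelocity

variable {v : ℝ × E3 → E3} {B : Fin 3 → ℝ} {h τ : ℕ → ℝ} {a : ℕ → ℕ → Fin 3 → E3 → ℝ} {t : ℝ}

lemma tendsto_stepAfter_mul (A : ApproximatingVelocity v B h τ a) (ht : 0 ≤ t) :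
    Tendsto (fun k => stepAfter (τ k) t * τ k) atTop (𝓝 t) := by
  have h1 : Tendsto (fun k => t + τ k) atTop (𝓝 t) := by simpa using A.tendsto_τ.const_add t
  refine tendsto_of_tendsto_of_tendsto_of_le_of_le tendsto_const_nhds h1
    (fun k => le_stepAfter_mul (A.stable k).τ_pos t) fun k => ?_
  have := floor_mul_le (A.stable k).τ_pos ht
  simp only [stepAfter]
  push_cast
  linarith

lemma tendsto_floor_mul (A : ApproximatingVelocity v B h τ a) (ht : 0 ≤ t) :
    Tendsto (fun k => (⌊t / τ k⌋₊ : ℝ) * τ k) atTop (𝓝 t) := by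
  have h1 : Tendsto (fun k => t - τ k) atTop (𝓝 t) := by simpa using A.tendsto_τ.const_sub t
  refine tendsto_of_tendsto_of_tendsto_of_le_of_le h1 tendsto_const_nhds (fun k => ?_)
    (fun k => floor_mul_le (A.stable k).τ_pos ht)
  have := le_stepAfter_mul (A.stable k).τ_pos t
  simp only [stepAfter] at this
  push_cast at this
  linarith

end ApproximatingVelocity

namespace SchemeLimit

variable {v : ℝ × E3 → E3} {B : Fin 3 → ℝ} {h τ : ℕ → ℝ} {a : ℕ → ℕ → Fin 3 → E3 → ℝ}
  {f : E3 → ℝ} {M : ℝ} {φ : ℝ × E3 → ℝ} {Dφ : Fin 3 → ℝ × E3 → ℝ}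

/-- The slices of the limit of the scheme: a representative which is defined at every time. -/
structure Slices (v : ℝ × E3 → E3) (h τ : ℕ → ℝ) (a : ℕ → ℕ → Fin 3 → E3 → ℝ) (f : E3 → ℝ) (M : ℝ)
    (B : Fin 3 → ℝ) (φ : ℝ × E3 → ℝ) (Dφ : Fin 3 → ℝ × E3 → ℝ) (U : Ultrafilter ℕ)
    (u : ℝ → E3 → ℝ) (w : Fin 3 → ℝ → E3 → ℝ) : Prop where
  measurable : Measurable (Function.uncurry u)
  measurable_grad : ∀ j, Measurable (Function.uncurry (w j))
  memLp : ∀ t, 0 ≤ t → MemLp (u t) 2 volume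
  memLp_grad : ∀ t, 0 ≤ t → ∀ j, MemLp (w j t) 2 volume
  integral_sq_le : ∀ t, 0 ≤ t → ∫ x, u t x ^ 2 ≤ ∫ x, f x ^ 2
  integral_sq_grad_le : ∀ t, 0 ≤ t → ∀ j,
    ∫ x, w j t x ^ 2 ≤ ApproximatingVelocity.energyBound B f M j
  tendsto : ∀ t, 0 ≤ t → TendstoWeakL2 volume
    (fun k => eulerScheme (h k) (τ k) (a k) f (stepAfter (τ k) t)) U (u t)
  tendsto_grad : ∀ t, 0 ≤ t → ∀ j, TendstoWeakL2 volume (fun k =>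
    diffQuot (stdVec j) (h k) (eulerScheme (h k) (τ k) (a k) f (stepAfter (τ k) t))) U (w j t)
  integral_mul : ∀ t, 0 ≤ t → ∀ g, ContDiff ℝ ((⊤ : ℕ∞) : WithTop ℕ∞) g → HasCompactSupport g →
    ∫ x, u t x * g x = pairing v f φ Dφ g t
  integral_grad_mul : ∀ t, 0 ≤ t → ∀ j g, ContDiff ℝ ((⊤ : ℕ∞) : WithTop ℕ∞) g →
    HasCompactSupport g → ∫ x, w j t x * g x = - ∫ x, u t x * fderiv ℝ g x (stdVec j)

lemma contDiff_fderiv_apply {V : Type*} [NormedAddCommGroup V] [NormedSpace ℝ V] {g : V → ℝ}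
    (hg : ContDiff ℝ ((⊤ : ℕ∞) : WithTop ℕ∞) g) (d : V) :
    ContDiff ℝ ((⊤ : ℕ∞) : WithTop ℕ∞) fun x => fderiv ℝ g x d :=
  (hg.fderiv_right (m := ((⊤ : ℕ∞) : WithTop ℕ∞)) (by norm_cast)).clm_apply contDiff_const

/-- Limits of the pairings are known for the solution from `tendsto_pairing`. For its difference
quotients they follow by moving the difference onto the test function, which also identifies the
limits as weak derivatives at each time. -/
lemma exists_slices (L : SchemeLimit v B h τ a f M φ Dφ) {U : Ultrafilter ℕ}
    (hU : (U : Filter ℕ) ≤ atTop) : ∃ u w, Slices v h τ a f M B φ Dφ U u w := by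
  have hfc := L.contDiff.continuous
  obtain ⟨u, hu, hut⟩ := exists_measurable_slices U (S := fun k t =>
    eulerScheme (h k) (τ k) (a k) f (stepAfter (τ k) t)) (C := ∫ x, f x ^ 2)
    (fun k t => L.memLp_eulerScheme hfc L.hasCompactSupport k _)
    (fun k t => (L.stable k).integral_sq_eulerScheme_le hfc L.hasCompactSupport _)
    (P := pairing v f φ Dφ) (fun g hg hgc => L.continuous_pairing (contDiff_two_of_smooth hg) hgc)
    (fun g hg hgc t ht => (L.tendsto_pairing (contDiff_two_of_smooth hg) hgc
      (L.tendsto_stepAfter_mul ht)).mono_left hU)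
  have hwj (j : Fin 3) := exists_measurable_slices U (S := fun k t => diffQuot (stdVec j) (h k)
    (eulerScheme (h k) (τ k) (a k) f (stepAfter (τ k) t)))
    (C := ApproximatingVelocity.energyBound B f M j)
    (fun k t => L.memLp_diffQuot_eulerScheme hfc L.hasCompactSupport k _ j)
    (fun k t => L.integral_sq_diffQuot_le_energyBound L.contDiff_one L.hasCompactSupport L.abs_le k _ j)
    (P := fun g t => - pairing v f φ Dφ (fun x => fderiv ℝ g x (stdVec j)) t)
    (fun g hg hgc => (L.continuous_pairing
      (contDiff_two_of_smooth (contDiff_fderiv_apply hg _)) (hgc.fderiv_apply ℝ _)).neg)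
    (fun g hg hgc t ht => by
      have hg1 : ContDiff ℝ 1 g := hg.of_le (mod_cast le_top)
      obtain ⟨R, hR⟩ := hgc.exists_tsupport_subset
      have hc := BoundedTendsto.diffQuot (μ := (volume : Measure E3)) (r := fun k => - h k)
        hg1 hgc hR (norm_stdVec j).le
        (by simpa using L.tendsto_h.neg) (fun k => neg_ne_zero.2 (L.stable k).h_pos.ne')
        (fun k => by rw [abs_neg]; exact abs_h_le L.toApproximatingVelocity k)
      have key := (hut t ht).2.1.tendsto_integral_mul
        (fun k => L.memLp_eulerScheme hfc L.hasCompactSupport k _)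
        (fun k => (L.stable k).integral_sq_eulerScheme_le hfc L.hasCompactSupport _)
        (hc.memLp_seq measurableSet_closedBall measure_closedBall_lt_top.ne)
        (hc.memLp_lim measurableSet_closedBall measure_closedBall_lt_top.ne)
        ((hc.integral_sub_sq_tendsto measurableSet_closedBall
          measure_closedBall_lt_top.ne).mono_left hU)
      rw [← (hut t ht).2.2.2 _ (contDiff_fderiv_apply hg _) (hgc.fderiv_apply ℝ _)]
      refine key.neg.congr fun k => ?_
      exact (integral_diffQuot_mul ((L.stable k).continuous_eulerScheme hfc _)
        (StableVelocity.hasCompactSupport_eulerScheme L.hasCompactSupport _) hg.continuous _ _).symm)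
  choose w hw hwt using hwj
  exact ⟨u, w, hu, hw, fun t ht => (hut t ht).1, fun t ht j => (hwt j t ht).1,
    fun t ht => (hut t ht).2.2.1, fun t ht j => (hwt j t ht).2.2.1, fun t ht => (hut t ht).2.1,
    fun t ht j => (hwt j t ht).2.1, fun t ht => (hut t ht).2.2.2,
    fun t ht j g hg hgc => by
      rw [(hwt j t ht).2.2.2 g hg hgc,
        (hut t ht).2.2.2 _ (contDiff_fderiv_apply hg _) (hgc.fderiv_apply ℝ _)]⟩

end SchemeLimit

/-! ### Agreement of the slices with the space-time limits -/

section TestSlices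

variable {Ψ : ℝ × E3 → ℝ} {R : ℝ}

lemma contDiff_slice {n : WithTop ℕ∞} (hΨ : ContDiff ℝ n Ψ) (s : ℝ) :
    ContDiff ℝ n fun x => Ψ (s, x) :=
  hΨ.comp (contDiff_const.prodMk contDiff_id)

lemma slice_eq_zero (hR : tsupport Ψ ⊆ Metric.closedBall 0 R) (s : ℝ) {x : E3}
    (hx : x ∉ Metric.closedBall (0 : E3) R) : Ψ (s, x) = 0 := by
  refine eq_zero_of_tsupport_subset hR ?_
  rw [mem_closedBall_zero_iff, not_le] at hx
  exact hx.trans_le (le_max_right _ _)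

lemma hasCompactSupport_slice (hc : HasCompactSupport Ψ) (s : ℝ) :
    HasCompactSupport fun x => Ψ (s, x) := by
  obtain ⟨R, hR⟩ := hc.exists_tsupport_subset
  exact HasCompactSupport.intro (isCompact_closedBall 0 R) fun x hx => slice_eq_zero hR s hx

lemma fderiv_slice (hΨ : ContDiff ℝ 1 Ψ) (s : ℝ) (x : E3) (j : Fin 3) :
    fderiv ℝ (fun x => Ψ (s, x)) x (stdVec j) = fderiv ℝ Ψ (s, x) (spaceDir j) := by
  have h1 := (hΨ.differentiable (by norm_num) (s, x)).hasFDerivAt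
  have h2 : HasFDerivAt (fun x => Ψ (s, x)) _ x := h1.comp x (hasFDerivAt_prodMk_right s x)
  rw [h2.fderiv]
  rfl

lemma diffQuot_spaceDir (j : Fin 3) (r s : ℝ) (x : E3) :
    diffQuot (spaceDir j) r Ψ (s, x) = diffQuot (stdVec j) r (fun x => Ψ (s, x)) x := by
  simp [diffQuot, spaceDir]

end TestSlices

lemma memLp_slab_of_forall_lintegral_le {F : ℝ × E3 → ℝ} (hF : Measurable F) {C T : ℝ}
    (h : ∀ s, 0 < s → ∫⁻ x, ‖F (s, x)‖ₑ ^ 2 ≤ ENNReal.ofReal C) : MemLp F 2 (slab T) := by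
  refine memLp_two_of_lintegral_le (C := |T| * |C|) hF.aestronglyMeasurable ?_
  rw [slab, lintegral_prod _ (hF.enorm.pow_const 2).aemeasurable]
  calc _ ≤ ∫⁻ s in Ioc 0 T, ENNReal.ofReal |C| :=
        setLIntegral_mono' measurableSet_Ioc fun s hs =>
          (h s hs.1).trans (ENNReal.ofReal_le_ofReal (le_abs_self C))
    _ ≤ _ := by
        rw [setLIntegral_const, Real.volume_Ioc, sub_zero, mul_comm,
          ENNReal.ofReal_mul (abs_nonneg _)]
        gcongr
        exact le_abs_self T

lemma memLp_slab_of_continuous {Ψ : ℝ × E3 → ℝ} (hΨ : Continuous Ψ) (hc : HasCompactSupport Ψ)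
    (T : ℝ) : MemLp Ψ 2 (slab T) := by
  have : IsFiniteMeasureOnCompacts (slab T) := by
    rw [slab_eq_restrict]; infer_instance
  exact hΨ.memLp_of_hasCompactSupport hc

lemma integral_slab_diffQuot_mul {τ : ℝ} (hτ : 0 < τ) {u : ℕ → E3 → ℝ} (hu : ∀ n, Continuous (u n))
    (huc : ∀ n, HasCompactSupport (u n)) {Ψ : ℝ × E3 → ℝ} (hΨ : Continuous Ψ)
    (hc : HasCompactSupport Ψ) (j : Fin 3) (r T : ℝ) :
    ∫ p : ℝ × E3, diffQuot (stdVec j) r (u ⌊p.1 / τ⌋₊) p.2 * Ψ p ∂slab T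
      = - ∫ p : ℝ × E3, u ⌊p.1 / τ⌋₊ p.2 * diffQuot (spaceDir j) (-r) Ψ p ∂slab T := by
  have hb {Θ : ℝ × E3 → ℝ} (hΘ : Continuous Θ) (hΘc : HasCompactSupport Θ) {w : ℕ → E3 → ℝ}
      (hw : ∀ n, Continuous (w n)) (hwc : ∀ n, HasCompactSupport (w n)) :
      Integrable (fun p : ℝ × E3 => w ⌊p.1 / τ⌋₊ p.2 * Θ p) (slab T) := by
    obtain ⟨C, hC⟩ := hΘc.exists_abs_le hΘ
    exact (integrable_comp_floor hτ hw hwc T).mul_bdd (c := C) hΘ.aestronglyMeasurable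
      (Eventually.of_forall hC)
  have hD : Continuous (diffQuot (spaceDir j) (-r) Ψ) := by unfold diffQuot; fun_prop
  have hDc : HasCompactSupport (diffQuot (spaceDir j) (-r) Ψ) := by
    unfold diffQuot
    exact ((hc.comp_homeomorph (Homeomorph.addRight _)).sub hc).mul_left (f := fun _ => (-r)⁻¹)
  have h1 := hb hΨ hc (w := fun n => diffQuot (stdVec j) r (u n))
    (fun n => continuous_diffQuot _ _ (hu n)) fun n => hasCompactSupport_diffQuot _ _ (huc n)
  have h2 := hb hD hDc hu huc
  rw [slab] at h1 h2 ⊢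
  rw [integral_prod _ h1, integral_prod _ h2, ← integral_neg]
  congr 1; ext s
  simp only [diffQuot_spaceDir]
  exact integral_diffQuot_mul (hu _) (huc _) (by fun_prop) _ _

namespace SchemeLimit

variable {v : ℝ × E3 → E3} {B : Fin 3 → ℝ} {h τ : ℕ → ℝ} {a : ℕ → ℕ → Fin 3 → E3 → ℝ}
  {f : E3 → ℝ} {M : ℝ} {φ : ℝ × E3 → ℝ} {Dφ : Fin 3 → ℝ × E3 → ℝ} {U : Ultrafilter ℕ}
  {u : ℝ → E3 → ℝ} {w : Fin 3 → ℝ → E3 → ℝ} {Ψ : ℝ × E3 → ℝ}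

lemma Slices.memLp_uncurry (S : Slices v h τ a f M B φ Dφ U u w) (T : ℝ) :
    MemLp (Function.uncurry u) 2 (slab T) :=
  memLp_slab_of_forall_lintegral_le S.measurable fun s hs => by
    simp only [Function.uncurry_apply_pair]
    rw [lintegral_enorm_sq_eq_ofReal_integral (S.memLp s hs.le)]
    exact ENNReal.ofReal_le_ofReal (S.integral_sq_le s hs.le)

lemma Slices.memLp_uncurry_grad (S : Slices v h τ a f M B φ Dφ U u w) (j : Fin 3) (T : ℝ) :
    MemLp (Function.uncurry (w j)) 2 (slab T) :=
  memLp_slab_of_forall_lintegral_le (S.measurable_grad j) fun s hs => by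
    simp only [Function.uncurry_apply_pair]
    rw [lintegral_enorm_sq_eq_ofReal_integral (S.memLp_grad s hs.le j)]
    exact ENNReal.ofReal_le_ofReal (S.integral_sq_grad_le s hs.le j)

/-- Fubini reduces the claim to pairings at fixed time, and the maximum principle supplies the
domination in time. -/
lemma integral_mul_eq_of_slices (L : SchemeLimit v B h τ a f M φ Dφ)
    (S : Slices v h τ a f M B φ Dφ U u w) (hΨ : ContDiff ℝ ((⊤ : ℕ∞) : WithTop ℕ∞) Ψ)
    (hc : HasCompactSupport Ψ) (T : ℝ) :
    ∫ p, φ p * Ψ p ∂slab T = ∫ p, Function.uncurry u p * Ψ p ∂slab T := by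
  obtain ⟨R, hR⟩ := hc.exists_tsupport_subset
  obtain ⟨D, hD⟩ := hc.exists_abs_le hΨ.continuous
  have hΨ2 := memLp_slab_of_continuous hΨ.continuous hc T
  have h1 := L.tendsto_field T Ψ hΨ2
  have hi (k : ℕ) : Integrable (fun p => schemeField (h k) (τ k) (a k) f p * Ψ p) (slab T) :=
    (L.memLp_schemeField T k).1.integrable_mul hΨ2
  have hiu : Integrable (fun p => Function.uncurry u p * Ψ p) (slab T) :=
    (S.memLp_uncurry T).integrable_mul hΨ2
  refine tendsto_nhds_unique h1 ?_
  rw [slab] at hi hiu ⊢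
  rw [integral_prod _ hiu]
  simp only [integral_prod _ (hi _)]
  refine tendsto_integral_of_dominated_convergence
    (fun _ => M * D * (volume : Measure E3).real (Metric.closedBall 0 R))
    (fun k => (hi k).integral_prod_left.aestronglyMeasurable) (integrable_const _)
    (fun k => Eventually.of_forall fun s => ?_) ?_
  · rw [← setIntegral_eq_integral_of_forall_compl_eq_zero (s := Metric.closedBall (0 : E3) R)
      fun x hx => by rw [slice_eq_zero hR s hx, mul_zero]]
    refine norm_setIntegral_le_of_norm_le_const measure_closedBall_lt_top fun x _ => ?_
    rw [norm_mul]
    exact mul_le_mul ((L.stable k).abs_eulerScheme_le L.abs_le _ x) (hD _) (norm_nonneg _)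
      ((abs_nonneg _).trans (L.abs_le 0))
  · filter_upwards [ae_restrict_mem measurableSet_Ioc] with s hs
    simp only [Function.uncurry_apply_pair]
    rw [S.integral_mul s hs.1.le _ (contDiff_slice hΨ s) (hasCompactSupport_slice hc s)]
    -- The space-time field uses the grid time below `s` and the slices the one above; both tend to
    -- `s`, so the pairings have the same limit.
    exact L.tendsto_pairing (contDiff_two_of_smooth (contDiff_slice hΨ s))
      (hasCompactSupport_slice hc s) (L.tendsto_floor_mul hs.1.le)

lemma boundedTendsto_backward (A : ApproximatingVelocity v B h τ a)
    (hΨ : ContDiff ℝ 1 Ψ) (hc : HasCompactSupport Ψ) {R : ℝ}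
    (hR : tsupport Ψ ⊆ Metric.closedBall 0 R) (j : Fin 3) (μ : Measure (ℝ × E3)) :
    BoundedTendsto μ (univ ×ˢ Metric.closedBall (0 : E3) (R + 2))
      (fun k => diffQuot (spaceDir j) (-h k) Ψ) (fun p => fderiv ℝ Ψ p (spaceDir j)) := by
  refine (BoundedTendsto.diffQuot hΨ hc hR (norm_spaceDir j).le
    (by simpa using A.tendsto_h.neg) (fun k => neg_ne_zero.2 (A.stable k).h_pos.ne')
    (fun k => by rw [abs_neg]; exact abs_h_le A k)).mono_set fun p hp => ⟨mem_univ _, ?_⟩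
  rw [mem_closedBall_zero_iff] at hp ⊢
  exact (norm_snd_le p).trans hp

lemma integral_grad_mul (L : SchemeLimit v B h τ a f M φ Dφ)
    (hΨ : ContDiff ℝ ((⊤ : ℕ∞) : WithTop ℕ∞) Ψ)
    (hc : HasCompactSupport Ψ) (T : ℝ) (j : Fin 3) :
    ∫ p, Dφ j p * Ψ p ∂slab T = - ∫ p, φ p * fderiv ℝ Ψ p (spaceDir j) ∂slab T := by
  obtain ⟨R, hR⟩ := hc.exists_tsupport_subset
  have h1 := L.tendsto_grad j T Ψ (memLp_slab_of_continuous hΨ.continuous hc T)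
  have h2 := (L.tendsto_integral_field (T := T) (boundedTendsto_backward L.toApproximatingVelocity
    (hΨ.of_le (mod_cast le_top)) hc hR j _)).neg
  refine tendsto_nhds_unique h1 (h2.congr fun k => ?_)
  exact (integral_slab_diffQuot_mul (L.stable k).τ_pos
    (fun n => (L.stable k).continuous_eulerScheme L.contDiff.continuous n)
    (fun n => StableVelocity.hasCompactSupport_eulerScheme L.hasCompactSupport n) hΨ.continuous hc
    j (h k) T).symm

lemma Slices.integral_uncurry_grad_mul (S : Slices v h τ a f M B φ Dφ U u w)
    (hΨ : ContDiff ℝ ((⊤ : ℕ∞) : WithTop ℕ∞) Ψ)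
    (hc : HasCompactSupport Ψ) (T : ℝ) (j : Fin 3) :
    ∫ p, Function.uncurry (w j) p * Ψ p ∂slab T
      = - ∫ p, Function.uncurry u p * fderiv ℝ Ψ p (spaceDir j) ∂slab T := by
  have hΨ1 : ContDiff ℝ 1 Ψ := hΨ.of_le (mod_cast le_top)
  have h1 : Integrable (fun p => Function.uncurry (w j) p * Ψ p) (slab T) :=
    (S.memLp_uncurry_grad j T).integrable_mul (memLp_slab_of_continuous hΨ.continuous hc T)
  have h2 : Integrable (fun p => Function.uncurry u p * fderiv ℝ Ψ p (spaceDir j)) (slab T) :=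
    (S.memLp_uncurry T).integrable_mul (memLp_slab_of_continuous
      (continuous_fderiv_apply hΨ1 _) (hc.fderiv_apply ℝ _) T)
  rw [slab] at h1 h2 ⊢
  rw [integral_prod _ h1, integral_prod _ h2, ← integral_neg]
  refine setIntegral_congr_fun measurableSet_Ioc fun s hs => ?_
  simp only [Function.uncurry_apply_pair]
  rw [S.integral_grad_mul s hs.1.le j _ (contDiff_slice hΨ s) (hasCompactSupport_slice hc s)]
  simp only [fderiv_slice hΨ1]

lemma locallyIntegrable_slab {F : ℝ × E3 → ℝ} {T : ℝ} (hF : MemLp F 2 (slab T)) :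
    LocallyIntegrable F (slab T) := by
  have : IsLocallyFiniteMeasure (slab T) := by
    rw [slab_eq_restrict]; infer_instance
  exact hF.locallyIntegrable (by norm_num)

lemma ae_eq_uncurry (L : SchemeLimit v B h τ a f M φ Dφ)
    (S : Slices v h τ a f M B φ Dφ U u w) (T : ℝ) : φ =ᵐ[slab T] Function.uncurry u := by
  refine ae_eq_of_integral_contDiff_smul_eq (locallyIntegrable_slab (L.memLp T))
    (locallyIntegrable_slab (S.memLp_uncurry T)) fun Ψ hΨ hc => ?_
  simpa only [smul_eq_mul, mul_comm] using L.integral_mul_eq_of_slices S hΨ hc T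

lemma ae_eq_uncurry_grad (L : SchemeLimit v B h τ a f M φ Dφ)
    (S : Slices v h τ a f M B φ Dφ U u w) (j : Fin 3) (T : ℝ) :
    Dφ j =ᵐ[slab T] Function.uncurry (w j) := by
  refine ae_eq_of_integral_contDiff_smul_eq (locallyIntegrable_slab (L.memLp_grad j T))
    (locallyIntegrable_slab (S.memLp_uncurry_grad j T)) fun Ψ hΨ hc => ?_
  have h1 := L.integral_grad_mul hΨ hc T j
  rw [L.integral_mul_eq_of_slices S (contDiff_fderiv_apply hΨ _) (hc.fderiv_apply ℝ _),
    ← S.integral_uncurry_grad_mul hΨ hc T j] at h1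
  simpa only [smul_eq_mul, mul_comm] using h1

end SchemeLimit

lemma TendstoWeakL2.congr_lim {α : Type*} [MeasurableSpace α] {μ : Measure α} {l : Filter ℕ}
    {S : ℕ → α → ℝ} {u w : α → ℝ} (h : TendstoWeakL2 μ S l u) (huw : u =ᵐ[μ] w) :
    TendstoWeakL2 μ S l w := by
  intro g hg
  have : ∫ x, w x * g x ∂μ = ∫ x, u x * g x ∂μ :=
    integral_congr_ae (by filter_upwards [huw] with x hx; rw [hx])
  rw [this]
  exact h g hg

namespace SchemeLimit

variable {v : ℝ × E3 → E3} {B : Fin 3 → ℝ} {h τ : ℕ → ℝ} {a : ℕ → ℕ → Fin 3 → E3 → ℝ}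
  {f : E3 → ℝ} {M : ℝ} {φ : ℝ × E3 → ℝ} {Dφ : Fin 3 → ℝ × E3 → ℝ} {U : Ultrafilter ℕ}
  {u : ℝ → E3 → ℝ} {w : Fin 3 → ℝ → E3 → ℝ}

/-- Allows the slices to replace the space-time limits, so that from here on the solution and its
gradient are defined at every time. -/
lemma of_slices (L : SchemeLimit v B h τ a f M φ Dφ) (S : Slices v h τ a f M B φ Dφ U u w) :
    SchemeLimit v B h τ a f M (Function.uncurry u) fun j => Function.uncurry (w j) :=
  { L with
    memLp := S.memLp_uncurry
    memLp_grad := S.memLp_uncurry_grad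
    tendsto_field := fun T => (L.tendsto_field T).congr_lim (L.ae_eq_uncurry S T)
    tendsto_grad := fun i T => (L.tendsto_grad i T).congr_lim (L.ae_eq_uncurry_grad S i T) }

lemma pairing_congr (L : SchemeLimit v B h τ a f M φ Dφ) (S : Slices v h τ a f M B φ Dφ U u w)
    (g : E3 → ℝ) (t : ℝ) : pairing v f φ Dφ g t
      = pairing v f (Function.uncurry u) (fun j => Function.uncurry (w j)) g t := by
  unfold pairing
  congr 1
  refine integral_congr_ae ?_
  have h1 : ∀ᵐ p ∂slab t, ∀ j, Dφ j p = Function.uncurry (w j) p :=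
    ae_all_iff.2 fun j => L.ae_eq_uncurry_grad S j t
  filter_upwards [L.ae_eq_uncurry S t, h1] with p hp hp'
  simp only [hp, hp']

lemma slices_of_slices (L : SchemeLimit v B h τ a f M φ Dφ) (S : Slices v h τ a f M B φ Dφ U u w) :
    Slices v h τ a f M B (Function.uncurry u) (fun j => Function.uncurry (w j)) U u w :=
  { S with
    integral_mul := fun t ht g hg hgc => by
      rw [S.integral_mul t ht g hg hgc, L.pairing_congr S] }

end SchemeLimit

/-! ### Second derivatives, energy inequality and sup bound in the limit -/

lemma TendstoWeakL2.restrict {α : Type*} [MeasurableSpace α] {μ : Measure α} {l : Filter ℕ}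
    {S : ℕ → α → ℝ} {u : α → ℝ} (h : TendstoWeakL2 μ S l u) {s : Set α} (hs : MeasurableSet s) :
    TendstoWeakL2 (μ.restrict s) S l u := by
  intro g hg
  have h1 := h (s.indicator g) ((memLp_indicator_iff_restrict hs).2 hg)
  have e (w : α → ℝ) : ∫ x, w x * s.indicator g x ∂μ = ∫ x in s, w x * g x ∂μ := by
    rw [← integral_indicator hs]
    congr 1; ext x
    by_cases hx : x ∈ s <;> simp [hx]
  simpa only [e] using h1

/-- A minorant of the squared norm which is affine in `S` and therefore converges under weak
convergence; at `S = u` it equals the squared norm of `u`. It replaces limits inferior in the energy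
inequality. -/
lemma two_mul_integral_sub_le {α : Type*} [MeasurableSpace α] {μ : Measure α} {S u : α → ℝ}
    (hS : MemLp S 2 μ) (hu : MemLp u 2 μ) :
    2 * (∫ x, S x * u x ∂μ) - ∫ x, u x ^ 2 ∂μ ≤ ∫ x, S x ^ 2 ∂μ := by
  have h1 : Integrable (fun x => S x * u x) μ := hS.integrable_mul hu
  have h2 : 0 ≤ ∫ x, (S x ^ 2 - 2 * (S x * u x) + u x ^ 2) ∂μ :=
    integral_nonneg fun x => by
      have : S x ^ 2 - 2 * (S x * u x) + u x ^ 2 = (S x - u x) ^ 2 := by ring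
      simp only [this, Pi.zero_apply]
      positivity
  have h3 : Integrable (fun x => S x ^ 2 - 2 * (S x * u x)) μ :=
    hS.integrable_sq.sub (h1.const_mul 2)
  rw [integral_add h3 hu.integrable_sq,
    integral_sub hS.integrable_sq (h1.const_mul 2), integral_const_mul] at h2
  linarith

namespace SchemeLimit

variable {v : ℝ × E3 → E3} {B : Fin 3 → ℝ} {h τ : ℕ → ℝ} {a : ℕ → ℕ → Fin 3 → E3 → ℝ}
  {f : E3 → ℝ} {M : ℝ} {φ : ℝ × E3 → ℝ} {Dφ : Fin 3 → ℝ × E3 → ℝ} {U : Ultrafilter ℕ}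
  {u : ℝ → E3 → ℝ} {w : Fin 3 → ℝ → E3 → ℝ} {Ψ : ℝ × E3 → ℝ}

/-- Summed over all time steps the dissipation stays bounded, hence a bound on the whole half
space-time; the factor 2 undoes the `1 / 2` in `energy_le_energyBound`. -/
lemma lintegral_schemeHess_le (L : SchemeLimit v B h τ a f M φ Dφ) (k : ℕ) (i j : Fin 3) :
    ∫⁻ p, ‖schemeHess (h k) (τ k) (a k) f i j p‖ₑ ^ 2 ∂halfSpaceTime
      ≤ ENNReal.ofReal (2 * ApproximatingVelocity.energyBound B f M j) := by
  have hm := (L.stable k).measurable_schemeHess L.contDiff.continuous i j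
  have hτ := (L.stable k).τ_pos
  have hL2 (n : ℕ) (i : Fin 3) := L.memLp_diffQuot_diffQuot_eulerScheme L.contDiff.continuous
    L.hasCompactSupport k n i j
  rw [halfSpaceTime, lintegral_prod _ (hm.enorm.pow_const 2).aemeasurable]
  simp only [schemeHess]
  rw [lintegral_Ioi_eq_tsum hτ]
  have e (n : ℕ) := lintegral_const_timeStep n (fun n => ∫⁻ x, ‖diffQuot (stdVec i) (h k)
    (diffQuot (stdVec j) (h k) (eulerScheme (h k) (τ k) (a k) f n)) x‖ₑ ^ 2) hτ
  simp only [fun n => lintegral_enorm_sq_eq_ofReal_integral (hL2 n i)] at e ⊢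
  simp only [e]
  refine ENNReal.tsum_le_of_sum_range_le fun N => ?_
  simp only [← ENNReal.ofReal_mul hτ.le]
  rw [← ENNReal.ofReal_sum_of_nonneg fun n _ =>
    mul_nonneg hτ.le (integral_nonneg fun x => sq_nonneg _)]
  refine ENNReal.ofReal_le_ofReal ?_
  have h1 := L.energy_le_energyBound L.contDiff_one L.hasCompactSupport L.abs_le k N j
  have h2 : 0 ≤ ∫ x, diffQuot (stdVec j) (h k) (eulerScheme (h k) (τ k) (a k) f N) x ^ 2 :=
    integral_nonneg fun x => sq_nonneg _
  have h3 : ∑ n ∈ Finset.range N, τ k * ∫ x, diffQuot (stdVec i) (h k)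
      (diffQuot (stdVec j) (h k) (eulerScheme (h k) (τ k) (a k) f n)) x ^ 2
      ≤ ∑ n ∈ Finset.range N, τ k * ∑ i, ∫ x, diffQuot (stdVec i) (h k)
      (diffQuot (stdVec j) (h k) (eulerScheme (h k) (τ k) (a k) f n)) x ^ 2 := by
    refine Finset.sum_le_sum fun n _ => mul_le_mul_of_nonneg_left ?_ hτ.le
    exact Finset.single_le_sum (f := fun i => ∫ x, diffQuot (stdVec i) (h k)
      (diffQuot (stdVec j) (h k) (eulerScheme (h k) (τ k) (a k) f n)) x ^ 2)
      (fun i _ => integral_nonneg fun x => sq_nonneg _) (Finset.mem_univ i)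
  linarith

lemma memLp_schemeHess (L : SchemeLimit v B h τ a f M φ Dφ) (k : ℕ) (i j : Fin 3) :
    MemLp (schemeHess (h k) (τ k) (a k) f i j) 2 halfSpaceTime :=
  memLp_two_of_lintegral_le
    ((L.stable k).measurable_schemeHess L.contDiff.continuous i j).aestronglyMeasurable
    (L.lintegral_schemeHess_le k i j)

lemma exists_hess (L : SchemeLimit v B h τ a f M φ Dφ) (U : Ultrafilter ℕ) :
    ∃ z : Fin 3 → Fin 3 → ℝ × E3 → ℝ, ∀ i j, StronglyMeasurable (z i j) ∧
      MemLp (z i j) 2 halfSpaceTime ∧ TendstoWeakL2 halfSpaceTime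
        (fun k => schemeHess (h k) (τ k) (a k) f i j) U (z i j) := by
  choose z hz using fun i j => exists_tendstoWeakL2_ultrafilter U
    (f := fun k => schemeHess (h k) (τ k) (a k) f i j) (fun k => L.memLp_schemeHess k i j)
    (fun k => integral_sq_le_of_lintegral_le (L.memLp_schemeHess k i j).1
      (by linarith [L.energyBound_nonneg f M j]) (L.lintegral_schemeHess_le k i j))
  exact ⟨z, hz⟩

lemma integral_hess_mul (L : SchemeLimit v B h τ a f M φ Dφ) (hU : (U : Filter ℕ) ≤ atTop)
    {i j : Fin 3} {z : ℝ × E3 → ℝ}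
    (hz : TendstoWeakL2 halfSpaceTime (fun k => schemeHess (h k) (τ k) (a k) f i j) U z)
    (hΨ : ContDiff ℝ ((⊤ : ℕ∞) : WithTop ℕ∞) Ψ) (hc : HasCompactSupport Ψ) (T : ℝ) :
    ∫ p, z p * Ψ p ∂slab T = - ∫ p, Dφ j p * fderiv ℝ Ψ p (spaceDir i) ∂slab T := by
  obtain ⟨R, hR⟩ := hc.exists_tsupport_subset
  have hz' : TendstoWeakL2 (slab T) (fun k => schemeHess (h k) (τ k) (a k) f i j) U z := by
    rw [slab_eq_restrict_halfSpaceTime]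
    exact hz.restrict (measurableSet_Iic.prod MeasurableSet.univ)
  have h1 := hz' Ψ (memLp_slab_of_continuous hΨ.continuous hc T)
  have h2 := ((L.tendsto_integral_grad (T := T) (boundedTendsto_backward L.toApproximatingVelocity
    (hΨ.of_le (mod_cast le_top)) hc hR i _) j).neg).mono_left hU
  refine tendsto_nhds_unique h1 (h2.congr fun k => ?_)
  exact (integral_slab_diffQuot_mul (L.stable k).τ_pos
    (u := fun n => diffQuot (stdVec j) (h k) (eulerScheme (h k) (τ k) (a k) f n))
    (fun n => continuous_diffQuot _ _
      ((L.stable k).continuous_eulerScheme L.contDiff.continuous n))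
    (fun n => hasCompactSupport_diffQuot _ _
      (StableVelocity.hasCompactSupport_eulerScheme L.hasCompactSupport n)) hΨ.continuous hc
    i (h k) T).symm

lemma integral_sq_schemeHess_le_sum (L : SchemeLimit v B h τ a f M φ Dφ) (k N : ℕ) (j : Fin 3)
    {t : ℝ} (ht : t ≤ N * τ k) :
    ∑ i, ∫ p, schemeHess (h k) (τ k) (a k) f i j p ^ 2 ∂slab t
      ≤ ∑ n ∈ Finset.range N, τ k * ∑ i, ∫ x, diffQuot (stdVec i) (h k)
      (diffQuot (stdVec j) (h k) (eulerScheme (h k) (τ k) (a k) f n)) x ^ 2 := by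
  simp only [Finset.mul_sum]
  rw [Finset.sum_comm]
  refine Finset.sum_le_sum fun i _ => ?_
  have hfc := L.contDiff.continuous
  rw [← integral_slab_comp_floor (L.stable k).τ_pos (u := fun n x => diffQuot (stdVec i) (h k)
      (diffQuot (stdVec j) (h k) (eulerScheme (h k) (τ k) (a k) f n)) x ^ 2)]
  · refine integral_mono_measure (slab_mono ht) (Eventually.of_forall fun p => sq_nonneg _) ?_
    exact ((L.memLp_schemeHess k i j).mono_measure (slab_le_halfSpaceTime _)).integrable_sq
  · exact fun n => (continuous_diffQuot _ _ (continuous_diffQuot _ _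
      ((L.stable k).continuous_eulerScheme hfc n))).pow 2
  · intro n
    have h1 := hasCompactSupport_diffQuot (stdVec i) (h k) (hasCompactSupport_diffQuot (stdVec j)
      (h k) (StableVelocity.hasCompactSupport_eulerScheme (h := h k) (τ := τ k) (a := a k)
        L.hasCompactSupport n))
    simp only [sq]
    exact h1.mul_right

/-- The energy inequality for the limit. -/
lemma energy_limit (L : SchemeLimit v B h τ a f M φ Dφ) (S : Slices v h τ a f M B φ Dφ U u w)
    (hU : (U : Filter ℕ) ≤ atTop) {z : Fin 3 → Fin 3 → ℝ × E3 → ℝ}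
    (hz2 : ∀ i j, MemLp (z i j) 2 halfSpaceTime)
    (hz : ∀ i j, TendstoWeakL2 halfSpaceTime (fun k => schemeHess (h k) (τ k) (a k) f i j) U (z i j))
    {t : ℝ} (ht : 0 ≤ t) (j : Fin 3) :
    (∫ x, w j t x ^ 2) + ∑ i, ∫ p, z i j p ^ 2 ∂slab t
      ≤ (∫ x, fderiv ℝ f x (stdVec j) ^ 2) + M ^ 2 * B j := by
  have hz2' (i : Fin 3) : MemLp (z i j) 2 (slab t) := (hz2 i j).mono_measure (slab_le_halfSpaceTime t)
  have hz' (i : Fin 3) :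
      TendstoWeakL2 (slab t) (fun k => schemeHess (h k) (τ k) (a k) f i j) U (z i j) := by
    rw [slab_eq_restrict_halfSpaceTime]
    exact (hz i j).restrict (measurableSet_Iic.prod MeasurableSet.univ)
  have hε : Tendsto (fun k => 54 * τ k / h k ^ 2) U (𝓝 0) := by
    have h1 := (L.tendsto_ratio.const_mul 54).mono_left hU
    simp only [mul_zero] at h1
    exact h1.congr fun k => (mul_div_assoc _ _ _).symm
  -- Affine minorants of all the squared norms are passed to the limit together, with the factors `1
  -- ± 54 τ / h²` tending to one.
  have hl1 := ((S.tendsto_grad t ht j _ (S.memLp_grad t ht j)).const_mul 2).sub_const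
    (∫ x, w j t x ^ 2)
  have hl2 := tendsto_finsetSum Finset.univ fun (i : Fin 3) _ =>
    ((hz' i _ (hz2' i)).const_mul 2).sub_const (∫ p, z i j p ^ 2 ∂slab t)
  have hl := hl1.add ((hε.const_sub 1).mul hl2)
  have hr := (((hε.const_add 1).mul_const (M ^ 2)).mul_const (B j)).const_add
    (∫ x, fderiv ℝ f x (stdVec j) ^ 2)
  have key := le_of_tendsto_of_tendsto' hl hr fun k => ?_
  · simp only [sub_zero, one_mul, add_zero] at key
    have e1 : ∫ x, w j t x * w j t x = ∫ x, w j t x ^ 2 := by simp only [sq]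
    have e2 (i : Fin 3) : 2 * (∫ p, z i j p * z i j p ∂slab t) - ∫ p, z i j p ^ 2 ∂slab t
        = ∫ p, z i j p ^ 2 ∂slab t := by simp only [← sq]; ring
    rw [e1] at key
    simp only [e2] at key
    linarith
  · set N := stepAfter (τ k) t
    refine le_trans ?_ (L.energy_le L.contDiff_one L.hasCompactSupport L.abs_le k N j)
    have hw := two_mul_integral_sub_le (L.memLp_diffQuot_eulerScheme L.contDiff.continuous
      L.hasCompactSupport k N j) (S.memLp_grad t ht j)
    have hzz : ∑ i, (2 * (∫ p, schemeHess (h k) (τ k) (a k) f i j p * z i j p ∂slab t)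
        - ∫ p, z i j p ^ 2 ∂slab t)
        ≤ ∑ n ∈ Finset.range N, τ k * ∑ i, ∫ x, diffQuot (stdVec i) (h k)
          (diffQuot (stdVec j) (h k) (eulerScheme (h k) (τ k) (a k) f n)) x ^ 2 := by
      refine le_trans (Finset.sum_le_sum fun i _ => two_mul_integral_sub_le
        ((L.memLp_schemeHess k i j).mono_measure (slab_le_halfSpaceTime t)) (hz2' i)) ?_
      -- Stopping at the first grid time after `t` makes the dissipation sum cover the whole slab up
      -- to `t`.
      exact L.integral_sq_schemeHess_le_sum k N j (le_stepAfter_mul (L.stable k).τ_pos t)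
    have h1 := (L.stable k).one_sub_pos
    exact add_le_add hw (mul_le_mul_of_nonneg_left hzz (by linarith))

/-- The sup bound is rewritten by duality as a bound on pairings with test functions, which survives
weak limits. -/
lemma ae_abs_slice_le (L : SchemeLimit v B h τ a f M φ Dφ)
    (S : Slices v h τ a f M B φ Dφ U u w) {t : ℝ} (ht : 0 ≤ t) : ∀ᵐ x, |u t x| ≤ M := by
  refine ae_abs_le_of_integral_le ((S.memLp t ht).locallyIntegrable (by norm_num))
    fun g hg hgc => ?_
  refine le_of_tendsto (S.tendsto t ht g (memLp_two_of_smooth hg hgc)).abs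
    (Eventually.of_forall fun k => ?_)
  rw [← integral_const_mul]
  refine abs_integral_le_integral_abs.trans (integral_mono_of_nonneg
    (Eventually.of_forall fun x => abs_nonneg _) ?_ (Eventually.of_forall fun x => ?_))
  · exact ((hg.continuous.integrable_of_hasCompactSupport hgc).abs).const_mul M
  · simp only [abs_mul]
    exact mul_le_mul_of_nonneg_right ((L.stable k).abs_eulerScheme_le L.abs_le _ x) (abs_nonneg _)

end SchemeLimit

/-! ### The equation in the sense of distributions on space-time -/

lemma integrable_comp_floor_mul {τ : ℝ} (hτ : 0 < τ) {u : ℕ → E3 → ℝ} (hu : ∀ n, Continuous (u n))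
    (huc : ∀ n, HasCompactSupport (u n)) {Ψ : ℝ × E3 → ℝ} (hΨ : Continuous Ψ)
    (hc : HasCompactSupport Ψ) (T : ℝ) :
    Integrable (fun p : ℝ × E3 => u ⌊p.1 / τ⌋₊ p.2 * Ψ p) (slab T) := by
  obtain ⟨C, hC⟩ := hc.exists_abs_le hΨ
  exact (integrable_comp_floor hτ hu huc T).mul_bdd (c := C) hΨ.aestronglyMeasurable
    (Eventually.of_forall hC)

lemma sub_smul_timeDir (s τ : ℝ) (x : E3) : (s, x) + (-τ) • timeDir = (s - τ, x) := by
  simp [timeDir, sub_eq_add_neg]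

/-- Shifting the time variable by one step of the scheme. -/
lemma integral_slab_succ_mul {τ T : ℝ} (hτ : 0 < τ) (hτ1 : τ ≤ 1) {u : ℕ → E3 → ℝ}
    (hu : ∀ n, Continuous (u n)) (huc : ∀ n, HasCompactSupport (u n)) {Ψ : ℝ × E3 → ℝ}
    (hΨ : Continuous Ψ) (hc : HasCompactSupport Ψ) (h0 : ∀ p : ℝ × E3, p.1 ≤ 0 → Ψ p = 0)
    (hT : ∀ p : ℝ × E3, T - 1 < p.1 → Ψ p = 0) :
    ∫ p : ℝ × E3, u (⌊p.1 / τ⌋₊ + 1) p.2 * Ψ p ∂slab T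
      = ∫ p : ℝ × E3, u ⌊p.1 / τ⌋₊ p.2 * Ψ (p + (-τ) • timeDir) ∂slab T := by
  have hΨ' : Continuous fun p : ℝ × E3 => Ψ (p + (-τ) • timeDir) := by fun_prop
  have hc' : HasCompactSupport fun p : ℝ × E3 => Ψ (p + (-τ) • timeDir) :=
    hc.comp_homeomorph (Homeomorph.addRight _)
  have h1 := integrable_comp_floor_mul hτ (u := fun n => u (n + 1)) (fun n => hu _) (fun n => huc _)
    hΨ hc T
  have h2 := integrable_comp_floor_mul hτ hu huc hΨ' hc' T
  rw [slab] at h1 h2 ⊢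
  rw [integral_prod _ h1, integral_prod _ h2]
  simp only [sub_smul_timeDir]
  set G : ℝ → ℝ := fun s => ∫ x, u ⌊s / τ⌋₊ x * Ψ (s - τ, x) with hG
  -- For `s ≤ 0` the natural-number floor need not advance by one, but `Ψ` vanishes there.
  have e (s : ℝ) : ∫ x, u (⌊s / τ⌋₊ + 1) x * Ψ (s, x) = G (s + τ) := by
    rcases le_or_gt s 0 with hs | hs
    · simp only [hG, add_sub_cancel_right]
      simp [h0 (s, _) hs]
    · simp only [hG, add_sub_cancel_right]
      rw [add_div, div_self hτ.ne', Nat.floor_add_one (by positivity)]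
  simp only [e]
  -- Both integrands vanish outside `(0, T]`: the margin `T - 1` leaves room for the shift by `τ ≤
  -- 1`. The integrals then extend to the real line, where translation is free.
  rw [setIntegral_eq_integral_of_forall_compl_eq_zero (fun s hs => ?_),
    setIntegral_eq_integral_of_forall_compl_eq_zero (fun s hs => ?_),
    integral_add_right_eq_self G τ]
  · simp only [mem_Ioc, not_and_or, not_lt, not_le] at hs
    refine integral_eq_zero_of_ae (Eventually.of_forall fun x => ?_)
    rcases hs with hs | hs
    · simp [h0 (s - τ, x) (by simp only; linarith)]
    · simp [hT (s - τ, x) (by simp only; linarith)]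
  · simp only [mem_Ioc, not_and_or, not_lt, not_le] at hs
    refine integral_eq_zero_of_ae (Eventually.of_forall fun x => ?_)
    simp only [add_sub_cancel_right]
    rcases hs with hs | hs
    · simp [h0 (s, x) hs]
    · simp [hT (s, x) (by simp only; linarith)]

/-- The weak form of the scheme on space-time. -/
lemma StableVelocity.integral_diffQuot_timeDir {h τ T : ℝ} {a : ℕ → Fin 3 → E3 → ℝ} {f : E3 → ℝ}
    (H : StableVelocity h τ a) (hτ1 : τ ≤ 1) (hf : Continuous f) (hfc : HasCompactSupport f)
    {Ψ : ℝ × E3 → ℝ} (hΨ : Continuous Ψ) (hc : HasCompactSupport Ψ)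
    (h0 : ∀ p : ℝ × E3, p.1 ≤ 0 → Ψ p = 0) (hT : ∀ p : ℝ × E3, T - 1 < p.1 → Ψ p = 0)
    (hF : Integrable (fun p : ℝ × E3 => schemeField h τ a f p
        * ∑ i, diffQuot (spaceDir i) (-h) (diffQuot (spaceDir i) h Ψ) p
      + ∑ i, schemeGrad h τ a f i p
        * (a ⌊p.1 / τ⌋₊ i p.2 * ((Ψ p + Ψ (p + h • spaceDir i)) / 2))) (slab T)) :
    ∫ p, schemeField h τ a f p * diffQuot timeDir (-τ) Ψ p ∂slab T
      = - ∫ p : ℝ × E3, (schemeField h τ a f p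
        * ∑ i, diffQuot (spaceDir i) (-h) (diffQuot (spaceDir i) h Ψ) p
      + ∑ i, schemeGrad h τ a f i p
        * (a ⌊p.1 / τ⌋₊ i p.2 * ((Ψ p + Ψ (p + h • spaceDir i)) / 2))) ∂slab T := by
  have hu (n : ℕ) := H.continuous_eulerScheme hf n
  have huc (n : ℕ) := StableVelocity.hasCompactSupport_eulerScheme (h := h) (τ := τ) (a := a) hfc n
  have hΨ' : Continuous fun p : ℝ × E3 => Ψ (p + (-τ) • timeDir) := by fun_prop
  have hc' : HasCompactSupport fun p : ℝ × E3 => Ψ (p + (-τ) • timeDir) :=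
    hc.comp_homeomorph (Homeomorph.addRight _)
  have i1 := integrable_comp_floor_mul H.τ_pos hu huc hΨ hc T
  have i2 := integrable_comp_floor_mul H.τ_pos hu huc hΨ' hc' T
  have i3 := integrable_comp_floor_mul H.τ_pos (u := fun n => eulerScheme h τ a f (n + 1))
    (fun n => hu _) (fun n => huc _) hΨ hc T
  -- Summation by parts in time: the backward difference on `Ψ` becomes a forward step of the
  -- scheme, without initial term because `Ψ` vanishes at nonpositive times.
  have e1 (p : ℝ × E3) : schemeField h τ a f p * diffQuot timeDir (-τ) Ψ p
      = -τ⁻¹ * (eulerScheme h τ a f ⌊p.1 / τ⌋₊ p.2 * Ψ (p + (-τ) • timeDir)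
        - eulerScheme h τ a f ⌊p.1 / τ⌋₊ p.2 * Ψ p) := by
    simp only [schemeField, diffQuot, smul_eq_mul, inv_neg]; ring
  simp only [e1]
  rw [integral_const_mul, integral_sub i2 i1,
    ← integral_slab_succ_mul H.τ_pos hτ1 hu huc hΨ hc h0 hT, ← integral_sub i3 i1]
  have i4 : Integrable (fun p : ℝ × E3 => eulerScheme h τ a f (⌊p.1 / τ⌋₊ + 1) p.2 * Ψ p
      - eulerScheme h τ a f ⌊p.1 / τ⌋₊ p.2 * Ψ p) (slab T) := i3.sub i1
  rw [slab] at i4 hF ⊢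
  rw [integral_prod _ i4, integral_prod _ hF]
  have e2 (s : ℝ) : ∫ x, (eulerScheme h τ a f (⌊s / τ⌋₊ + 1) x * Ψ (s, x)
      - eulerScheme h τ a f ⌊s / τ⌋₊ x * Ψ (s, x))
      = τ * ∫ x, (schemeField h τ a f (s, x)
        * ∑ i, diffQuot (spaceDir i) (-h) (diffQuot (spaceDir i) h Ψ) (s, x)
      + ∑ i, schemeGrad h τ a f i (s, x)
        * (a ⌊s / τ⌋₊ i x * ((Ψ (s, x) + Ψ ((s, x) + h • spaceDir i)) / 2))) := by
    have hsl : Continuous fun x => Ψ (s, x) := by fun_prop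
    have h1 := integral_eulerStep_sub_mul (τ := τ) H.h_pos (H.continuous ⌊s / τ⌋₊)
      (H.divFree ⌊s / τ⌋₊) (hu ⌊s / τ⌋₊) (huc ⌊s / τ⌋₊) hsl
    simp only [discreteLaplacian_eq_sum] at h1
    have e3 (i : Fin 3) (x : E3) : (s, x) + h • spaceDir i = (s, x + h • stdVec i) := by
      simp [spaceDir]
    have e4 (i : Fin 3) (x : E3) : diffQuot (spaceDir i) (-h) (diffQuot (spaceDir i) h Ψ) (s, x)
        = diffQuot (stdVec i) (-h) (diffQuot (stdVec i) h fun x => Ψ (s, x)) x := by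
      rw [diffQuot_spaceDir]
      simp only [diffQuot_spaceDir]
    simp only [e3, e4, schemeField, schemeGrad]
    rw [← h1]
    congr 1; ext x
    simp only [eulerScheme]
    ring
  have e5 := integral_const_mul τ (fun s => ∫ x, (schemeField h τ a f (s, x)
        * ∑ i, diffQuot (spaceDir i) (-h) (diffQuot (spaceDir i) h Ψ) (s, x)
      + ∑ i, schemeGrad h τ a f i (s, x)
        * (a ⌊s / τ⌋₊ i x * ((Ψ (s, x) + Ψ ((s, x) + h • spaceDir i)) / 2))))
        (μ := volume.restrict (Ioc 0 T))
  simp only [e2]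
  rw [e5, ← mul_assoc, neg_mul, inv_mul_cancel₀ H.τ_pos.ne', neg_one_mul]

namespace SchemeLimit

variable {v : ℝ × E3 → E3} {B : Fin 3 → ℝ} {h τ : ℕ → ℝ} {a : ℕ → ℕ → Fin 3 → E3 → ℝ}
  {f : E3 → ℝ} {M : ℝ} {φ : ℝ × E3 → ℝ} {Dφ : Fin 3 → ℝ × E3 → ℝ} {Ψ : ℝ × E3 → ℝ}

lemma closedBall_subset_univ_prod (R : ℝ) :
    Metric.closedBall (0 : ℝ × E3) R ⊆ univ ×ˢ Metric.closedBall (0 : E3) R := fun p hp => by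
  rw [mem_closedBall_zero_iff] at hp
  exact ⟨mem_univ _, by rw [mem_closedBall_zero_iff]; exact (norm_snd_le p).trans hp⟩

/-- The limit solves the equation, tested against functions on space-time. -/
lemma integral_equation (L : SchemeLimit v B h τ a f M φ Dφ)
    (hΨ : ContDiff ℝ ((⊤ : ℕ∞) : WithTop ℕ∞) Ψ) (hc : HasCompactSupport Ψ) {T : ℝ}
    (h0 : ∀ p : ℝ × E3, p.1 ≤ 0 → Ψ p = 0) (hT : ∀ p : ℝ × E3, T - 1 < p.1 → Ψ p = 0) :
    (∫ p, φ p * fderiv ℝ Ψ p timeDir ∂slab T) + (∫ p, φ p * spaceLaplacian Ψ p ∂slab T)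
      + ∑ i, ∫ p, Dφ i p * (v p i * Ψ p) ∂slab T = 0 := by
  obtain ⟨R, hR⟩ := hc.exists_tsupport_subset
  have A := L.toApproximatingVelocity
  have hΨ1 : ContDiff ℝ 1 Ψ := hΨ.of_le (mod_cast le_top)
  have hτ0 (k : ℕ) := (L.stable k).τ_pos
  have hh0 (k : ℕ) := (L.stable k).h_pos
  have b1 := (BoundedTendsto.diffQuot (μ := slab T) (r := fun k => - τ k) hΨ1 hc hR
    norm_timeDir.le (by simpa using A.tendsto_τ.neg) (fun k => neg_ne_zero.2 (hτ0 k).ne')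
    (fun k => by rw [abs_neg, abs_of_pos (hτ0 k)]; exact A.τ_le_one k)).mono_set
    (closedBall_subset_univ_prod _)
  have b2 := (BoundedTendsto.finset_sum Finset.univ fun (i : Fin 3) _ =>
    BoundedTendsto.diffQuot_diffQuot (μ := slab T) (contDiff_two_of_smooth hΨ) hc hR
      (norm_spaceDir i).le A.tendsto_h (fun k => (hh0 k).ne') (abs_h_le A)).mono_set
    (closedBall_subset_univ_prod _)
  have b3 (i : Fin 3) := (BoundedTendsto.average_shift (μ := slab T) hΨ.continuous hc hR
    (norm_spaceDir i).le A.tendsto_h (abs_h_le A)).mono_set (closedBall_subset_univ_prod _)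
  have key := ((L.tendsto_integral_field b1).add (L.tendsto_integral_field b2)).add
    (tendsto_finsetSum Finset.univ fun i _ => L.tendsto_integral_transport (b3 i) i)
  refine tendsto_nhds_unique key (tendsto_const_nhds.congr fun k => ?_)
  have j1 : Integrable (fun p : ℝ × E3 => schemeField (h k) (τ k) (a k) f p
      * ∑ i, diffQuot (spaceDir i) (-h k) (diffQuot (spaceDir i) (h k) Ψ) p) (slab T) :=
    (L.memLp_schemeField T k).1.integrable_mul (b2.memLp_seq (measurableSet_univ_prod_closedBall _)
      (slab_univ_prod_closedBall_ne_top T _) k)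
  have j2 (i : Fin 3) : Integrable (fun p : ℝ × E3 => schemeGrad (h k) (τ k) (a k) f i p
        * (a k ⌊p.1 / τ k⌋₊ i p.2 * ((Ψ p + Ψ (p + h k • spaceDir i)) / 2))) (slab T) :=
    (L.memLp_schemeGrad T k i).1.integrable_mul (L.memLp_velocity_mul (b3 i) k i)
  have j3 := integrable_finsetSum Finset.univ fun i _ => j2 i
  rw [(L.stable k).integral_diffQuot_timeDir (A.τ_le_one k) L.contDiff.continuous
    L.hasCompactSupport hΨ.continuous hc h0 hT (j1.add j3), integral_add j1 j3,
    integral_finsetSum _ fun i _ => j2 i]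
  ring

end SchemeLimit

/-! ### From limits on slabs to the distributional solution -/

/-- The set where the bound fails is open by continuity and null, hence empty; the scheme needs the
bound at every point. -/
lemma abs_le_toReal_eLpNorm_top {f : E3 → ℝ} (hf : Continuous f) (hfin : eLpNorm f ∞ volume ≠ ∞)
    (x : E3) : |f x| ≤ (eLpNorm f ∞ volume).toReal := by
  set M := (eLpNorm f ∞ volume).toReal
  have h1 : ∀ᵐ x, |f x| ≤ M := by
    filter_upwards [ae_le_eLpNormEssSup (f := f) (μ := volume)] with x hx
    rw [← eLpNorm_exponent_top] at hx
    have := ENNReal.toReal_mono hfin hx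
    rwa [toReal_enorm, Real.norm_eq_abs] at this
  have h2 : IsOpen {x | M < |f x|} := isOpen_lt continuous_const hf.abs
  have h3 : {x | M < |f x|} = ∅ := by
    rw [← h2.measure_eq_zero_iff (μ := volume)]
    simpa only [ae_iff, not_le] using h1
  by_contra hx
  have : x ∈ {x | M < |f x|} := not_le.1 hx
  simp [h3] at this

lemma slab_restrict_univ_prod (T : ℝ) (K : Set E3) :
    (slab T).restrict (univ ×ˢ K) = (volume.restrict (Ioc 0 T)).prod (volume.restrict K) := by
  rw [slab, ← Measure.prod_restrict, Measure.restrict_univ]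

lemma locallyIntegrableOn_of_slab {F : ℝ × E3 → ℝ}
    (hF : ∀ T R, Integrable F ((slab T).restrict (univ ×ˢ Metric.closedBall (0 : E3) R))) :
    LocallyIntegrableOn F (Ici (0 : ℝ) ×ˢ (univ : Set E3)) := by
  intro p hp
  set T := p.1 + 1
  set R := ‖p.2‖ + 1
  refine ⟨(Ici (0 : ℝ) ×ˢ univ) ∩ (Iio T ×ˢ Metric.ball 0 R), ?_, ?_⟩
  · refine inter_mem_nhdsWithin _ ((isOpen_Iio.prod Metric.isOpen_ball).mem_nhds ⟨?_, ?_⟩)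
    · simp [T]
    · simp [R]
  · rw [prod_inter_prod, univ_inter, Ici_inter_Iio]
    have e : (volume : Measure (ℝ × E3)).restrict (Ico 0 T ×ˢ Metric.ball 0 R)
        = (slab T).restrict (univ ×ˢ Metric.ball (0 : E3) R) := by
      rw [slab_restrict_univ_prod, Measure.volume_eq_prod, ← Measure.prod_restrict,
        Measure.restrict_congr_set Ico_ae_eq_Ioc]
    rw [IntegrableOn, e]
    exact (hF T R).mono_measure
      (Measure.restrict_mono (Set.prod_mono le_rfl Metric.ball_subset_closedBall) le_rfl)

lemma locallyIntegrableOn_of_memLp_slab {F : ℝ × E3 → ℝ} (hF : ∀ T, MemLp F 2 (slab T)) :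
    LocallyIntegrableOn F (Ici (0 : ℝ) ×ˢ (univ : Set E3)) := by
  refine locallyIntegrableOn_of_slab fun T R => ?_
  have : IsFiniteMeasure ((slab T).restrict (univ ×ˢ Metric.closedBall (0 : E3) R)) :=
    ⟨by simpa using (SchemeLimit.slab_univ_prod_closedBall_ne_top T R).lt_top⟩
  exact ((hF T).restrict _).integrable (by norm_num)

lemma spaceTime_subset : (spaceTime : Set (ℝ × E3)) ⊆ Ici (0 : ℝ) ×ˢ (univ : Set E3) :=
  prod_mono Ioi_subset_Ici_self le_rfl

lemma integral_eq_slab {F : ℝ × E3 → ℝ} {T : ℝ} (h : ∀ p : ℝ × E3, p.1 ∉ Ioc 0 T → F p = 0) :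
    ∫ p, F p = ∫ p, F p ∂slab T := by
  rw [slab_eq_restrict]
  refine (setIntegral_eq_integral_of_forall_compl_eq_zero fun p hp => h p fun h' => hp ?_).symm
  exact ⟨h', mem_univ _⟩

/-- Test functions on the half space-time vanish outside of a bounded time interval. -/
lemma exists_time_support (Ψ : 𝓓(spaceTime, ℝ)) :
    ∃ T : ℝ, ∀ p : ℝ × E3, p.1 ∉ Ioc 0 (T - 1) → p ∉ tsupport Ψ := by
  obtain ⟨R, hR⟩ := Ψ.hasCompactSupport.exists_tsupport_subset
  refine ⟨R + 1, fun p hp hpΨ => hp ⟨(Ψ.tsupport_subset hpΨ).1, ?_⟩⟩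
  have h1 := hR hpΨ
  rw [mem_closedBall_zero_iff] at h1
  have h2 := (norm_fst_le p).trans h1
  rw [Real.norm_eq_abs] at h2
  linarith [le_abs_self p.1]

lemma fderiv_apply_eq_zero_of_notMem_tsupport {V : Type*} [NormedAddCommGroup V] [NormedSpace ℝ V]
    {Ψ : V → ℝ} {p : V} (h : p ∉ tsupport Ψ) (d : V) : fderiv ℝ Ψ p d = 0 :=
  image_eq_zero_of_notMem_tsupport (f := fun x => fderiv ℝ Ψ x d)
    fun h' => h (tsupport_fderiv_apply_subset ℝ d h')

lemma spaceLaplacian_eq_zero_of_notMem_tsupport {Ψ : ℝ × E3 → ℝ} {p : ℝ × E3}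
    (h : p ∉ tsupport Ψ) : spaceLaplacian Ψ p = 0 :=
  Finset.sum_eq_zero fun i _ => fderiv_apply_eq_zero_of_notMem_tsupport
    (fun h' => h (tsupport_fderiv_apply_subset ℝ (spaceDir i) h')) _

lemma hasWeakDerivOn_spaceTime {F G : ℝ × E3 → ℝ} (hF : ∀ T, MemLp F 2 (slab T))
    (hG : ∀ T, MemLp G 2 (slab T)) {d : ℝ × E3}
    (h : ∀ Ψ : ℝ × E3 → ℝ, ContDiff ℝ ((⊤ : ℕ∞) : WithTop ℕ∞) Ψ → HasCompactSupport Ψ → ∀ T,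
      ∫ p, G p * Ψ p ∂slab T = - ∫ p, F p * fderiv ℝ Ψ p d ∂slab T) :
    HasWeakDerivOn spaceTime d F G := by
  refine ⟨(locallyIntegrableOn_of_memLp_slab hF).mono_set spaceTime_subset,
    (locallyIntegrableOn_of_memLp_slab hG).mono_set spaceTime_subset, fun Ψ => ?_⟩
  obtain ⟨T, hT⟩ := exists_time_support Ψ
  have hT' (p : ℝ × E3) (hp : p.1 ∉ Ioc 0 T) : p ∉ tsupport Ψ :=
    hT p fun h' => hp ⟨h'.1, by linarith [h'.2]⟩
  rw [integral_eq_slab (T := T) fun p hp => by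
      rw [fderiv_apply_eq_zero_of_notMem_tsupport (hT' p hp), zero_smul],
    integral_eq_slab (T := T) fun p hp => by
      rw [image_eq_zero_of_notMem_tsupport (hT' p hp), zero_smul]]
  have := h Ψ Ψ.contDiff Ψ.hasCompactSupport T
  simp only [smul_eq_mul]
  simp only [mul_comm (Ψ _), this, neg_neg, mul_comm (fderiv ℝ Ψ _ _)]

namespace SchemeLimit

variable {v : ℝ × E3 → E3} {B : Fin 3 → ℝ} {h τ : ℕ → ℝ} {a : ℕ → ℕ → Fin 3 → E3 → ℝ}
  {f : E3 → ℝ} {M : ℝ} {φ : ℝ × E3 → ℝ} {Dφ : Fin 3 → ℝ × E3 → ℝ} {U : Ultrafilter ℕ}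
  {u : ℝ → E3 → ℝ} {w : Fin 3 → ℝ → E3 → ℝ}

lemma ae_slab_eq {v₀ : ℝ → E3 → E3} (hv : v =ᵐ[halfSpaceTime] Function.uncurry v₀) (T : ℝ) :
    ∀ᵐ p ∂slab T, v₀ p.1 p.2 = v p := by
  filter_upwards [hv.filter_mono (ae_mono (slab_le_halfSpaceTime T))] with p hp
  rw [hp]
  rfl

lemma integrable_mul_apply (L : SchemeLimit v B h τ a f M φ Dφ) (i : Fin 3) (T R : ℝ) :
    Integrable (fun p => v p i * Dφ i p)
      ((slab T).restrict (univ ×ˢ Metric.closedBall (0 : E3) R)) :=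
  (L.memLp_apply i T measure_closedBall_lt_top.ne).integrable_mul ((L.memLp_grad i T).restrict _)

lemma integrable_transportTerm (L : SchemeLimit v B h τ a f M (Function.uncurry u)
      fun j => Function.uncurry (w j)) {v₀ : ℝ → E3 → E3}
    (hv : v =ᵐ[halfSpaceTime] Function.uncurry v₀) (T R : ℝ) :
    Integrable (transportTerm v₀ w)
      ((slab T).restrict (univ ×ˢ Metric.closedBall (0 : E3) R)) := by
  have h1 := integrable_finsetSum Finset.univ fun (i : Fin 3) _ => L.integrable_mul_apply i T R
  refine h1.congr (ae_restrict_of_ae ?_)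
  filter_upwards [ae_slab_eq hv T] with p hp
  simp only [transportTerm, hp]
  rfl

/-- The limit of the scheme is a distributional solution. -/
lemma isDistributionalSolution (L : SchemeLimit v B h τ a f M (Function.uncurry u)
      fun j => Function.uncurry (w j))
    (S : Slices v h τ a f M B (Function.uncurry u) (fun j => Function.uncurry (w j)) U u w)
    {v₀ : ℝ → E3 → E3} (hv : v =ᵐ[halfSpaceTime] Function.uncurry v₀) :
    IsDistributionalSolution v₀ f u w where
  locallyIntegrable := locallyIntegrableOn_of_memLp_slab L.memLp
  weakDeriv j := hasWeakDerivOn_spaceTime L.memLp (L.memLp_grad j)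
    fun Ψ hΨ hc T => L.integral_grad_mul hΨ hc T j
  locallyIntegrable_transport :=
    locallyIntegrableOn_of_slab fun T R => L.integrable_transportTerm hv T R
  equation Ψ := by
    obtain ⟨T, hT⟩ := exists_time_support Ψ
    have hT' (p : ℝ × E3) (hp : p.1 ∉ Ioc 0 T) : p ∉ tsupport Ψ :=
      hT p fun h' => hp ⟨h'.1, by linarith [h'.2]⟩
    have key := L.integral_equation (Ψ := Ψ) (T := T) Ψ.contDiff Ψ.hasCompactSupport
      (fun p hp => image_eq_zero_of_notMem_tsupport (hT p fun h' => not_lt.2 hp h'.1))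
      (fun p hp => image_eq_zero_of_notMem_tsupport (hT p fun h' => not_le.2 hp h'.2))
    obtain ⟨R, hR⟩ := Ψ.hasCompactSupport.exists_tsupport_subset
    have hΨ1 : ContDiff ℝ 1 Ψ := Ψ.contDiff.of_le (mod_cast le_top)
    have i1 : Integrable (fun p => Function.uncurry u p * fderiv ℝ Ψ p timeDir) (slab T) :=
      (L.memLp T).integrable_mul (memLp_slab_of_continuous (continuous_fderiv_apply hΨ1 _)
        (Ψ.hasCompactSupport.fderiv_apply ℝ _) T)
    have i2 : Integrable (fun p => Function.uncurry u p * spaceLaplacian Ψ p) (slab T) := by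
      refine (L.memLp T).integrable_mul (memLp_slab_of_continuous ?_ ?_ T)
      · exact continuous_finsetSum _ fun i _ =>
          continuous_fderiv_fderiv_apply (contDiff_two_of_smooth Ψ.contDiff) _ _
      · exact hasCompactSupport_finset_sum _ fun i _ =>
          (Ψ.hasCompactSupport.fderiv_apply ℝ _).fderiv_apply ℝ _
    have hb := (BoundedTendsto.shift (μ := slab T) (r := fun _ => 0) Ψ.continuous
      Ψ.hasCompactSupport hR norm_timeDir.le tendsto_const_nhds (by simp)).mono_set
      (closedBall_subset_univ_prod _)
    have i3 (i : Fin 3) : Integrable (fun p => Function.uncurry (w i) p * (v p i * Ψ p)) (slab T) :=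
      (L.memLp_grad i T).integrable_mul (L.memLp_mul_lim hb i)
    rw [integral_eq_slab (T := T) fun p hp => by
      -- All three terms of the integrand vanish off the support of `Ψ`, so the integral lives on a
      -- slab.
      rw [fderiv_apply_eq_zero_of_notMem_tsupport (hT' p hp),
        image_eq_zero_of_notMem_tsupport (hT' p hp),
        spaceLaplacian_eq_zero_of_notMem_tsupport (hT' p hp)]
      ring]
    have e : ∫ p : ℝ × E3, (-(u p.1 p.2 * fderiv ℝ Ψ p timeDir) - transportTerm v₀ w p * Ψ p
        - u p.1 p.2 * spaceLaplacian Ψ p) ∂slab T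
        = ∫ p, (-1) * (Function.uncurry u p * fderiv ℝ Ψ p timeDir
          + Function.uncurry u p * spaceLaplacian Ψ p
          + ∑ i, Function.uncurry (w i) p * (v p i * Ψ p)) ∂slab T := by
      refine integral_congr_ae ?_
      filter_upwards [ae_slab_eq hv T] with p hp
      simp only [transportTerm, hp, Function.uncurry, Fin.sum_univ_three]
      ring
    have i4 : Integrable (fun p => Function.uncurry u p * fderiv ℝ Ψ p timeDir
          + Function.uncurry u p * spaceLaplacian Ψ p) (slab T) := i1.add i2
    rw [e, integral_const_mul, integral_add i4 (integrable_finsetSum _ fun i _ => i3 i),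
      integral_add i1 i2, integral_finsetSum _ fun i _ => i3 i, key, mul_zero]
  locallyIntegrable_slice t ht := (S.memLp t ht).locallyIntegrable (by norm_num)
  continuousOn ψ := by
    refine (L.continuous_pairing (contDiff_two_of_smooth ψ.contDiff)
      ψ.hasCompactSupport).continuousOn.congr fun t ht => ?_
    exact S.integral_mul t ht ψ ψ.contDiff ψ.hasCompactSupport
  initial := by
    refine ae_eq_of_integral_contDiff_smul_eq ((S.memLp 0 le_rfl).locallyIntegrable (by norm_num))
      L.contDiff.continuous.locallyIntegrable fun g hg hgc => ?_
    have h1 := S.integral_mul 0 le_rfl g hg hgc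
    rw [pairing_zero] at h1
    simpa only [smul_eq_mul, mul_comm] using h1

lemma Slices.hasWeakDerivOn (S : Slices v h τ a f M B φ Dφ U u w) {t : ℝ} (ht : 0 ≤ t) (j : Fin 3) :
    HasWeakDerivOn (⊤ : Opens E3) (stdVec j) (u t) (w j t) := by
  refine ⟨((S.memLp t ht).locallyIntegrable (by norm_num)).locallyIntegrableOn _,
    ((S.memLp_grad t ht j).locallyIntegrable (by norm_num)).locallyIntegrableOn _, fun ψ => ?_⟩
  have h1 := S.integral_grad_mul t ht j ψ ψ.contDiff ψ.hasCompactSupport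
  simp only [smul_eq_mul]
  simp only [mul_comm (ψ _), h1, neg_neg, mul_comm (fderiv ℝ ψ _ _)]

end SchemeLimit

/-! ### Assembly of the theorem -/

theorem theorem2 (v : ℝ → E3 → E3) (Dv : Fin 3 → ℝ → E3 → E3)
    (hv : MemL2HomSobolev v Dv) (hdiv : IsDivergenceFree v)
    (φ₀ : 𝓓((⊤ : Opens E3), ℝ)) :
    ∃ (φ : ℝ → E3 → ℝ) (Dφ : Fin 3 → ℝ → E3 → ℝ) (DDφ : Fin 3 → Fin 3 → ℝ → E3 → ℝ),
      IsDistributionalSolution v φ₀ φ Dφ ∧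
      (∀ t, 0 < t → ∀ j, HasWeakDerivOn (⊤ : Opens E3) (stdVec j) (φ t) (Dφ j t)) ∧
      (∀ i j, HasWeakDerivOn spaceTime (spaceDir i)
        (Function.uncurry (Dφ j)) (Function.uncurry (DDφ i j))) ∧
      (∀ t, 0 < t → eLpNorm (φ t) ∞ volume ≤ eLpNorm φ₀ ∞ volume) ∧
      (∀ t, 0 < t → ∀ j,
        eLpNorm (Dφ j t) 2 volume ^ 2
            + ∫⁻ s in Ioc 0 t, ∑ i, eLpNorm (DDφ i j s) 2 volume ^ 2
          ≤ eLpNorm (fun x => fderiv ℝ φ₀ x (stdVec j)) 2 volume ^ 2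
            + eLpNorm φ₀ ∞ volume ^ 2
              * eLpNorm (Function.uncurry (Dv j)) 2
                  (volume.restrict (spaceTime : Set (ℝ × E3))) ^ 2) := by
  have hfin : eLpNorm φ₀ ∞ volume ≠ ∞ :=
    (φ₀.continuous.memLp_of_hasCompactSupport φ₀.hasCompactSupport).eLpNorm_lt_top.ne
  set M := (eLpNorm φ₀ ∞ volume).toReal with hM
  have hMle : ∀ x, |φ₀ x| ≤ M := abs_le_toReal_eLpNorm_top φ₀.continuous hfin
  have hsmooth : ContDiff ℝ ((⊤ : ℕ∞) : WithTop ℕ∞) φ₀ := φ₀.contDiff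
  have hC1 : ContDiff ℝ 1 φ₀ := hsmooth.of_le (mod_cast le_top)
  obtain ⟨v', h, τ, a, hv'm, hvv', hK, A⟩ := exists_approximatingVelocity hv hdiv
  set B : Fin 3 → ℝ := fun j => (∫⁻ p, ‖Function.uncurry (Dv j) p‖ₑ ^ 2 ∂halfSpaceTime).toReal
  obtain ⟨θ, ψ, Dψ, hθ, hψ, hDψ, hψt, hDψt⟩ :=
    A.exists_subseq_tendstoWeakL2 hC1 φ₀.hasCompactSupport hMle
  have L₀ : SchemeLimit v' B (h ∘ θ) (τ ∘ θ) (a ∘ θ) φ₀ M ψ Dψ :=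
    { A.comp_subseq hθ with
      measurable := hv'm
      lintegral_lt_top := hK
      contDiff := hsmooth
      hasCompactSupport := φ₀.hasCompactSupport
      abs_le := hMle
      memLp := hψ
      memLp_grad := hDψ
      tendsto_field := hψt
      tendsto_grad := hDψt }
  -- Being finer than `atTop`, the ultrafilter inherits all limits already known along the
  -- subsequence.
  have hU : (hyperfilter ℕ : Filter ℕ) ≤ atTop := Nat.hyperfilter_le_atTop
  obtain ⟨u, w, S₀⟩ := L₀.exists_slices hU
  have L := L₀.of_slices S₀
  have S := L₀.slices_of_slices S₀
  -- Taken along the same ultrafilter as the slices, so that both terms of the energy inequality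
  -- pass to the limit together.
  obtain ⟨z, hz⟩ := L.exists_hess (hyperfilter ℕ)
  refine ⟨u, w, fun i j s x => z i j (s, x), L.isDistributionalSolution S hvv',
    fun t ht j => S.hasWeakDerivOn ht.le j, fun i j => ?_, fun t ht => ?_, fun t ht j => ?_⟩
  · exact hasWeakDerivOn_spaceTime (L.memLp_grad j)
      (fun T => (hz i j).2.1.mono_measure (slab_le_halfSpaceTime T))
      fun Ψ hΨ hc T => L.integral_hess_mul hU (hz i j).2.2 hΨ hc T
  · refine (eLpNorm_le_of_ae_bound (L.ae_abs_slice_le S ht.le)).trans ?_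
    rw [ENNReal.toReal_top, inv_zero, ENNReal.rpow_zero, one_mul, hM,
      ENNReal.ofReal_toReal hfin]
  · have key := L.energy_limit S hU (fun i j => (hz i j).2.1) (fun i j => (hz i j).2.2) ht.le j
    have hzm (i : Fin 3) : MemLp (z i j) 2 (slab t) :=
      (hz i j).2.1.mono_measure (slab_le_halfSpaceTime t)
    have hBfin : ∫⁻ p, ‖Function.uncurry (Dv j) p‖ₑ ^ 2 ∂halfSpaceTime ≠ ∞ := by
      rw [halfSpaceTime_eq_restrict, ← eLpNorm_two_sq]
      exact (ENNReal.pow_lt_top (hv.memLp j).eLpNorm_lt_top).ne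
    have e1 : ∫⁻ s in Ioc 0 t, ∑ i, eLpNorm (fun x => z i j (s, x)) 2 volume ^ 2
        = ENNReal.ofReal (∑ i, ∫ p, z i j p ^ 2 ∂slab t) := by
      simp only [eLpNorm_two_sq]
      have hm (i : Fin 3) : Measurable fun p => ‖z i j p‖ₑ ^ 2 :=
        (hz i j).1.measurable.enorm.pow_const 2
      rw [lintegral_finsetSum _ fun i _ => (hm i).lintegral_prod_right',
        ENNReal.ofReal_sum_of_nonneg fun i _ => integral_nonneg fun p => sq_nonneg _]
      refine Finset.sum_congr rfl fun i _ => ?_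
      rw [← lintegral_enorm_sq_eq_ofReal_integral (hzm i), slab, lintegral_prod _ (hm i).aemeasurable]
    have e2 : MemLp (fun x => fderiv ℝ φ₀ x (stdVec j)) 2 volume :=
      memLp_two_of_hasCompactSupport (continuous_fderiv_apply hC1 _)
        (φ₀.hasCompactSupport.fderiv_apply ℝ _)
    rw [e1, eLpNorm_two_sq, eLpNorm_two_sq, eLpNorm_two_sq, ← halfSpaceTime_eq_restrict,
      lintegral_enorm_sq_eq_ofReal_integral (S.memLp_grad t ht.le j),
      lintegral_enorm_sq_eq_ofReal_integral e2, ← ENNReal.ofReal_toReal hBfin,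
      ← ENNReal.ofReal_toReal hfin, ← ENNReal.ofReal_pow ENNReal.toReal_nonneg,
      ← ENNReal.ofReal_mul (sq_nonneg _), ← ENNReal.ofReal_add
        (integral_nonneg fun x => sq_nonneg _)
        (Finset.sum_nonneg fun i _ => integral_nonneg fun p => sq_nonneg _),
      ← ENNReal.ofReal_add (integral_nonneg fun x => sq_nonneg _)
        (mul_nonneg (sq_nonneg _) ENNReal.toReal_nonneg)]
    exact ENNReal.ofReal_le_ofReal key
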